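/- Let $\mathbb K$ be an algebraically closed field of characteristic $0$, $M=\mathbb Z^n$ the character lattice of the torus $T=(\mathbb K^*)^n$, and $P\subseteq M_{\mathbb R}=\mathbb R^n$ a full dimensional normal lattice polytope with set of lattice points $\Lambda=P\cap M$. Let $\hat X_P\subseteq \mathbb K^\Lambda$ be the Zariski closure of $\{\sum_{\chi\in\Lambda}c\,\chi(t)e_\chi\mid (c,t)\in\mathbb K^*\times T\}$, with coordinate ring $\mathbb K[\hat X_P]$, graded by the degree of functions, and let $X_P=\mathrm{Proj}\,\mathbb K[\hat X_P]$ be the embedded toric variety. The ring $\mathbb K[\hat X_P]$ has a basis consisting of eigenfunctions $f_{m,\eta}$ of weight $-(m,\eta)$ for $\mathbb K^*\times T$, where $(m,\eta)$ runs over the submonoid of $\mathbb Z\oplus M$ generated by the $(1,\chi)$, $\chi\in\Lambda$; here $f_{m,\eta}$ is the class of any monomial $x_{\chi_1}\cdots x_{\chi_m}$ with $\chi_1+\dots+\chi_m=\eta$. Let $A$ be the set of nonempty faces of $P$ (including $P$), partially ordered by inclusion. For every $\sigma\in A$ let $f_\sigma\in\mathbb K[\hat X_P]$ be a nonzero $\mathbb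 K^*\times T$-eigenfunction of degree $\deg f_\sigma\ge 1$ and weight $-(\deg f_\sigma,\omega_\sigma)$ such that $\omega_\sigma/\deg f_\sigma$ lies in the relative interior of $\sigma$. Fix a total order on $A$ extending the partial order, and order $\mathbb Q^A$ lexicographically: $a<b$ if $a_\sigma<b_\sigma$ for the largest $\sigma\in A$ with $a_\sigma\neq b_\sigma$. For a maximal chain $\mathfrak C$ in $A$ the weights of the $f_\sigma$, $\sigma\in\mathfrak C$, form a basis of $\mathbb Q\oplus M_{\mathbb Q}$. Put $\nu_{\mathfrak C}(g)=\sum_{\sigma\in\mathfrak C}a_\sigma e_\sigma\in\mathbb Q^A$ for an eigenfunction $g\ne0$ whose weight is $\sum_{\sigma\in\mathfrak C}a_\sigma\cdot(\text{weight of }f_\sigma)$, and for general $g\neq 0$ let $\nu_{\mathfrak C}(g)$ be the minimum of the values at the eigencomponents of $g$. Let $\nu(g)=\min_{\mathfrak C}\nu_{\mathfrak C}(g)$ be the quasi-valuation, let $\mathrm{gr}_\nu\mathbb K[\hat X_P]=\bigoplus_{a\in\mathbb Q^A}\{\nu\ge a\}/\{\nu>a\}$ (where $0$ belongs to all these spaces),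 graded by the degree of functions, and let $X_0=\mathrm{Proj}(\mathrm{gr}_\nu\mathbb K[\hat X_P])$. There is a finite set $f_{m_1,\chi_1},\dots,f_{m_p,\chi_p}$ of basis elements of degrees $m_i\ge 1$ which contains all $f_{1,\chi}$, $\chi\in\Lambda$, and whose classes $\bar f_{m_i,\chi_i}$ (in degree $\nu(f_{m_i,\chi_i})$) generate the algebra $\mathrm{gr}_\nu\mathbb K[\hat X_P]$. Fix any such set, grade $\mathbb K[\underline x]=\mathbb K[x_1,\dots,x_p]$ by $\deg x_i=m_i$, let $\theta:\mathbb K[\underline x]\to\mathbb K[\hat X_P]$, $x_i\mapsto f_{m_i,\chi_i}$, and $J=\ker\theta$. Let $\mathrm{in}_\nu$ denote initial terms (sums of the greatest terms) and initial ideals with respect to the global monomial preorder defined by $\deg_Ax^\alpha=(\sum_i\alpha_im_i,\ \sum_i\alpha_i\nu(f_{m_i,\chi_i}))$, where $(m',a')\preceq(m,a)$ if $m'<m$, or $m'=m$ and $a'\ge a$. For $\lambda\in\mathbb Z^p$ let $\mathrm{in}_\lambda$ denote initial terms and initial ideals with respect to the weight $\lambda\cdot\alpha$ of $x^\alpha$.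 Then there is a $\lambda\in\mathbb Z^p$ with $\mathrm{in}_\nu J=\mathrm{in}_\lambda J$. Moreover, for every such $\lambda$ the following holds. For nonzero $f=\sum_\alpha c_\alpha x^\alpha\in\mathbb K[\underline x]$ put $\deg_\lambda f=\max\{\lambda\cdot\alpha\mid c_\alpha\ne0\}$ and $\breve f=\sum_\alpha c_\alpha u^{\deg_\lambda f-\lambda\cdot\alpha}x^\alpha\in\mathbb K[\underline x,u]$ (the $\lambda$-homogenization of $f$). Let $\breve J$ be the ideal generated by all $\breve f$, $f\in J\setminus\{0\}$. It is homogeneous for the grading with $\deg x_i=m_i$, $\deg u=0$. Let $$\breve{\mathfrak X}_P=\mathrm{Proj}(\mathbb K[\underline x,u]/\breve J)\subseteq\mathbb P(m_1,\dots,m_p)\times\mathbb A^1,$$ and let $\pi:\breve{\mathfrak X}_P\to\mathbb A^1=\mathrm{Spec}\,\mathbb K[u]$ be the morphism induced by $\mathbb K[u]\hookrightarrow\mathbb K[\underline x,u]$. Then $\breve{\mathfrak X}_P$ is a variety (integral, separated and of finite type over $\mathbb K$), and (i) $\pi$ is flat and surjective; (ii) the (scheme-theoretic) fibre of $\pi$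 over $0$ is isomorphic to $X_0$ over $\mathbb K$; (iii) $\pi$ is trivial over $\mathbb A^1\setminus\{0\}$ with fibre $X_P$: there is an isomorphism $\pi^{-1}(\mathbb A^1\setminus\{0\})\cong X_P\times_{\mathbb K}(\mathbb A^1\setminus\{0\})$ over $\mathbb A^1\setminus\{0\}$. -/

import Mathlib

open AlgebraicGeometry CategoryTheory CategoryTheory.Limits
open scoped Pointwise DirectSum

universe u

noncomputable section

namespace ToricSeshadri

attribute [local instance] MvPolynomial.weightedGradedAlgebra

/-! ## Generalities on graded algebras -/

section Graded

variable {ι R A B : Type*} [DecidableEq ι] [CommRing R] [CommRing A] [CommRing B]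
  [Algebra R A] [Algebra R B]

theorem isInternal_of_proj (𝒜 : ι → Submodule R A) (p : ι → A →+ A)
    (hsum : ∀ a, ∃ s : Finset ι, ∑ i ∈ s, p i a = a) (hmem : ∀ i a, p i a ∈ 𝒜 i)
    (hproj : ∀ i j a, a ∈ 𝒜 i → p j a = if i = j then a else 0) :
    DirectSum.IsInternal 𝒜 := by
  classical
  constructor
  · rw [injective_iff_map_eq_zero]
    intro x hx
    ext j
    have key : ∀ z : ⨁ i, 𝒜 i, p j (DirectSum.coeAddMonoidHom 𝒜 z) = z j := by
      intro z
      induction z using DirectSum.induction_on with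
      | zero => simp
      | of i y =>
        rw [DirectSum.coeAddMonoidHom_of, hproj i j _ y.2, DirectSum.coe_of_apply]
        split_ifs <;> rfl
      | add x y hx' hy' => simp [hx', hy']
    have h1 := key x
    rw [hx, map_zero] at h1
    simpa using h1.symm
  · intro a
    obtain ⟨s, hs⟩ := hsum a
    refine ⟨∑ i ∈ s, DirectSum.of (fun i => 𝒜 i) i ⟨p i a, hmem i a⟩, ?_⟩
    simpa using hs

variable [AddMonoid ι]

/-- The algebra `A` is graded by the submodules `𝒜 i` as soon as there are projections onto
them. -/
@[reducible] def gradedOfProj (𝒜 : ι → Submodule R A) [SetLike.GradedMonoid 𝒜] (p : ι → A →+ A)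
    (hsum : ∀ a, ∃ s : Finset ι, ∑ i ∈ s, p i a = a) (hmem : ∀ i a, p i a ∈ 𝒜 i)
    (hproj : ∀ i j a, a ∈ 𝒜 i → p j a = if i = j then a else 0) : GradedAlgebra 𝒜 where
  toDecomposition := (isInternal_of_proj 𝒜 p hsum hmem hproj).chooseDecomposition

theorem isInternal_map (𝒜 : ι → Submodule R A) [GradedAlgebra 𝒜] (φ : A →ₐ[R] B)
    (hφ : Function.Surjective φ) (hk : (RingHom.ker φ).IsHomogeneous 𝒜) :
    DirectSum.IsInternal fun i => (𝒜 i).map φ.toLinearMap := by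
  classical
  have key : ∀ x : ⨁ i, ((𝒜 i).map φ.toLinearMap : Submodule R B), ∃ a : A,
      (∀ i, φ (DirectSum.decompose 𝒜 a i) = x i) ∧ φ a = DirectSum.coeAddMonoidHom _ x := by
    intro x
    induction x using DirectSum.induction_on with
    | zero => exact ⟨0, by simp, by simp⟩
    | of j y =>
      obtain ⟨y, a, ha, rfl⟩ := y
      refine ⟨a, fun i => ?_, by simp⟩
      rw [DirectSum.coe_of_apply]
      split_ifs with h
      · subst h
        rw [DirectSum.decompose_of_mem_same 𝒜 ha]; rfl
      · rw [DirectSum.decompose_of_mem_ne 𝒜 ha h]; simp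
    | add x y hx hy =>
      obtain ⟨a, ha, ha'⟩ := hx
      obtain ⟨b, hb, hb'⟩ := hy
      exact ⟨a + b, by simp [DirectSum.decompose_add, ← ha, ← hb], by simp [ha', hb']⟩
  constructor
  · rw [injective_iff_map_eq_zero]
    intro x hx
    obtain ⟨a, ha, ha'⟩ := key x
    have h0 : a ∈ RingHom.ker φ := by rw [RingHom.mem_ker]; exact ha'.trans hx
    ext i
    rw [← ha i]
    exact hk i h0
  · intro b
    obtain ⟨a, rfl⟩ := hφ b
    refine ⟨∑ i ∈ (DirectSum.decompose 𝒜 a).support,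
      DirectSum.of (fun i => ((𝒜 i).map φ.toLinearMap : Submodule R B)) i
        ⟨φ (DirectSum.decompose 𝒜 a i), _, SetLike.coe_mem _, rfl⟩, ?_⟩
    conv_rhs => rw [← DirectSum.sum_support_decompose 𝒜 a]
    simp

/-- The grading induced on the image of a graded algebra under a surjection with homogeneous
kernel. -/
@[reducible] def gradedMap (𝒜 : ι → Submodule R A) [GradedAlgebra 𝒜] (φ : A →ₐ[R] B)
    (hφ : Function.Surjective φ) (hk : (RingHom.ker φ).IsHomogeneous 𝒜) :
    GradedAlgebra fun i => (𝒜 i).map φ.toLinearMap where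
  one_mem := ⟨1, SetLike.GradedOne.one_mem, map_one φ⟩
  mul_mem := by
    rintro i j _ _ ⟨a, ha, rfl⟩ ⟨b, hb, rfl⟩
    exact ⟨a * b, SetLike.GradedMul.mul_mem ha hb, map_mul φ a b⟩
  toDecomposition := (isInternal_map 𝒜 φ hφ hk).chooseDecomposition

/-- The pieces of the grading induced on a quotient `A ⧸ I`. -/
abbrev quotPiece (𝒜 : ι → Submodule R A) (I : Ideal A) (i : ι) : Submodule R (A ⧸ I) :=
  (𝒜 i).map (Ideal.Quotient.mkₐ R I).toLinearMap

@[reducible] def gradedQuot (𝒜 : ι → Submodule R A) [GradedAlgebra 𝒜] (I : Ideal A)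
    (hI : I.IsHomogeneous 𝒜) : GradedAlgebra (quotPiece 𝒜 I) :=
  gradedMap 𝒜 _ (Ideal.Quotient.mkₐ_surjective R I) (by
    have h : RingHom.ker (Ideal.Quotient.mkₐ R I) = I := Ideal.Quotient.mkₐ_ker R I
    rwa [h])

/-- The kernel of a degree-preserving homomorphism is homogeneous. -/
theorem ker_isHomogeneous (𝒜 : ι → Submodule R A) [GradedAlgebra 𝒜] (ℬ : ι → Submodule R B)
    [GradedAlgebra ℬ] (φ : A →ₐ[R] B) (h : ∀ i, ∀ a ∈ 𝒜 i, φ a ∈ ℬ i) :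
    (RingHom.ker φ).IsHomogeneous 𝒜 := by
  classical
  have key : ∀ a i, φ (DirectSum.decompose 𝒜 a i) = DirectSum.decompose ℬ (φ a) i := by
    intro a i
    induction a using DirectSum.Decomposition.inductionOn 𝒜 with
    | zero => simp
    | @homogeneous j m =>
      by_cases hij : j = i
      · subst hij
        rw [DirectSum.decompose_of_mem_same 𝒜 m.2, DirectSum.decompose_of_mem_same ℬ (h _ _ m.2)]
      · rw [DirectSum.decompose_of_mem_ne 𝒜 m.2 hij,
          DirectSum.decompose_of_mem_ne ℬ (h _ _ m.2) hij, map_zero]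
    | add a b ha hb => simp [DirectSum.decompose_add, ha, hb]
  intro i a ha
  rw [RingHom.mem_ker] at ha ⊢
  rw [key, ha]
  simp

end Graded

/-- The structure morphism of `Proj` of a graded `R`-algebra. -/
def projStr {R A : Type u} [CommRing R] [CommRing A] [Algebra R A] (𝒜 : ℕ → Submodule R A)
    [GradedAlgebra 𝒜] : Proj 𝒜 ⟶ Spec (.of R) :=
  Proj.toSpecZero 𝒜 ≫ Spec.map (CommRingCat.ofHom (algebraMap R (𝒜 0)))


/-! ## Normal lattice polytopes and embedded toric varieties

The character lattice of the torus `T = (Kˣ)ⁿ` is `M = ℤⁿ`, and `M_ℝ = ℝⁿ`. -/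

/-- A lattice point, viewed in `M_ℝ`. -/
def latticePt {n : ℕ} (χ : Fin n → ℤ) : Fin n → ℝ := fun i => (χ i : ℝ)

/-- A full dimensional normal lattice polytope in `M_ℝ`. -/
structure NormalPolytope (n : ℕ) where
  carrier : Set (Fin n → ℝ)
  lattice : ∃ s : Finset (Fin n → ℤ), s.Nonempty ∧
    carrier = convexHull ℝ (latticePt '' (s : Set (Fin n → ℤ)))
  fullDim : affineSpan ℝ carrier = ⊤
  normal : ∀ (k l : ℕ) (χ : Fin n → ℤ), latticePt χ ∈ ((k + l : ℕ) : ℝ) • carrier →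
    ∃ χ₁ χ₂ : Fin n → ℤ, latticePt χ₁ ∈ (k : ℝ) • carrier ∧ latticePt χ₂ ∈ (l : ℝ) • carrier ∧
      χ₁ + χ₂ = χ

/-- The character lattice `ℤ ⊕ M` of the torus `Kˣ × T`. -/
abbrev Wt (n : ℕ) : Type := ℤ × (Fin n → ℤ)

/-- The torus `Kˣ × T` acting on the affine cone. -/
abbrev BigTorus (K : Type u) [Field K] (n : ℕ) : Type u := Kˣ × (Fin n → Kˣ)

/-- The character of `Kˣ × T` attached to `(m, η) ∈ ℤ ⊕ M`, that is `(c, t) ↦ c ^ m * t ^ η`. -/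
def bigChar (K : Type u) [Field K] {n : ℕ} (l : Wt n) : BigTorus K n →* Kˣ where
  toFun t := t.1 ^ l.1 * ∏ i, t.2 i ^ l.2 i
  map_one' := by simp
  map_mul' s t := by
    simp only [Prod.fst_mul, Prod.snd_mul, Pi.mul_apply, mul_zpow, Finset.prod_mul_distrib]
    exact mul_mul_mul_comm _ _ _ _

variable {n : ℕ}

/-- The set `Λ = P ∩ M` of lattice points of `P`. -/
abbrev LatPts (P : NormalPolytope n) : Type := {χ : Fin n → ℤ // latticePt χ ∈ P.carrier}

/-- The weight `(1, χ)`. -/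
abbrev LatPts.wt {P : NormalPolytope n} (χ : LatPts P) : Wt n := (1, χ.1)

/-- The map `(c, t) ↦ ∑ c χ(t) e_χ` from `Kˣ × T` to `V = K^Λ`; the affine cone over the embedded
toric variety `X_P ⊆ ℙ(V)` is the Zariski closure of its image. -/
def conePt (K : Type u) [Field K] (P : NormalPolytope n) (t : BigTorus K n) : LatPts P → K :=
  fun χ => (bigChar K χ.wt t : K)

/-- The vanishing ideal in `K[V]` of the affine cone over `X_P`. -/
def coneIdeal (K : Type u) [Field K] (P : NormalPolytope n) : Ideal (MvPolynomial (LatPts P) K) :=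
  MvPolynomial.vanishingIdeal K (Set.range (conePt K P))

/-- The coordinate ring of the affine cone over `X_P`, which is the homogeneous coordinate ring of
`X_P ⊆ ℙ(V)`. -/
abbrev CoordRing (K : Type u) [Field K] (P : NormalPolytope n) : Type u :=
  MvPolynomial (LatPts P) K ⧸ coneIdeal K P

section Torus

variable (K : Type u) [Field K] (P : NormalPolytope n)

/-- The action of `Kˣ × T` on `K[V]`, given by `(t • g) x = g (t⁻¹ • x)`. -/
def polyAct (t : BigTorus K n) : MvPolynomial (LatPts P) K →ₐ[K] MvPolynomial (LatPts P) K :=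
  MvPolynomial.aeval fun χ => MvPolynomial.C (bigChar K χ.wt t⁻¹ : K) * MvPolynomial.X χ

theorem polyAct_mem (t : BigTorus K n) (p : MvPolynomial (LatPts P) K) (hp : p ∈ coneIdeal K P) :
    polyAct K P t p ∈ coneIdeal K P := by
  rintro _ ⟨s, rfl⟩
  have h := hp _ ⟨t⁻¹ * s, rfl⟩
  have : (MvPolynomial.aeval (R := K) (conePt K P s)).comp (polyAct K P t) =
      MvPolynomial.aeval (conePt K P (t⁻¹ * s)) := by
    ext χ
    simp [polyAct, conePt]
  rw [← this] at h
  exact h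

/-- The induced action of `Kˣ × T` on the coordinate ring of the affine cone. -/
def torusAct (t : BigTorus K n) : CoordRing K P →ₐ[K] CoordRing K P :=
  Ideal.quotientMapₐ (coneIdeal K P) (polyAct K P t) fun p hp => polyAct_mem K P t p hp

/-- The functions on the affine cone on which `Kˣ × T` acts by the character `-l`, that is, zero
and the eigenfunctions of weight `-l`. (The coordinate function `x_χ` has weight `-(1, χ)`.) -/
def eigenSpace (l : Wt n) : Submodule K (CoordRing K P) where
  carrier := {g | ∀ t, torusAct K P t g = (bigChar K (-l) t : K) • g}
  zero_mem' t := by simp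
  add_mem' {a b} ha hb t := by rw [map_add, ha t, hb t, smul_add]
  smul_mem' c a ha t := by rw [map_smul, ha t, smul_comm]

/-- Pull back of polynomial functions on `V` to the torus `Kˣ × T`, as Laurent polynomials. -/
def toLaurent : MvPolynomial (LatPts P) K →ₐ[K] AddMonoidAlgebra K (Wt n) :=
  MvPolynomial.aeval fun χ => AddMonoidAlgebra.single χ.wt 1

/-- The weight of a monomial. -/
def monWt {P : NormalPolytope n} (a : LatPts P →₀ ℕ) : Wt n := a.sum fun χ k => k • χ.wt

variable {K P}

theorem toLaurent_monomial (a : LatPts P →₀ ℕ) (c : K) :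
    toLaurent K P (MvPolynomial.monomial a c) = AddMonoidAlgebra.single (monWt a) c := by
  rw [toLaurent, MvPolynomial.aeval_monomial, monWt]
  have : (a.prod fun i k => AddMonoidAlgebra.single (LatPts.wt i) (1 : K) ^ k) =
      AddMonoidAlgebra.single (a.sum fun χ k => k • LatPts.wt χ) 1 := by
    induction a using Finsupp.induction with
    | zero => simp; rfl
    | single_add i k f hi hk ih =>
      rw [Finsupp.prod_add_index' (by simp) (by intros; rw [pow_add]),
        Finsupp.sum_add_index' (by simp) (by intros; rw [add_smul]), ih]
      simp [AddMonoidAlgebra.single_pow, AddMonoidAlgebra.single_mul_single]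
  rw [this]
  simp

theorem toLaurent_coeff [DecidableEq (Wt n)] (p : MvPolynomial (LatPts P) K) (l : Wt n) :
    (toLaurent K P p).coeff l = ∑ a ∈ p.support with monWt a = l, p.coeff a := by
  conv_lhs => rw [p.as_sum, map_sum]
  simp only [toLaurent_monomial]
  rw [AddMonoidAlgebra.coeff_sum, Finsupp.finsetSum_apply, Finset.sum_filter]
  refine Finset.sum_congr rfl fun a _ => ?_
  simp [Finsupp.single_apply]

theorem bigChar_injective [CharZero K] : Function.Injective (bigChar K : Wt n → BigTorus K n →* Kˣ) := by
  classical
  have h2 : ∀ a b : ℤ, (Units.mk0 (2 : K) two_ne_zero) ^ a = (Units.mk0 (2 : K) two_ne_zero) ^ b →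
      a = b := by
    intro a b h
    have h' : (2 : K) ^ a = (2 : K) ^ b := by
      have := congrArg (Units.val) h
      simpa using this
    have h3 : ((2 : ℚ) ^ a) = (2 : ℚ) ^ b := by
      have : (((2 : ℚ) ^ a : ℚ) : K) = (((2 : ℚ) ^ b : ℚ) : K) := by push_cast; exact h'
      exact_mod_cast this
    exact zpow_right_injective₀ (by norm_num) (by norm_num) h3
  intro l l' h
  refine Prod.ext ?_ (funext fun i => ?_)
  · have := DFunLike.congr_fun h (Units.mk0 (2 : K) two_ne_zero, 1)
    exact h2 _ _ (by simpa [bigChar] using this)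
  · have := DFunLike.congr_fun h (1, Pi.mulSingle i (Units.mk0 (2 : K) two_ne_zero))
    apply h2
    have aux : ∀ l : Wt n, ∏ j, (Pi.mulSingle i (Units.mk0 (2 : K) two_ne_zero) : Fin n → Kˣ) j ^ l.2 j
        = (Units.mk0 (2 : K) two_ne_zero) ^ l.2 i := by
      intro l
      rw [Finset.prod_eq_single i]
      · simp
      · intro j _ hj
        simp [Pi.mulSingle_eq_of_ne hj]
      · simp
    simpa [bigChar, aux] using this

theorem bigChar_add (l l' : Wt n) (t : BigTorus K n) :
    bigChar K (l + l') t = bigChar K l t * bigChar K l' t := by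
  simp only [bigChar, MonoidHom.coe_mk, OneHom.coe_mk, Prod.fst_add, Prod.snd_add, Pi.add_apply,
    zpow_add, Finset.prod_mul_distrib]
  exact mul_mul_mul_comm _ _ _ _

theorem bigChar_zero (t : BigTorus K n) : bigChar K 0 t = 1 := by simp [bigChar]

theorem bigChar_nsmul (k : ℕ) (l : Wt n) (t : BigTorus K n) :
    bigChar K (k • l) t = bigChar K l t ^ k := by
  induction k with
  | zero => simp [bigChar_zero]
  | succ k ih => rw [succ_nsmul, bigChar_add, pow_succ, ih]

theorem bigChar_neg (l : Wt n) (t : BigTorus K n) : bigChar K (-l) t = (bigChar K l t)⁻¹ := by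
  rw [eq_inv_iff_mul_eq_one, ← bigChar_add, neg_add_cancel, bigChar_zero]

/-- The vanishing ideal of the affine cone is the kernel of the pull back to the torus. -/
theorem coneIdeal_eq_ker [CharZero K] : coneIdeal K P = RingHom.ker (toLaurent K P) := by
  have hev : ∀ (t : BigTorus K n) (p : MvPolynomial (LatPts P) K),
      MvPolynomial.aeval (conePt K P t) p =
        (toLaurent K P p).coeff.sum fun l c => c • (bigChar K l t : K) := by
    intro t p
    let F : Multiplicative (Wt n) →* K :=
      { toFun := fun l => (bigChar K l.toAdd t : K)
        map_one' := by simp [bigChar_zero]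
        map_mul' := fun a b => by simp [bigChar_add] }
    have h : (AddMonoidAlgebra.lift K K (Wt n) F).comp (toLaurent K P) =
        MvPolynomial.aeval (conePt K P t) := by
      ext χ
      simp [toLaurent, conePt, F]
    rw [← h, AlgHom.comp_apply, AddMonoidAlgebra.lift_apply]
    rfl
  have hli : LinearIndependent K (fun l : Wt n => fun t : BigTorus K n => (bigChar K l t : K)) := by
    have h := linearIndependent_monoidHom (BigTorus K n) K
    refine h.comp (fun l : Wt n => (Units.coeHom K).comp (bigChar K l)) ?_
    intro l l' hl
    apply bigChar_injective (K := K)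
    ext t
    exact DFunLike.congr_fun hl t
  ext p
  rw [RingHom.mem_ker]
  constructor
  · intro hp
    have h0 : (toLaurent K P p).coeff = 0 := by
      refine (linearIndependent_iff.mp hli) _ ?_
      ext t
      have := hp _ ⟨t, rfl⟩
      rw [hev] at this
      rw [Finsupp.linearCombination_apply, Finsupp.sum, Finset.sum_apply]
      simpa [Finsupp.sum] using this
    exact AddMonoidAlgebra.coeff_injective h0
  · rintro hp _ ⟨t, rfl⟩
    rw [hev, hp]
    simp

/-- The vanishing ideal is homogeneous for every grading of `K[V]` coarser than the one by
weights. -/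
theorem coneIdeal_component_mem [CharZero K] {N : Type*} [AddCommMonoid N] [DecidableEq N]
    (w : LatPts P → N) (F : Wt n → N) (hF : ∀ a : LatPts P →₀ ℕ, Finsupp.weight w a = F (monWt a))
    (i : N) {p : MvPolynomial (LatPts P) K} (hp : p ∈ coneIdeal K P) :
    MvPolynomial.weightedHomogeneousComponent w i p ∈ coneIdeal K P := by
  classical
  rw [coneIdeal_eq_ker, RingHom.mem_ker] at hp ⊢
  apply AddMonoidAlgebra.coeff_injective
  ext l
  have h := congrArg (fun x => AddMonoidAlgebra.coeff x l) hp
  simp only [toLaurent_coeff] at h ⊢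
  rw [MvPolynomial.support_weightedHomogeneousComponent, Finset.filter_filter]
  simp only [MvPolynomial.coeff_weightedHomogeneousComponent, hF]
  by_cases hl : F l = i
  · refine Eq.trans ?_ h
    refine Finset.sum_congr ?_ ?_
    · ext a
      simp only [Finset.mem_filter]
      constructor
      · rintro ⟨h1, h2, h3⟩; exact ⟨h1, h3⟩
      · rintro ⟨h1, h3⟩; exact ⟨h1, by rw [h3, hl], h3⟩
    · intro a ha
      simp only [Finset.mem_filter] at ha
      rw [if_pos (by rw [ha.2, hl])]
  · rw [Finset.sum_eq_zero]
    · simp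
    · intro a ha
      simp only [Finset.mem_filter] at ha
      exact absurd (ha.2.2 ▸ ha.2.1) hl

theorem weight_wt (a : LatPts P →₀ ℕ) : Finsupp.weight (LatPts.wt (P := P)) a = monWt a := by
  rw [Finsupp.weight_apply]; rfl

theorem monWt_fst (a : LatPts P →₀ ℕ) : (monWt a).1 = (a.degree : ℤ) := by
  rw [monWt, Finsupp.sum, Prod.fst_sum, Finsupp.degree_apply]
  push_cast
  refine Finset.sum_congr rfl fun χ _ => ?_
  simp

variable (K P)

/-- The homogeneous elements of degree `m` of the coordinate ring of the affine cone. -/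
def degPiece (m : ℕ) : Submodule K (CoordRing K P) :=
  quotPiece (MvPolynomial.homogeneousSubmodule (LatPts P) K) (coneIdeal K P) m

instance [CharZero K] : GradedAlgebra (degPiece K P) := by
  letI : GradedAlgebra (MvPolynomial.homogeneousSubmodule (LatPts P) K) :=
    MvPolynomial.weightedGradedAlgebra K 1
  refine gradedQuot (MvPolynomial.homogeneousSubmodule (LatPts P) K) (coneIdeal K P) ?_
  intro i p hp
  have := coneIdeal_component_mem (1 : LatPts P → ℕ) (fun l => l.1.toNat)
    (fun a => by rw [monWt_fst, Finsupp.degree_eq_weight_one]; simp; rfl) i hp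
  rw [← MvPolynomial.weightedDecomposition.decompose'_apply] at this
  exact this

theorem polyAct_monomial (t : BigTorus K n) (a : LatPts P →₀ ℕ) (c : K) :
    polyAct K P t (MvPolynomial.monomial a c) =
      (bigChar K (-monWt a) t : K) • MvPolynomial.monomial a c := by
  have key : ∀ a : LatPts P →₀ ℕ, (a.prod fun χ k =>
      (MvPolynomial.C (bigChar K χ.wt t⁻¹ : K) * MvPolynomial.X χ : MvPolynomial (LatPts P) K) ^ k)
        = MvPolynomial.C (bigChar K (-monWt a) t : K) * a.prod fun χ k => MvPolynomial.X χ ^ k := by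
    intro a
    induction a using Finsupp.induction with
    | zero => simp [monWt, bigChar_zero]
    | single_add i k f hi hk ih =>
      have hw : monWt (Finsupp.single i k + f) = k • i.wt + monWt f := by
        rw [monWt, Finsupp.sum_add_index' (by simp) (by intros; rw [add_smul])]
        simp [monWt]
      have hc : (bigChar K (-(k • i.wt)) t : K) = (bigChar K i.wt t⁻¹ : K) ^ k := by
        rw [map_inv, bigChar_neg, bigChar_nsmul, ← Units.val_pow_eq_pow_val, inv_pow]
      rw [Finsupp.prod_add_index' (by simp) (by intros; rw [pow_add]),
        Finsupp.prod_add_index' (by simp) (by intros; rw [pow_add]), ih, hw, neg_add, bigChar_add]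
      rw [Finsupp.prod_single_index (by simp), Finsupp.prod_single_index (by simp)]
      simp only [Units.val_mul, hc, map_mul, map_pow, mul_pow]
      ring
  rw [polyAct, MvPolynomial.aeval_monomial, key, MvPolynomial.monomial_eq,
    MvPolynomial.smul_eq_C_mul, MvPolynomial.algebraMap_eq]
  ring

theorem quotPiece_le_eigenSpace (l : Wt n) :
    quotPiece (MvPolynomial.weightedHomogeneousSubmodule K (LatPts.wt (P := P))) (coneIdeal K P) l ≤
      eigenSpace K P l := by
  rintro _ ⟨p, hp, rfl⟩ t
  have h : polyAct K P t p = (bigChar K (-l) t : K) • p := by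
    conv_lhs => rw [p.as_sum]
    conv_rhs => rw [p.as_sum]
    rw [map_sum, Finset.smul_sum]
    refine Finset.sum_congr rfl fun a ha => ?_
    rw [polyAct_monomial, ← weight_wt]
    rw [show Finsupp.weight (LatPts.wt (P := P)) a = l from hp (MvPolynomial.mem_support_iff.mp ha)]
  have h2 : torusAct K P t (Ideal.Quotient.mkₐ K (coneIdeal K P) p) =
      Ideal.Quotient.mkₐ K (coneIdeal K P) (polyAct K P t p) := rfl
  change torusAct K P t (Ideal.Quotient.mkₐ K (coneIdeal K P) p) = _
  rw [h2, h, map_smul]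
  rfl

/-- The grading of `K[V]` by weights induces a grading of the coordinate ring. -/
@[reducible] def gradedWt [CharZero K] : GradedAlgebra
    (quotPiece (MvPolynomial.weightedHomogeneousSubmodule K (LatPts.wt (P := P)))
      (coneIdeal K P)) := by
  refine gradedQuot _ _ ?_
  intro i p hp
  have := coneIdeal_component_mem (LatPts.wt (P := P)) id weight_wt i hp
  rw [← MvPolynomial.weightedDecomposition.decompose'_apply] at this
  exact this

theorem quotPiece_eq_eigenSpace [CharZero K] :
    quotPiece (MvPolynomial.weightedHomogeneousSubmodule K (LatPts.wt (P := P))) (coneIdeal K P) =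
      eigenSpace K P := by
  classical
  let _ := gradedWt K P
  set 𝒬 := quotPiece (MvPolynomial.weightedHomogeneousSubmodule K (LatPts.wt (P := P)))
    (coneIdeal K P) with h𝒬
  funext l
  refine le_antisymm (quotPiece_le_eigenSpace K P l) ?_
  intro g hg
  have hz : ∀ k, k ≠ l → (DirectSum.decompose 𝒬 g k : CoordRing K P) = 0 := by
    intro k hk
    obtain ⟨t, ht⟩ : ∃ t : BigTorus K n, bigChar K (-k) t ≠ bigChar K (-l) t := by
      by_contra! hcon
      exact hk (neg_injective (bigChar_injective (K := K) (MonoidHom.ext hcon)))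
    have h1 : ∀ x : CoordRing K P, (DirectSum.decompose 𝒬 (torusAct K P t x) k : CoordRing K P) =
        (bigChar K (-k) t : K) • (DirectSum.decompose 𝒬 x k : CoordRing K P) := by
      intro x
      induction x using DirectSum.Decomposition.inductionOn 𝒬 with
      | zero => simp
      | @homogeneous j m =>
        rw [quotPiece_le_eigenSpace K P j m.2 t]
        by_cases hjk : j = k
        · subst hjk
          rw [DirectSum.decompose_smul, DirectSum.smul_apply, Submodule.coe_smul]
        · rw [DirectSum.decompose_smul, DirectSum.smul_apply, Submodule.coe_smul,
            DirectSum.decompose_of_mem_ne 𝒬 m.2 hjk, smul_zero, smul_zero]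
      | add a b ha hb => simp only [map_add, DirectSum.decompose_add, DirectSum.add_apply,
          Submodule.coe_add, ha, hb, smul_add]
    have h2 := h1 g
    rw [hg t, DirectSum.decompose_smul, DirectSum.smul_apply, Submodule.coe_smul] at h2
    have h3 : ((bigChar K (-l) t : K) - (bigChar K (-k) t : K)) •
        (DirectSum.decompose 𝒬 g k : CoordRing K P) = 0 := by
      rw [sub_smul, h2, sub_self]
    rcases smul_eq_zero.mp h3 with h4 | h4
    · exact absurd (Units.ext (sub_eq_zero.mp h4)).symm ht
    · exact h4
  have h5 : g = DirectSum.decompose 𝒬 g l := by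
    conv_lhs => rw [← DirectSum.sum_support_decompose 𝒬 g]
    rw [Finset.sum_eq_single l]
    · intro k _ hk
      exact hz k hk
    · intro hl
      simpa using hl
  rw [h5]
  exact SetLike.coe_mem _

/-- The coordinate ring is the direct sum of the spaces of eigenfunctions. -/
instance [CharZero K] : GradedAlgebra (eigenSpace K P) := by
  rw [← quotPiece_eq_eigenSpace]
  exact gradedWt K P

end Torus

/-! ## Combinatorial Seshadri stratifications and the quasi-valuation -/

/-- The set `A` of (nonempty) faces of `P`, ordered by inclusion; `P` itself is a face. -/
abbrev Face (P : NormalPolytope n) : Type :=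
  {σ : Set (Fin n → ℝ) // IsExposed ℝ P.carrier σ ∧ σ.Nonempty}

instance (P : NormalPolytope n) : Finite (Face P) := by
  obtain ⟨s, -, hs⟩ := P.lattice
  have hfin : (latticePt '' (s : Set (Fin n → ℤ))).Finite := s.finite_toSet.image _
  have hc : IsCompact P.carrier := hs ▸ hfin.isCompact_convexHull ℝ
  have hconv : Convex ℝ P.carrier := hs ▸ convex_convexHull ℝ _
  have : Finite (𝒫 (latticePt '' (s : Set (Fin n → ℤ)))) := hfin.finite_subsets.to_subtype
  refine Finite.of_injective (fun σ : Face P =>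
    (⟨σ.1.extremePoints ℝ, ?_⟩ : 𝒫 (latticePt '' (s : Set (Fin n → ℤ))))) ?_
  · refine (σ.2.1.isExtreme.extremePoints_eq.subset.trans Set.inter_subset_right).trans ?_
    rw [hs]
    exact extremePoints_convexHull_subset
  · intro σ τ h
    have h' : σ.1.extremePoints ℝ = τ.1.extremePoints ℝ := congrArg Subtype.val h
    refine Subtype.ext ?_
    rw [← closure_convexHull_extremePoints (σ.2.1.isCompact hc) (σ.2.1.convex hconv), h',
      closure_convexHull_extremePoints (τ.2.1.isCompact hc) (τ.2.1.convex hconv)]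

/-- A linearization of the partial order on the set of faces. -/
structure Linearization (P : NormalPolytope n) where
  order : LinearOrder (Face P)
  extends_le : ∀ σ τ : Face P, σ ≤ τ → order.le σ τ

/-- The set of faces, listed from the largest to the smallest one for a given linearization. -/
def FaceIdx {P : NormalPolytope n} (_ : Linearization P) : Type := Face P

instance {P : NormalPolytope n} (t : Linearization P) : LinearOrder (FaceIdx t) :=
  @OrderDual.instLinearOrder (Face P) t.order

instance {P : NormalPolytope n} (t : Linearization P) : Finite (FaceIdx t) :=
  inferInstanceAs (Finite (Face P))

/-- The totally ordered group `ℚ^A`, with the lexicographic order induced by the linearization: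
`a < b` if and only if `a σ < b σ` for the largest face `σ` with `a σ ≠ b σ`. -/
def ValGroup {P : NormalPolytope n} (t : Linearization P) : Type := Lex (FaceIdx t → ℚ)

instance {P : NormalPolytope n} (t : Linearization P) : AddCommGroup (ValGroup t) :=
  inferInstanceAs (AddCommGroup (Lex (FaceIdx t → ℚ)))

instance {P : NormalPolytope n} (t : Linearization P) : LinearOrder (ValGroup t) :=
  inferInstanceAs (LinearOrder (Lex (FaceIdx t → ℚ)))

instance {P : NormalPolytope n} (t : Linearization P) : IsOrderedCancelAddMonoid (ValGroup t) :=
  inferInstanceAs (IsOrderedCancelAddMonoid (Lex (FaceIdx t → ℚ)))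

/-- A combinatorial Seshadri stratification on `X_P`: functions `f σ`, for `σ` a face, which are
nonzero eigenfunctions of `Kˣ × T` of degree `deg σ ≥ 1` and weight `-(deg σ, wt σ)`, such that
`wt σ / deg σ` lies in the relative interior of `σ`. -/
structure Stratification (K : Type u) [Field K] (P : NormalPolytope n) where
  f : Face P → CoordRing K P
  deg : Face P → ℕ
  wt : Face P → Fin n → ℤ
  one_le_deg : ∀ σ, 1 ≤ deg σ
  f_ne_zero : ∀ σ, f σ ≠ 0
  f_mem : ∀ σ, f σ ∈ eigenSpace K P ((deg σ : ℤ), wt σ)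
  mem_relint : ∀ σ, (fun i => (wt σ i : ℝ) / (deg σ : ℝ)) ∈ intrinsicInterior ℝ σ.1

/-- The inclusion of `ℤ ⊕ M` in `ℚ ⊕ M_ℚ`. -/
def ratWt : Wt n →+ ℚ × (Fin n → ℚ) where
  toFun l := ((l.1 : ℚ), fun i => (l.2 i : ℚ))
  map_zero' := by ext <;> simp
  map_add' a b := by ext <;> simp

section Valuation

variable {K : Type u} [Field K] [CharZero K] {P : NormalPolytope n}
variable (S : Stratification K P) (t : Linearization P)

open scoped Classical in
/-- For a maximal chain `C` of faces, the vectors `(deg σ, wt σ)`, `σ ∈ C`, are a basis of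
`ℚ ⊕ M_ℚ`. This is the linear map which sends a vector to its coordinates with respect to
this basis, that is, the one which sends `(deg σ, wt σ)` to the basis vector `e_σ` of `ℚ^A`. -/
def chainCoord (C : Set (Face P)) : (ℚ × (Fin n → ℚ)) →ₗ[ℚ] (Face P → ℚ) :=
  if h : ∃ L : (ℚ × (Fin n → ℚ)) →ₗ[ℚ] (Face P → ℚ),
      ∀ σ ∈ C, L (ratWt ((S.deg σ : ℤ), S.wt σ)) = Pi.single σ 1
  then h.choose else 0

/-- The value `∑ a_σ e_σ` of `ν_C` at an eigenfunction of weight `-l`, where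
`-l = ∑ a_σ μ_σ` with `μ_σ = -(deg σ, wt σ)`. -/
def nuWt (C : Set (Face P)) : Wt n →+ ValGroup t where
  toFun l := toLex (fun σ : FaceIdx t => chainCoord S C (ratWt l) σ)
  map_zero' := by rw [map_zero, map_zero]; rfl
  map_add' a b := by rw [map_add, map_add]; rfl

variable (K P) in
open scoped Classical in
/-- The `l` such that the component of weight `-l` in the decomposition of `g` into eigenfunctions
is not zero. -/
def wtSupport (g : CoordRing K P) : Finset (Wt n) :=
  (DirectSum.decompose (eigenSpace K P) g).support

/-- The valuation `ν_C` (with an irrelevant value at `g = 0`). -/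
def nuChain (C : Set (Face P)) (g : CoordRing K P) : ValGroup t :=
  if h : (wtSupport K P g).Nonempty then (wtSupport K P g).inf' h (nuWt S t C) else 0

/-- The maximal chains of faces. -/
abbrev MaxChain (P : NormalPolytope n) : Type := {C : Set (Face P) // IsMaxChain (· ≤ ·) C}

instance : Nonempty (MaxChain P) := ⟨⟨_, maxChain_spec⟩⟩

instance : Fintype (MaxChain P) := Fintype.ofFinite _

/-- The quasi-valuation `ν`, the minimum of the `ν_C` over all maximal chains `C` (with an
irrelevant value at `g = 0`). -/
def nu (g : CoordRing K P) : ValGroup t :=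
  Finset.univ.inf' Finset.univ_nonempty fun C : MaxChain P => nuChain S t C.1 g

open scoped Classical in
theorem mem_wtSupport (g : CoordRing K P) (l : Wt n) : l ∈ wtSupport K P g ↔
    (DirectSum.decompose (eigenSpace K P) g l : CoordRing K P) ≠ 0 := by
  rw [wtSupport, DFinsupp.mem_support_toFun, ne_eq, ne_eq, Submodule.coe_eq_zero]

open scoped Classical in
theorem wtSupport_nonempty {g : CoordRing K P} (hg : g ≠ 0) : (wtSupport K P g).Nonempty := by
  by_contra h
  rw [Finset.not_nonempty_iff_eq_empty, wtSupport] at h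
  replace h := DFinsupp.support_eq_empty.mp h
  exact hg ((DirectSum.decompose (eigenSpace K P)).injective (by rw [h, DirectSum.decompose_zero]))

theorem wtSupport_add {g h : CoordRing K P} {l : Wt n} (hl : l ∈ wtSupport K P (g + h)) :
    l ∈ wtSupport K P g ∨ l ∈ wtSupport K P h := by
  simp only [mem_wtSupport, DirectSum.decompose_add, DirectSum.add_apply] at hl ⊢
  by_contra! hcon
  exact hl (by rw [Submodule.coe_add, hcon.1, hcon.2, add_zero])

open scoped Classical in
theorem wtSupport_mul {g h : CoordRing K P} {l : Wt n} (hl : l ∈ wtSupport K P (g * h)) :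
    ∃ a ∈ wtSupport K P g, ∃ b ∈ wtSupport K P h, a + b = l := by
  rw [mem_wtSupport, DirectSum.decompose_mul, DirectSum.coe_mul_apply] at hl
  obtain ⟨ij, hij, -⟩ := Finset.exists_ne_zero_of_sum_ne_zero hl
  simp only [Finset.mem_filter, Finset.mem_product, DFinsupp.mem_support_toFun] at hij
  refine ⟨ij.1, ?_, ij.2, ?_, hij.2⟩
  · rw [wtSupport, DFinsupp.mem_support_toFun]; exact hij.1.1
  · rw [wtSupport, DFinsupp.mem_support_toFun]; exact hij.1.2

theorem wtSupport_mem {g : CoordRing K P} {k l : Wt n} (hg : g ∈ eigenSpace K P k)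
    (hl : l ∈ wtSupport K P g) : l = k := by
  by_contra h
  rw [mem_wtSupport, DirectSum.decompose_of_mem_ne _ hg (Ne.symm h)] at hl
  exact hl rfl

theorem wtSupport_smul {g : CoordRing K P} {c : K} {l : Wt n} (hl : l ∈ wtSupport K P (c • g)) :
    l ∈ wtSupport K P g := by
  rw [mem_wtSupport, DirectSum.decompose_smul, DirectSum.smul_apply, Submodule.coe_smul] at hl
  rw [mem_wtSupport]
  exact fun h => hl (by rw [h, smul_zero])

variable {S t} in
theorem le_nu_iff {g : CoordRing K P} {a : ValGroup t} : (g = 0 ∨ a ≤ nu S t g) ↔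
    ∀ C : MaxChain P, ∀ l ∈ wtSupport K P g, a ≤ nuWt S t C.1 l := by
  by_cases hg : g = 0
  · subst hg
    simp [mem_wtSupport]
  · have hne := wtSupport_nonempty hg
    simp only [hg, false_or, nu, Finset.le_inf'_iff, Finset.mem_univ, true_implies, nuChain,
      dif_pos hne]

variable {S t} in
theorem lt_nu_iff {g : CoordRing K P} {a : ValGroup t} : (g = 0 ∨ a < nu S t g) ↔
    ∀ C : MaxChain P, ∀ l ∈ wtSupport K P g, a < nuWt S t C.1 l := by
  by_cases hg : g = 0
  · subst hg
    simp [mem_wtSupport]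
  · have hne := wtSupport_nonempty hg
    simp only [hg, false_or, nu, Finset.lt_inf'_iff, Finset.mem_univ, true_implies, nuChain,
      dif_pos hne]

/-! ## The associated graded algebra -/

/-- The functions `g` with `g = 0` or `ν(g) ≥ a`. -/
def filtGE (a : ValGroup t) : Submodule K (CoordRing K P) where
  carrier := {g | g = 0 ∨ a ≤ nu S t g}
  zero_mem' := Or.inl rfl
  add_mem' {g h} hg hh := by
    simp only [Set.mem_ofPred_eq, le_nu_iff] at hg hh ⊢
    exact fun C l hl => (wtSupport_add hl).elim (hg C l) (hh C l)
  smul_mem' c g hg := by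
    simp only [Set.mem_ofPred_eq, le_nu_iff] at hg ⊢
    exact fun C l hl => hg C l (wtSupport_smul hl)

/-- The functions `g` with `g = 0` or `ν(g) > a`. -/
def filtGT (a : ValGroup t) : Submodule K (CoordRing K P) where
  carrier := {g | g = 0 ∨ a < nu S t g}
  zero_mem' := Or.inl rfl
  add_mem' {g h} hg hh := by
    simp only [Set.mem_ofPred_eq, lt_nu_iff] at hg hh ⊢
    exact fun C l hl => (wtSupport_add hl).elim (hg C l) (hh C l)
  smul_mem' c g hg := by
    simp only [Set.mem_ofPred_eq, lt_nu_iff] at hg ⊢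
    exact fun C l hl => hg C l (wtSupport_smul hl)

variable {S t} in
theorem mem_filtGE {a : ValGroup t} {g : CoordRing K P} : g ∈ filtGE S t a ↔
    ∀ C : MaxChain P, ∀ l ∈ wtSupport K P g, a ≤ nuWt S t C.1 l := le_nu_iff

variable {S t} in
theorem mem_filtGT {a : ValGroup t} {g : CoordRing K P} : g ∈ filtGT S t a ↔
    ∀ C : MaxChain P, ∀ l ∈ wtSupport K P g, a < nuWt S t C.1 l := lt_nu_iff

instance : SetLike.GradedMonoid (filtGE S t) where
  one_mem := by
    rw [mem_filtGE]
    intro C l hl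
    rw [wtSupport_mem SetLike.GradedOne.one_mem hl, map_zero]
  mul_mem := by
    intro a b g h hg hh
    rw [mem_filtGE] at hg hh ⊢
    intro C l hl
    obtain ⟨x, hx, y, hy, rfl⟩ := wtSupport_mul hl
    rw [map_add]
    exact add_le_add (hg C x hx) (hh C y hy)

theorem mul_mem_filtGT {a b : ValGroup t} {g h : CoordRing K P} (hg : g ∈ filtGE S t a)
    (hh : h ∈ filtGT S t b) : g * h ∈ filtGT S t (a + b) := by
  rw [mem_filtGE] at hg
  rw [mem_filtGT] at hh ⊢
  intro C l hl
  obtain ⟨x, hx, y, hy, rfl⟩ := wtSupport_mul hl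
  rw [map_add]
  exact add_lt_add_of_le_of_lt (hg C x hx) (hh C y hy)

/-- The algebra `⨁ₐ {ν ≥ a}`, where `a` runs over `ℚ^A`. -/
def Rees : Type u := ⨁ a : ValGroup t, filtGE S t a

instance : CommRing (Rees S t) := inferInstanceAs (CommRing (⨁ a : ValGroup t, filtGE S t a))

instance : Algebra K (Rees S t) := inferInstanceAs (Algebra K (⨁ a : ValGroup t, filtGE S t a))

/-- The element `g` of the summand `{ν ≥ a}` of `⨁ₐ {ν ≥ a}`. -/
def Rees.of (a : ValGroup t) (g : filtGE S t a) : Rees S t :=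
  DirectSum.of (fun a => filtGE S t a) a g

variable {S t} in
/-- The component of an element of `⨁ₐ {ν ≥ a}` in the summand `{ν ≥ a}`. -/
def Rees.comp (x : Rees S t) (a : ValGroup t) : filtGE S t a :=
  (show ⨁ a : ValGroup t, filtGE S t a from x) a

theorem Rees.ext {x y : Rees S t} (h : ∀ a, (x.comp a : CoordRing K P) = y.comp a) : x = y :=
  DFinsupp.ext fun a => Subtype.ext (h a)

theorem Rees.comp_zero (a : ValGroup t) : (0 : Rees S t).comp a = 0 := rfl

theorem Rees.comp_add (x y : Rees S t) (a : ValGroup t) :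
    (x + y).comp a = x.comp a + y.comp a := rfl

theorem Rees.comp_smul (c : K) (x : Rees S t) (a : ValGroup t) :
    (c • x).comp a = c • x.comp a := rfl

theorem Rees.comp_one (a : ValGroup t) :
    ((1 : Rees S t).comp a : CoordRing K P) = if 0 = a then 1 else 0 := by
  have : ((1 : Rees S t).comp a : CoordRing K P) =
      ((1 : ⨁ a : ValGroup t, filtGE S t a) a : CoordRing K P) := rfl
  rw [this, DirectSum.one_def, DirectSum.coe_of_apply]
  split_ifs <;> rfl

theorem Rees.comp_mul_mem (x y : Rees S t) (a : ValGroup t) (N : Submodule K (CoordRing K P))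
    (h : ∀ b c : ValGroup t, b + c = a →
      (x.comp b : CoordRing K P) * (y.comp c : CoordRing K P) ∈ N) :
    ((x * y).comp a : CoordRing K P) ∈ N := by
  let _ : ∀ (i : ValGroup t) (x : filtGE S t i), Decidable (x ≠ 0) := fun _ _ => Classical.dec _
  have : ((x * y).comp a : CoordRing K P) =
    (((show ⨁ a : ValGroup t, filtGE S t a from x) * (show ⨁ a : ValGroup t, filtGE S t a from y) :
      ⨁ a : ValGroup t, filtGE S t a) a : CoordRing K P) := rfl
  rw [this, DirectSum.coe_mul_apply]
  exact sum_mem fun ij hij => h _ _ (Finset.mem_filter.mp hij).2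

/-- The ideal `⨁ₐ {ν > a}` of `⨁ₐ {ν ≥ a}`. -/
def reesIdeal : Ideal (Rees S t) where
  carrier := {x | ∀ a, (x.comp a : CoordRing K P) ∈ filtGT S t a}
  zero_mem' a := by rw [Rees.comp_zero]; exact zero_mem _
  add_mem' {x y} hx hy a := by
    rw [Rees.comp_add, Submodule.coe_add]
    exact add_mem (hx a) (hy a)
  smul_mem' y x hx a := by
    rw [smul_eq_mul]
    refine Rees.comp_mul_mem S t _ _ _ _ fun b c h => ?_
    rw [← h]
    exact mul_mem_filtGT S t (SetLike.coe_mem _) (hx _)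

/-- The associated graded algebra `gr_ν K[X̂_P] = ⨁ₐ {ν ≥ a} / {ν > a}`. -/
abbrev Gr : Type u := Rees S t ⧸ reesIdeal S t

/-- The class in `gr_ν` of a function `g`, in the piece of degree `ν(g)`. -/
def symb (g : CoordRing K P) : Gr S t :=
  Ideal.Quotient.mk (reesIdeal S t)
    (Rees.of S t (nu S t g) ⟨g, Or.inr le_rfl⟩)

theorem wtSupport_degPiece {g : CoordRing K P} {m : ℕ} (hg : g ∈ degPiece K P m) {l : Wt n}
    (hl : l ∈ wtSupport K P g) : l.1 = m := by
  obtain ⟨p, hp, rfl⟩ := hg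
  by_contra hne
  rw [mem_wtSupport] at hl
  apply hl
  have : ∀ a ∈ p.support, (DirectSum.decompose (eigenSpace K P)
      (Ideal.Quotient.mkₐ K (coneIdeal K P) (MvPolynomial.monomial a (p.coeff a))) l
        : CoordRing K P) = 0 := by
    intro a ha
    refine DirectSum.decompose_of_mem_ne _ (i := monWt a) ?_ ?_
    · rw [← quotPiece_eq_eigenSpace]
      exact ⟨_, MvPolynomial.isWeightedHomogeneous_monomial _ _ _ (weight_wt a), rfl⟩
    · rintro rfl
      apply hne
      rw [monWt_fst, Finsupp.degree_eq_weight_one]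
      exact_mod_cast hp (MvPolynomial.mem_support_iff.mp ha)
  rw [p.as_sum]
  rw [AlgHom.toLinearMap_apply, map_sum, DirectSum.decompose_sum]
  rw [DFinsupp.finsetSum_apply, AddSubmonoidClass.coe_finsetSum]
  exact Finset.sum_eq_zero this

open scoped Classical in
theorem wtSupport_component {g : CoordRing K P} {m : ℕ} {l : Wt n}
    (hl : l ∈ wtSupport K P (DirectSum.decompose (degPiece K P) g m : CoordRing K P)) :
    l ∈ wtSupport K P g := by
  have h1 := wtSupport_degPiece (SetLike.coe_mem _) hl
  rw [mem_wtSupport] at hl ⊢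
  intro h0
  apply hl
  rw [← h0]
  conv_rhs => rw [← DirectSum.sum_support_decompose (degPiece K P) g]
  rw [DirectSum.decompose_sum, DFinsupp.finsetSum_apply, AddSubmonoidClass.coe_finsetSum,
    Finset.sum_eq_single m]
  · intro k _ hk
    by_contra h2
    have := wtSupport_degPiece (SetLike.coe_mem _) ((mem_wtSupport _ _).mpr h2)
    omega
  · intro hm
    have : DirectSum.decompose (degPiece K P) g m = 0 := by simpa using hm
    rw [this]
    simp

/-- The component of degree `m`, as an endomorphism of `{ν ≥ a}`. -/
def degComp (m : ℕ) (a : ValGroup t) : filtGE S t a →+ filtGE S t a where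
  toFun g := ⟨DirectSum.decompose (degPiece K P) g.1 m, mem_filtGE.mpr fun C l hl =>
    mem_filtGE.mp g.2 C l (wtSupport_component hl)⟩
  map_zero' := by ext; simp
  map_add' g h := by ext; simp [DirectSum.decompose_add]

/-- The elements of `⨁ₐ {ν ≥ a}` all of whose components are homogeneous of degree `m`. -/
def reesPiece (m : ℕ) : Submodule K (Rees S t) where
  carrier := {x | ∀ a, (x.comp a : CoordRing K P) ∈ degPiece K P m}
  zero_mem' a := by rw [Rees.comp_zero]; exact zero_mem _
  add_mem' {x y} hx hy a := by
    rw [Rees.comp_add, Submodule.coe_add]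
    exact add_mem (hx a) (hy a)
  smul_mem' c x hx a := by
    rw [Rees.comp_smul, Submodule.coe_smul]
    exact Submodule.smul_mem _ _ (hx a)

instance : SetLike.GradedMonoid (reesPiece S t) where
  one_mem a := by
    rw [Rees.comp_one]
    split_ifs
    · exact SetLike.GradedOne.one_mem
    · exact zero_mem _
  mul_mem := by
    intro i j x y hx hy a
    exact Rees.comp_mul_mem S t _ _ _ _ fun b c _ => SetLike.GradedMul.mul_mem (hx _) (hy _)

/-- The component of degree `m`, as an endomorphism of `⨁ₐ {ν ≥ a}`. -/
def reesProj (m : ℕ) : Rees S t →+ Rees S t :=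
  show (⨁ a : ValGroup t, filtGE S t a) →+ ⨁ a : ValGroup t, filtGE S t a from
    DirectSum.map fun a => degComp S t m a

theorem reesProj_comp (m : ℕ) (x : Rees S t) (a : ValGroup t) :
    ((reesProj S t m x).comp a : CoordRing K P) =
      DirectSum.decompose (degPiece K P) (x.comp a : CoordRing K P) m := by
  have : (reesProj S t m x).comp a = degComp S t m a (x.comp a) :=
    DirectSum.map_apply (fun a => degComp S t m a) a x
  rw [this]
  rfl

theorem Rees.comp_sum {ι : Type*} (s : Finset ι) (x : ι → Rees S t) (a : ValGroup t) :
    ((∑ i ∈ s, x i).comp a : CoordRing K P) = ∑ i ∈ s, ((x i).comp a : CoordRing K P) := by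
  classical
  induction s using Finset.induction_on with
  | empty => rfl
  | insert i s hi ih =>
    rw [Finset.sum_insert hi, Finset.sum_insert hi, Rees.comp_add, Submodule.coe_add, ih]

instance : GradedAlgebra (reesPiece S t) := by
  letI : ∀ (i : ValGroup t) (x : filtGE S t i), Decidable (x ≠ 0) := fun _ _ => Classical.dec _
  letI : ∀ (i : ℕ) (x : degPiece K P i), Decidable (x ≠ 0) := fun _ _ => Classical.dec _
  refine gradedOfProj _ (reesProj S t) ?_ ?_ ?_
  · intro x
    refine ⟨(DFinsupp.support (show ⨁ a : ValGroup t, filtGE S t a from x)).biUnion fun a =>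
      (DirectSum.decompose (degPiece K P) (x.comp a : CoordRing K P)).support, ?_⟩
    refine Rees.ext S t fun a => ?_
    rw [Rees.comp_sum]
    simp only [reesProj_comp]
    by_cases ha : a ∈ DFinsupp.support (show ⨁ a : ValGroup t, filtGE S t a from x)
    · conv_rhs => rw [← DirectSum.sum_support_decompose (degPiece K P) (x.comp a : CoordRing K P)]
      refine (Finset.sum_subset (Finset.subset_biUnion_of_mem (fun a =>
        (DirectSum.decompose (degPiece K P) (x.comp a : CoordRing K P)).support) ha) ?_).symm
      intro m _ hm
      simpa using hm
    · have : x.comp a = 0 := DFinsupp.notMem_support_iff.mp ha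
      rw [this]
      simp
  · intro m x a
    rw [reesProj_comp]
    exact SetLike.coe_mem _
  · intro i j x hx
    refine Rees.ext S t fun a => ?_
    rw [reesProj_comp]
    split_ifs with h
    · subst h
      rw [DirectSum.decompose_of_mem_same _ (hx a)]
    · rw [DirectSum.decompose_of_mem_ne _ (hx a) h, Rees.comp_zero]
      rfl

/-- The grading of `gr_ν` induced by the degree of functions. -/
abbrev grPiece (m : ℕ) : Submodule K (Gr S t) := quotPiece (reesPiece S t) (reesIdeal S t) m

theorem reesProj_eq (m : ℕ) (x : Rees S t) :
    (DirectSum.decompose (reesPiece S t) x m : Rees S t) = reesProj S t m x := by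
  induction x using DirectSum.Decomposition.inductionOn (reesPiece S t) with
  | zero => simp
  | @homogeneous j y =>
    refine Rees.ext S t fun a => ?_
    rw [reesProj_comp]
    by_cases h : j = m
    · subst h
      rw [DirectSum.decompose_of_mem_same _ y.2, DirectSum.decompose_of_mem_same _ (y.2 a)]
    · rw [DirectSum.decompose_of_mem_ne _ y.2 h, DirectSum.decompose_of_mem_ne _ (y.2 a) h]
      rfl
  | add x y hx hy =>
    rw [DirectSum.decompose_add, DirectSum.add_apply, Submodule.coe_add, hx, hy, map_add]

instance : GradedAlgebra (grPiece S t) := by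
  refine gradedQuot _ _ ?_
  intro m x hx
  rw [reesProj_eq]
  intro a
  rw [reesProj_comp]
  exact mem_filtGT.mpr fun C l hl => mem_filtGT.mp (hx a) C l (wtSupport_component hl)

end Valuation

/-! ## Initial ideals and homogenization with respect to a weight vector -/

section Initial

variable {ι : Type} {K : Type u} [Field K]

/-- The initial term of `g`, the sum of those of its terms whose exponents have the greatest
degree. -/
def initialForm {Γ : Type*} [LinearOrder Γ] (d : (ι →₀ ℕ) → Γ) (g : MvPolynomial ι K) :
    MvPolynomial ι K :=
  ∑ α ∈ g.support with ∀ β ∈ g.support, d β ≤ d α, MvPolynomial.monomial α (g.coeff α)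

/-- The initial ideal of `I`, generated by the initial terms of the elements of `I`. -/
def initialIdeal {Γ : Type*} [LinearOrder Γ] (d : (ι →₀ ℕ) → Γ) (I : Ideal (MvPolynomial ι K)) :
    Ideal (MvPolynomial ι K) :=
  Ideal.span (initialForm d '' (I : Set (MvPolynomial ι K)))

/-- The maximum of `lam · α` over the exponents `α` of `f` (with an irrelevant value at `0`). -/
def lamDeg (lam : ι → ℤ) (f : MvPolynomial ι K) : ℤ :=
  if h : f.support.Nonempty then f.support.sup' h (Finsupp.weight lam) else 0

/-- The `lam`-homogenization
`u ^ (lamDeg f) * f (u ^ (-lam 1) * x 1, …, u ^ (-lam p) * x p)` of `f`, that is,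
`∑ c_α u ^ (lamDeg f - lam · α) x ^ α`, as an element of `K[u][x]`. -/
def homogenization (lam : ι → ℤ) (f : MvPolynomial ι K) : MvPolynomial ι (Polynomial K) :=
  ∑ α ∈ f.support, MvPolynomial.monomial α
    (Polynomial.C (f.coeff α) * Polynomial.X ^ (lamDeg lam f - Finsupp.weight lam α).toNat)

/-- The ideal generated by the `lam`-homogenizations of the elements of `J`. -/
def homogenizationIdeal (lam : ι → ℤ) (J : Ideal (MvPolynomial ι K)) :
    Ideal (MvPolynomial ι (Polynomial K)) :=
  Ideal.span (homogenization lam '' (J : Set (MvPolynomial ι K)))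

theorem le_lamDeg (lam : ι → ℤ) {f : MvPolynomial ι K} {α : ι →₀ ℕ} (h : α ∈ f.support) :
    Finsupp.weight lam α ≤ lamDeg lam f := by
  rw [lamDeg, dif_pos ⟨α, h⟩]
  exact Finset.le_sup' (Finsupp.weight lam) h

theorem coeff_homogenization (lam : ι → ℤ) (f : MvPolynomial ι K) (α : ι →₀ ℕ) :
    (homogenization lam f).coeff α =
      Polynomial.C (f.coeff α) * Polynomial.X ^ (lamDeg lam f - Finsupp.weight lam α).toNat := by
  classical
  rw [homogenization, MvPolynomial.coeff_sum]
  simp only [MvPolynomial.coeff_monomial]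
  rw [Finset.sum_ite_eq']
  split_ifs with h
  · rfl
  · rw [MvPolynomial.notMem_support_iff.mp h]; simp

theorem homogenizationIdeal_isHomogeneous (lam : ι → ℤ) (m : ι → ℕ) (J : Ideal (MvPolynomial ι K))
    (hJ : J.IsHomogeneous (MvPolynomial.weightedHomogeneousSubmodule K m)) :
    (homogenizationIdeal lam J).IsHomogeneous
      (MvPolynomial.weightedHomogeneousSubmodule (Polynomial K) m) := by
  classical
  have key : homogenizationIdeal lam J = Ideal.span (homogenization lam ''
      {f | f ∈ J ∧ ∃ k, MvPolynomial.IsWeightedHomogeneous m f k}) := by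
    refine le_antisymm (Ideal.span_le.mpr ?_)
      (Ideal.span_mono (Set.image_mono fun f hf => hf.1))
    rintro _ ⟨f, hf, rfl⟩
    have hsum : homogenization lam f = ∑ k ∈ f.support.image (Finsupp.weight m),
        MvPolynomial.C (Polynomial.X ^ (lamDeg lam f -
          lamDeg lam (MvPolynomial.weightedHomogeneousComponent m k f)).toNat) *
        homogenization lam (MvPolynomial.weightedHomogeneousComponent m k f) := by
      ext1 α
      rw [MvPolynomial.coeff_sum]
      simp only [MvPolynomial.coeff_C_mul, coeff_homogenization,
        MvPolynomial.coeff_weightedHomogeneousComponent]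
      by_cases hα : α ∈ f.support
      · rw [Finset.sum_eq_single (Finsupp.weight m α)]
        · rw [if_pos rfl]
          have hα' : α ∈ (MvPolynomial.weightedHomogeneousComponent m
              (Finsupp.weight m α) f).support := by
            rw [MvPolynomial.support_weightedHomogeneousComponent, Finset.mem_filter]
            exact ⟨hα, rfl⟩
          have h1 := le_lamDeg lam hα'
          have h2 : lamDeg lam (MvPolynomial.weightedHomogeneousComponent m
              (Finsupp.weight m α) f) ≤ lamDeg lam f := by
            rw [lamDeg, dif_pos ⟨α, hα'⟩]
            refine Finset.sup'_le _ _ fun β hβ => le_lamDeg lam ?_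
            rw [MvPolynomial.support_weightedHomogeneousComponent] at hβ
            exact Finset.filter_subset _ _ hβ
          rw [mul_left_comm, ← pow_add]
          congr 2
          omega
        · intro k _ hk
          rw [if_neg (Ne.symm hk)]
          simp
        · intro h
          exact absurd (Finset.mem_image_of_mem _ hα) h
      · rw [MvPolynomial.notMem_support_iff.mp hα]
        simp
    rw [SetLike.mem_coe, hsum]
    refine sum_mem fun k _ => Ideal.mul_mem_left _ _ (Ideal.subset_span ⟨_, ⟨?_, k,
      MvPolynomial.weightedHomogeneousComponent_isWeightedHomogeneous (w := m) k f⟩, rfl⟩)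
    have := hJ k hf
    rw [← MvPolynomial.weightedDecomposition.decompose'_apply]
    exact this
  rw [key]
  refine Ideal.homogeneous_span _ _ ?_
  rintro _ ⟨f, ⟨-, k, hk⟩, rfl⟩
  refine ⟨k, ?_⟩
  intro α hα
  apply hk
  intro h0
  apply hα
  rw [coeff_homogenization, h0]
  simp

end Initial

/-! ## The degeneration -/

section Degeneration

variable (K : Type u) [Field K] (P : NormalPolytope n)

/-- The basis element `f_{m,η}`, `l = (m, η)`, of the coordinate ring: the class of any monomial
of weight `-l` in the coordinate functions. (It is only used if there is such a monomial.) -/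
def basisFun (l : Wt n) : CoordRing K P :=
  open scoped Classical in
  if h : ∃ a : LatPts P →₀ ℕ, monWt a = l then
    Ideal.Quotient.mk (coneIdeal K P) (MvPolynomial.monomial h.choose 1) else 0

variable {K P}

theorem basisFun_mem_degPiece {l : Wt n} (h : ∃ a : LatPts P →₀ ℕ, monWt a = l) :
    basisFun K P l ∈ degPiece K P l.1.toNat := by
  rw [basisFun, dif_pos h]
  refine ⟨_, ?_, rfl⟩
  refine MvPolynomial.isHomogeneous_monomial _ ?_
  have := monWt_fst h.choose
  rw [h.choose_spec] at this
  omega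

variable [CharZero K]

/-- A finite set of basis elements `f_{m,η}` of degree `m ≥ 1`, which contains all those of degree
one and whose classes generate the algebra `gr_ν`. -/
structure GenSystem (S : Stratification K P) (t : Linearization P) where
  gens : Finset (Wt n)
  isWeight : ∀ l ∈ gens, ∃ a : LatPts P →₀ ℕ, monWt a = l
  one_le_fst : ∀ l ∈ gens, 1 ≤ l.1
  wt_mem : ∀ χ : LatPts P, χ.wt ∈ gens
  generate : Algebra.adjoin K ((fun l => symb S t (basisFun K P l)) '' (gens : Set (Wt n))) = ⊤

namespace GenSystem

variable {S : Stratification K P} {t : Linearization P} (G : GenSystem S t)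

/-- The degrees `m_i` of the generators. -/
def degs (l : G.gens) : ℕ := l.1.1.toNat

/-- The homomorphism `θ : K[x] → K[X̂_P]` which sends the variables to the generators. -/
def theta : MvPolynomial G.gens K →ₐ[K] CoordRing K P :=
  MvPolynomial.aeval fun l => basisFun K P l.1

/-- The value `deg_A` of an exponent in `ℕ × ℚ^A`, where `(m', a') ≤ (m, a)` if `m' < m`, or
`m' = m` and `a' ≥ a`. It defines the global monomial preorder induced by `ν`. -/
def degA (α : G.gens →₀ ℕ) : ℕ ×ₗ (ValGroup t)ᵒᵈ :=
  toLex (Finsupp.weight G.degs α,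
    OrderDual.toDual (α.sum fun l k => k • nu S t (basisFun K P l.1)))

/-- The integral weight vector `lam` approximates the global monomial preorder: both have the same
initial ideal of `ker θ`. -/
def Approximates (lam : G.gens → ℤ) : Prop :=
  initialIdeal G.degA (RingHom.ker G.theta) =
    initialIdeal (fun α => Finsupp.weight lam α) (RingHom.ker G.theta)

theorem ker_theta_isHomogeneous :
    (RingHom.ker G.theta).IsHomogeneous
      (MvPolynomial.weightedHomogeneousSubmodule K G.degs) := by
  refine ker_isHomogeneous _ (degPiece K P) _ ?_
  intro k f hf
  rw [f.as_sum, map_sum]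
  refine sum_mem fun α hα => ?_
  rw [← hf (MvPolynomial.mem_support_iff.mp hα), theta, MvPolynomial.aeval_monomial,
    ← Algebra.smul_def, Finsupp.weight_apply]
  refine Submodule.smul_mem _ _ ?_
  exact SetLike.prod_pow_mem_graded (degPiece K P) G.degs (fun l => basisFun K P l.1) α
    fun l _ => basisFun_mem_degPiece (G.isWeight _ l.2)

/-- The ideal of `K[u][x] = K[x, u]` generated by the `lam`-homogenizations of the elements of
`ker θ`. -/
def breveIdeal (lam : G.gens → ℤ) : Ideal (MvPolynomial G.gens (Polynomial K)) :=
  homogenizationIdeal lam (RingHom.ker G.theta)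

/-- The grading of `K[x, u] ⧸ J̆` with `deg x_i = m_i` and `deg u = 0`. -/
abbrev brevePiece (lam : G.gens → ℤ) (m : ℕ) :
    Submodule (Polynomial K) (MvPolynomial G.gens (Polynomial K) ⧸ G.breveIdeal lam) :=
  quotPiece (MvPolynomial.weightedHomogeneousSubmodule (Polynomial K) G.degs) (G.breveIdeal lam) m

instance (lam : G.gens → ℤ) : GradedAlgebra (G.brevePiece lam) :=
  gradedQuot _ _ (homogenizationIdeal_isHomogeneous lam G.degs _ G.ker_theta_isHomogeneous)

/-- The total space of the degeneration, the closed subscheme of `ℙ(m_1, …, m_p) × 𝔸¹` defined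
by `J̆`. -/
def family (lam : G.gens → ℤ) : Scheme.{u} := Proj (G.brevePiece lam)

/-- The morphism to the affine line `Spec K[u]`. -/
def toLine (lam : G.gens → ℤ) : G.family lam ⟶ Spec (.of (Polynomial K)) :=
  (@projStr (Polynomial K) (MvPolynomial G.gens (Polynomial K) ⧸ G.breveIdeal lam) _ _ _
    (G.brevePiece lam) inferInstance :)

end GenSystem

end Degeneration

/-- The structure morphism of the affine line. -/
def lineStr (K : Type u) [Field K] : Spec (.of (Polynomial K)) ⟶ Spec (.of K) :=
  Spec.map (CommRingCat.ofHom Polynomial.C)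

/-- The point `0` of the affine line. -/
def origin (K : Type u) [Field K] : Spec (.of K) ⟶ Spec (.of (Polynomial K)) :=
  Spec.map (CommRingCat.ofHom (Polynomial.evalRingHom 0))

/-- The complement of `0` in the affine line. -/
def punctured (K : Type u) [Field K] : (Spec (.of (Polynomial K))).Opens :=
  PrimeSpectrum.basicOpen (Polynomial.X : Polynomial K)

/-- The embedded toric variety `X_P`. -/
def XP (K : Type u) [Field K] [CharZero K] (P : NormalPolytope n) : Scheme.{u} :=
  Proj (degPiece K P)

def XPStr (K : Type u) [Field K] [CharZero K] (P : NormalPolytope n) : XP K P ⟶ Spec (.of K) :=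
  projStr (degPiece K P)

section XZero

variable {K : Type u} [Field K] [CharZero K] {P : NormalPolytope n}
  (S : Stratification K P) (t : Linearization P)

/-- The scheme `X_0 = Proj (gr_ν K[X̂_P])`. -/
def XZero : Scheme.{u} := Proj (grPiece S t)

def XZeroStr : XZero S t ⟶ Spec (.of K) := projStr (grPiece S t)

end XZero

end ToricSeshadri

end

open ToricSeshadri

/-! Everything is controlled by monomials. By normality the weights that occur are exactly the
lattice points of the cone over P (`mem_weightMonoid_iff`). The coordinate ring embeds in a Laurent
polynomial ring, and its basis satisfies f_l f_l' = f_(l+l'). The quasi-valuation is therefore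
determined by the numbers `val l`, the minimum over maximal chains of the values at weight l.

Convexity. The weights of the f_σ along a maximal chain form a basis (`linearIndependent_chain`,
`span_maxChain`), and every point of the cone has nonnegative coordinates for some maximal chain
(`exists_chain_repr`, by peeling off multiples of the vectors w σ). A nonnegative representation is
lexicographically at most any representation supported on a chain (`lex_le`), so the minimum
defining `val l` is attained on a chain whose cone contains l (`val_eq_of_nonneg`). Hence gr_ν has
the classes of the f_l as a basis, and the product of two classes is the class of f_(l+l') if `val`
is additive on the pair and 0 otherwise (`symb_mul`). In large degree some f_σ splits off
additively, which makes gr_ν finitely generated.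

Initial ideals. Call x^α standard if `val` is additive on its factors. Let K[x] → gr_ν be the map
`toGr`; it kills the other monomials. Whenever a degree function on exponents is, on each fibre of
the weight map, minimal exactly at the standard monomials, the initial ideal of J is the kernel of
`toGr` (`initialIdeal_eq_ker`). This applies to the preorder of ν. It also applies to an integral λ
obtained from a linear functional on ℚ^A that is positive on finitely many positive differences;
finitely many suffice because the pairs of exponents of equal weight form a finitely generated
monoid (`exists_functional`).

Degeneration. For any λ, the ideal of homogenizations is the kernel of x_i ↦ T^(λ_i) f_i, u ↦ T
(`ker_spread`). So K[x, u]/J̆ is a domain containing K[u], hence flat over it. Inverting u gives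
K[T, T⁻¹] ⊗ K[X̂_P] (`toGeneric_isBaseChange`). If in_λ J = in_ν J, setting u = 0 gives K[x]/in_λ J
= gr_ν (`ker_toSpecial`). Since Proj commutes with base change (`isPullback_projMap`), these two
computations describe the fibres. Surjectivity holds because π is proper and dominant. -/

noncomputable section

namespace ToricSeshadri

/-! ### Base change for Proj. -/

section

open HomogeneousLocalization TensorProduct

section TensorAct

variable {R M N : Type*} (S : Type*) [CommRing R] [CommRing S] [AddCommGroup M] [AddCommGroup N]
  [Algebra R S] [Module R M] [Module R N] [Module S N] [IsScalarTower R S N]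

/-- The map `s ⊗ m ↦ s • f m`, which is bijective if and only if `N` is the base change of `M`. -/
def tensorAct (f : M →ₗ[R] N) : S ⊗[R] M →ₗ[R] N :=
  TensorProduct.lift (((Algebra.linearMap S <| Module.End S (M →ₗ[R] N)).flip f).restrictScalars R)

theorem tensorAct_tmul (f : M →ₗ[R] N) (s : S) (m : M) : tensorAct S f (s ⊗ₜ m) = s • f m := by
  simp [tensorAct]

theorem isBaseChange_iff_bijective (f : M →ₗ[R] N) :
    IsBaseChange S f ↔ Function.Bijective (tensorAct S f) := Iff.rfl

end TensorAct

/-- A commutative square of schemes is cartesian if it is so locally on its upper right corner. -/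
theorem isPullback_of_openCover {X' X S' S : Scheme.{u}} {i : X' ⟶ X} {p' : X' ⟶ S'} {p : X ⟶ S}
    {s : S' ⟶ S} (w : i ≫ p = p' ≫ s) (𝒰 : X.OpenCover)
    (h : ∀ j, ∃ (Z : Scheme.{u}) (a : Z ⟶ X') (b : Z ⟶ 𝒰.X j), IsPullback a b i (𝒰.f j) ∧
      IsPullback b (a ≫ p') (𝒰.f j ≫ p) s) : IsPullback i p' p s := by
  -- The square is cartesian if the comparison map `c` to the fibre product is an isomorphism. This
  -- is tested on the pulled back cover, where `c` restricts to the map `z` between two pullbacks of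
  -- the same cospan.
  set c := pullback.lift i p' w with hc
  have hfst : c ≫ pullback.fst p s = i := pullback.lift_fst _ _ _
  have hsnd : c ≫ pullback.snd p s = p' := pullback.lift_snd _ _ _
  suffices hiso : IsIso c by
    refine IsPullback.of_iso_pullback ⟨w⟩ (asIso c) hfst hsnd
  change MorphismProperty.isomorphisms Scheme c
  refine IsZariskiLocalAtTarget.of_openCover (P := .isomorphisms _)
    (𝒰 := 𝒰.pullback₁ (pullback.fst p s)) fun j => ?_
  obtain ⟨Z, a, b, h1, h2⟩ := h j
  have hQ : IsPullback (pullback.fst (pullback.fst p s) (𝒰.f j))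
      (pullback.snd (pullback.fst p s) (𝒰.f j)) (pullback.fst p s) (𝒰.f j) :=
    IsPullback.of_hasPullback _ _
  have hQ' : IsPullback (pullback.snd (pullback.fst p s) (𝒰.f j))
      (pullback.fst (pullback.fst p s) (𝒰.f j) ≫ pullback.snd p s) (𝒰.f j ≫ p) s :=
    hQ.flip.paste_vert (IsPullback.of_hasPullback p s)
  let z : Z ⟶ pullback (pullback.fst p s) (𝒰.f j) := pullback.lift (a ≫ c) b
    (by rw [Category.assoc, hfst]; exact h1.w)
  have hz1 : z ≫ pullback.fst (pullback.fst p s) (𝒰.f j) = a ≫ c := pullback.lift_fst _ _ _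
  have hz2 : z ≫ pullback.snd (pullback.fst p s) (𝒰.f j) = b := pullback.lift_snd _ _ _
  have hzc : IsPullback a z c (pullback.fst (pullback.fst p s) (𝒰.f j)) := by
    refine IsPullback.of_bot (v₂₁ := pullback.snd (pullback.fst p s) (𝒰.f j)) ?_ hz1.symm hQ
    rw [hz2, hfst]
    exact h1
  have hzi : IsIso z := by
    have : z = (h2.isoIsPullback _ _ hQ').hom := by
      refine hQ'.hom_ext ?_ ?_
      · rw [hz2, IsPullback.isoIsPullback_hom_fst]
      · rw [IsPullback.isoIsPullback_hom_snd, reassoc_of% hz1, hsnd]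
    rw [this]
    infer_instance
  have : IsIso (pullback.snd c (pullback.fst (pullback.fst p s) (𝒰.f j))) := by
    rw [← hzc.isoPullback_inv_snd]
    infer_instance
  exact this

section AwayBaseChange

variable {R S A B : Type u} [CommRing R] [CommRing S] [CommRing A] [CommRing B]
  [Algebra R A] [Algebra S B]
  (𝒜 : ℕ → Submodule R A) (ℬ : ℕ → Submodule S B) [GradedAlgebra 𝒜] [GradedAlgebra ℬ]

/-- The structure homomorphism of the homogeneous localization of a graded `R`-algebra. -/
def awayStr (f : A) : R →+* Away 𝒜 f :=
  (fromZeroRingHom 𝒜 (.powers f)).comp (algebraMap R (𝒜 0))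

theorem val_awayStr (f : A) (r : R) :
    (awayStr 𝒜 f r).val = algebraMap A (Localization (.powers f)) (algebraMap R A r) := by
  change Localization.mk _ _ = _
  rw [← Localization.mk_one_eq_algebraMap]
  rfl

theorem awayι_projStr {f : A} {d : ℕ} (hf : f ∈ 𝒜 d) (hd : 0 < d) :
    Proj.awayι 𝒜 f hf hd ≫ projStr 𝒜 = Spec.map (CommRingCat.ofHom (awayStr 𝒜 f)) := by
  rw [projStr, Proj.awayι_toSpecZero_assoc, ← Spec.map_comp, ← CommRingCat.ofHom_comp]
  rfl

variable {𝒜 ℬ}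

theorem away_mk_eq_zero {f : A} {d : ℕ} (hf : f ∈ 𝒜 d) {n : ℕ} {x : A} {hx : x ∈ 𝒜 (n • d)}
    (h : Away.mk 𝒜 hf n x hx = 0) : ∃ k, f ^ k * x = 0 := by
  have h1 := congrArg HomogeneousLocalization.val h
  rw [Away.val_mk, val_zero, Localization.mk_eq_mk', IsLocalization.mk'_eq_zero_iff] at h1
  obtain ⟨⟨_, k, rfl⟩, h2⟩ := h1
  exact ⟨k, h2⟩

theorem away_mk_pow_mul {f : A} {d : ℕ} (hf : f ∈ 𝒜 d) (n k : ℕ) (x : A) (hx : x ∈ 𝒜 (n • d))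
    (hx' : f ^ k * x ∈ 𝒜 ((k + n) • d)) :
    Away.mk 𝒜 hf (k + n) (f ^ k * x) hx' = Away.mk 𝒜 hf n x hx := by
  ext
  rw [Away.val_mk, Away.val_mk, Localization.mk_eq_mk_iff, Localization.r_iff_exists]
  exact ⟨1, by simp only [OneMemClass.coe_one, one_mul, pow_add]; ring⟩

theorem away_mk_smul {f : A} {d : ℕ} (hf : f ∈ 𝒜 d) (n : ℕ) (r : R) (x : A)
    (hx : x ∈ 𝒜 (n • d)) : Away.mk 𝒜 hf n (r • x) (Submodule.smul_mem _ r hx) =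
      awayStr 𝒜 f r * Away.mk 𝒜 hf n x hx := by
  ext
  rw [val_mul, val_awayStr, Away.val_mk, Away.val_mk, ← Localization.mk_one_eq_algebraMap,
    Localization.mk_mul, one_mul, ← Algebra.smul_def]

variable [Algebra R S] [Algebra R B] [IsScalarTower R S B]

/-- The homomorphism between graded pieces induced by a graded homomorphism. -/
def pieceMap (φ : A →ₐ[R] B) (hφ : ∀ m, ∀ a ∈ 𝒜 m, φ a ∈ ℬ m) (m : ℕ) :
    𝒜 m →ₗ[R] ℬ m where
  toFun a := ⟨φ a, hφ m a a.2⟩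
  map_add' a b := by ext; simp
  map_smul' r a := by
    ext
    simp only [Submodule.coe_smul, map_smul, RingHom.id_apply]
    rw [← algebraMap_smul S r (φ a.1), ← algebraMap_smul S r (_ : ℬ m)]
    rfl

/-- The graded piece is a direct summand of the ring. Its projection splits the tensored inclusion,
which gives injectivity; taking components of degree m gives surjectivity. -/
theorem isBaseChange_pieceMap (φ : A →ₐ[R] B) (hφ : ∀ m, ∀ a ∈ 𝒜 m, φ a ∈ ℬ m)
    (H : IsBaseChange S φ.toLinearMap) (m : ℕ) : IsBaseChange S (pieceMap φ hφ m) := by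
  classical
  rw [isBaseChange_iff_bijective] at H ⊢
  have hcomm : ∀ z : S ⊗[R] 𝒜 m, tensorAct S φ.toLinearMap ((𝒜 m).subtype.lTensor S z) =
      (tensorAct S (pieceMap φ hφ m) z : B) := by
    intro z
    induction z with
    | zero => simp
    | tmul s a => simp [tensorAct_tmul, pieceMap]
    | add x y hx hy => rw [map_add, map_add, map_add, hx, hy]; rfl
  constructor
  · intro x y hxy
    have h1 : (𝒜 m).subtype.lTensor S x = (𝒜 m).subtype.lTensor S y :=
      H.1 (by rw [hcomm, hcomm, hxy])
    let p : A →ₗ[R] 𝒜 m := (GradedAlgebra.proj 𝒜 m).codRestrict _ fun a => by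
      rw [GradedAlgebra.proj_apply]; exact SetLike.coe_mem _
    have hp : p.comp (𝒜 m).subtype = LinearMap.id := by
      ext a
      simp [p, GradedAlgebra.proj_apply]
    have h2 : ∀ z : S ⊗[R] 𝒜 m, p.lTensor S ((𝒜 m).subtype.lTensor S z) = z := by
      intro z
      rw [← LinearMap.comp_apply, ← LinearMap.lTensor_comp, hp, LinearMap.lTensor_id]
      rfl
    rw [← h2 x, h1, h2]
  · have hspan : ∀ z : S ⊗[R] A, ∃ y : S ⊗[R] 𝒜 m,
        (tensorAct S (pieceMap φ hφ m) y : B) =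
          DirectSum.decompose ℬ (tensorAct S φ.toLinearMap z) m := by
      intro z
      induction z with
      | zero => exact ⟨0, by simp⟩
      | tmul s a =>
        refine ⟨s ⊗ₜ DirectSum.decompose 𝒜 a m, ?_⟩
        rw [tensorAct_tmul, tensorAct_tmul, DirectSum.decompose_smul, DirectSum.smul_apply,
          Submodule.coe_smul, Submodule.coe_smul]
        congr 1
        induction a using DirectSum.Decomposition.inductionOn 𝒜 with
        | zero => simp
        | @homogeneous j a =>
          by_cases h : j = m
          · subst h
            simp only [DirectSum.decompose_coe, DirectSum.of_eq_same, AlgHom.toLinearMap_apply]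
            rw [DirectSum.decompose_of_mem_same ℬ (hφ _ _ a.2)]
            rfl
          · rw [AlgHom.toLinearMap_apply, DirectSum.decompose_of_mem_ne ℬ (hφ _ _ a.2) h]
            simp [DirectSum.of_eq_of_ne _ _ _ (Ne.symm h)]
        | add a b ha hb =>
          simp only [DirectSum.decompose_add, DirectSum.add_apply, map_add, Submodule.coe_add,
            ha, hb]
      | add x y hx hy =>
        obtain ⟨x', hx⟩ := hx
        obtain ⟨y', hy⟩ := hy
        exact ⟨x' + y', by simp [hx, hy]⟩
    intro b
    obtain ⟨z, hz⟩ := H.2 b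
    obtain ⟨y, hy⟩ := hspan z
    refine ⟨y, Subtype.ext ?_⟩
    rw [hy, hz, DirectSum.decompose_coe, DirectSum.of_eq_same]

/-- The homogeneous localization of a base change is the base change of the homogeneous
localization. -/
theorem isPushout_away (g : 𝒜 →+*ᵍ ℬ) (φ : A →ₐ[R] B) (hg : ∀ a, g a = φ a)
    (H : IsBaseChange S φ.toLinearMap) {f : A} {d : ℕ} (hf : f ∈ 𝒜 d) :
    IsPushout (CommRingCat.ofHom (algebraMap R S)) (CommRingCat.ofHom (awayStr 𝒜 f))
      (CommRingCat.ofHom (awayStr ℬ (g f))) (CommRingCat.ofHom (Away.map g f)) := by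
  have hφ : ∀ m, ∀ a ∈ 𝒜 m, φ a ∈ ℬ m := fun m a ha => hg a ▸ Graded.map_mem g ha
  have hw : (awayStr ℬ (g f)).comp (algebraMap R S) = (Away.map g f).comp (awayStr 𝒜 f) := by
    ext r
    have h1 : awayStr 𝒜 f r = Away.mk 𝒜 hf 0 (algebraMap R A r)
        (by rw [zero_smul]; exact SetLike.algebraMap_mem_graded 𝒜 r) := by
      ext
      rw [val_awayStr, Away.val_mk, ← Localization.mk_one_eq_algebraMap]
      simp
      rfl
    rw [RingHom.comp_apply, RingHom.comp_apply, h1, Away.map_mk, val_awayStr, Away.val_mk]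
    simp only [hg, AlgHom.commutes]
    rw [ ← Localization.mk_one_eq_algebraMap,
      ← IsScalarTower.algebraMap_apply]
    simp
    rfl
  let i1 : Algebra R (Away 𝒜 f) := (awayStr 𝒜 f).toAlgebra
  let i2 : Algebra S (Away ℬ (g f)) := (awayStr ℬ (g f)).toAlgebra
  let i3 : Algebra (Away 𝒜 f) (Away ℬ (g f)) := (Away.map g f).toAlgebra
  let i4 : Algebra R (Away ℬ (g f)) := ((awayStr ℬ (g f)).comp (algebraMap R S)).toAlgebra
  have t1 : @IsScalarTower R S (Away ℬ (g f)) _ i2.toSMul i4.toSMul := IsScalarTower.of_algebraMap_eq' rfl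
  have t2 : @IsScalarTower R (Away 𝒜 f) (Away ℬ (g f)) i1.toSMul _ i4.toSMul := IsScalarTower.of_algebraMap_eq' hw
  suffices h : Algebra.IsPushout R S (Away 𝒜 f) (Away ℬ (g f)) from
    CommRingCat.isPushout_of_isPushout R S (Away 𝒜 f) (Away ℬ (g f))
  constructor
  rw [isBaseChange_iff_bijective]
  set F := tensorAct S (IsScalarTower.toAlgHom R (Away 𝒜 f) (Away ℬ (g f))).toLinearMap with hF
  have hdec := isBaseChange_pieceMap φ hφ H
  -- the fractions with denominator `f ^ n`
  let lam : ∀ n : ℕ, 𝒜 (n • d) →ₗ[R] Away 𝒜 f := fun n =>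
    { toFun := fun a => Away.mk 𝒜 hf n a a.2
      map_add' := fun a b => by
        ext
        simp only [Away.val_mk, val_add, Submodule.coe_add, Localization.add_mk_self]
      map_smul' := fun r a => away_mk_smul hf n r a a.2 }
  let mu : ∀ n : ℕ, ℬ (n • d) →ₗ[S] Away ℬ (g f) := fun n =>
    { toFun := fun b => Away.mk ℬ (Graded.map_mem g hf) n b b.2
      map_add' := fun a b => by
        ext
        simp only [Away.val_mk, val_add, Submodule.coe_add, Localization.add_mk_self]
      map_smul' := fun r a => away_mk_smul (Graded.map_mem g hf) n r a a.2 }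
  let pm : ∀ n k : ℕ, 𝒜 (n • d) →ₗ[R] 𝒜 ((k + n) • d) := fun n k =>
    { toFun := fun a => ⟨f ^ k * a, by
        rw [add_smul]; exact SetLike.mul_mem_graded (SetLike.pow_mem_graded k hf) a.2⟩
      map_add' := fun a b => by ext; simp [mul_add]
      map_smul' := fun r a => by ext; simp }
  have hpm : ∀ n k, (lam (k + n)).comp (pm n k) = lam n := fun n k =>
    LinearMap.ext fun a => away_mk_pow_mul hf n k a a.2 _
  have hsq : ∀ n (z : S ⊗[R] 𝒜 (n • d)), F ((lam n).lTensor S z) =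
      mu n (tensorAct S (pieceMap φ hφ (n • d)) z) := by
    intro n z
    induction z with
    | zero => simp
    | tmul s a =>
      rw [LinearMap.lTensor_tmul, hF, tensorAct_tmul, tensorAct_tmul, (mu n).map_smul]
      congr 1
      change Away.map g f (Away.mk 𝒜 hf n a a.2) = _
      rw [Away.map_mk]
      ext
      rw [Away.val_mk, hg a.1]
      rfl
    | add x y hx hy => simp only [map_add, hx, hy]
  -- The localization is a filtered colimit of the pieces of degree nd along multiplication by f, so
  -- a tensor can be written with a single denominator.
  have hsurj : ∀ z : S ⊗[R] Away 𝒜 f, ∃ n, ∃ y : S ⊗[R] 𝒜 (n • d), (lam n).lTensor S y = z := by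
    intro z
    induction z with
    | zero => exact ⟨0, 0, by simp⟩
    | tmul s a =>
      obtain ⟨n, a, ha, rfl⟩ := Away.mk_surjective 𝒜 hf a
      exact ⟨n, s ⊗ₜ ⟨a, ha⟩, by rw [LinearMap.lTensor_tmul]; rfl⟩
    | add x y hx hy =>
      obtain ⟨n, x, rfl⟩ := hx
      obtain ⟨k, y, rfl⟩ := hy
      refine ⟨k + n, (pm n k).lTensor S x +
        (Nat.add_comm n k ▸ (pm k n).lTensor S y : S ⊗[R] 𝒜 ((k + n) • d)), ?_⟩
      have : ∀ (a b : ℕ) (h : a = b) (w : S ⊗[R] 𝒜 (a • d)),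
          (lam b).lTensor S (h ▸ w) = (lam a).lTensor S w := by
        rintro a _ rfl w; rfl
      rw [map_add, this, ← LinearMap.comp_apply, ← LinearMap.comp_apply, ← LinearMap.lTensor_comp,
        ← LinearMap.lTensor_comp, hpm, hpm]
  constructor
  · rw [injective_iff_map_eq_zero]
    intro z hz
    obtain ⟨n, y, rfl⟩ := hsurj z
    rw [hsq] at hz
    -- A fraction is zero only if some f^k kills its numerator. Multiplying the tensor by f^k moves
    -- the question to the piece of degree (k + n)d, where the base change map is injective.
    obtain ⟨k, hk⟩ := away_mk_eq_zero (Graded.map_mem g hf) hz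
    have hcomm : ∀ w : S ⊗[R] 𝒜 (n • d),
        (tensorAct S (pieceMap φ hφ ((k + n) • d)) ((pm n k).lTensor S w) : B) =
          g f ^ k * tensorAct S (pieceMap φ hφ (n • d)) w := by
      intro w
      induction w with
      | zero => simp
      | tmul s a =>
        rw [LinearMap.lTensor_tmul, tensorAct_tmul, tensorAct_tmul]
        simp [pieceMap, pm, hg]
      | add x y hx hy => simp only [map_add, Submodule.coe_add, hx, hy, mul_add]
    have h0 : (pm n k).lTensor S y = 0 := by
      apply ((isBaseChange_iff_bijective S _).mp (hdec ((k + n) • d))).1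
      apply Subtype.ext
      rw [hcomm, map_zero]
      exact hk
    rw [← hpm n k, LinearMap.lTensor_comp, LinearMap.comp_apply, h0, map_zero]
  · intro x
    obtain ⟨n, b, hb, rfl⟩ := Away.mk_surjective ℬ (Graded.map_mem g hf) x
    obtain ⟨y, hy⟩ := ((isBaseChange_iff_bijective S _).mp (hdec (n • d))).2 ⟨b, hb⟩
    exact ⟨(lam n).lTensor S y, by rw [hsq, hy]; rfl⟩

/-- A homogeneous element of positive degree is an S-combination of images of elements of the same
degree. This is the condition under which `Proj.map` is defined on all of Proj. -/
theorem irrelevant_le_map (g : 𝒜 →+*ᵍ ℬ) (φ : A →ₐ[R] B) (hg : ∀ a, g a = φ a)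
    (H : IsBaseChange S φ.toLinearMap) : HomogeneousIdeal.irrelevant ℬ ≤
      (HomogeneousIdeal.irrelevant 𝒜).map g := by
  have hφ : ∀ m, ∀ a ∈ 𝒜 m, φ a ∈ ℬ m := fun m a ha => hg a ▸ Graded.map_mem g ha
  rw [HomogeneousIdeal.irrelevant_le]
  intro m hm b hb
  obtain ⟨z, hz⟩ := ((isBaseChange_iff_bijective S _).mp (isBaseChange_pieceMap φ hφ H m)).2 ⟨b, hb⟩
  have : ∀ z, (tensorAct S (pieceMap φ hφ m) z : B) ∈ (HomogeneousIdeal.irrelevant 𝒜).map g := by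
    intro z
    induction z with
    | zero => simp
    | tmul s a =>
      rw [tensorAct_tmul, Submodule.coe_smul, Algebra.smul_def]
      refine Ideal.mul_mem_left _ _ ?_
      change φ a ∈ _
      rw [← hg]
      refine Ideal.mem_map_of_mem _ ?_
      exact HomogeneousIdeal.mem_irrelevant_of_mem _ hm a.2
    | add x y hx hy =>
      rw [map_add, Submodule.coe_add]
      exact add_mem hx hy
  have := this z
  rwa [hz] at this

/-- `Proj` commutes with base change. -/
theorem isPullback_projMap (g : 𝒜 →+*ᵍ ℬ) (φ : A →ₐ[R] B) (hg : ∀ a, g a = φ a)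
    (H : IsBaseChange S φ.toLinearMap) :
    IsPullback (Proj.map g (irrelevant_le_map g φ hg H)) (projStr ℬ) (projStr 𝒜)
      (Spec.map (CommRingCat.ofHom (algebraMap R S))) := by
  have hirr := irrelevant_le_map g φ hg H
  have hw : ∀ (f : A) (d : ℕ) (hf : f ∈ 𝒜 d) (hd : 0 < d),
      IsPullback (Spec.map (CommRingCat.ofHom (Away.map g f)))
        (Spec.map (CommRingCat.ofHom (awayStr ℬ (g f))))
        (Spec.map (CommRingCat.ofHom (awayStr 𝒜 f)))
        (Spec.map (CommRingCat.ofHom (algebraMap R S))) := fun f d hf hd =>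
    (isPullback_SpecMap_of_isPushout _ _ _ _ (isPushout_away g φ hg H hf)).flip
  have hcomm : Proj.map g hirr ≫ projStr 𝒜 =
      projStr ℬ ≫ Spec.map (CommRingCat.ofHom (algebraMap R S)) := by
    have key : ∀ (i : ℕ) (hi : 0 < i) (f : A) (hf : f ∈ 𝒜 i),
        Proj.awayι ℬ (g f) (Graded.map_mem g hf) hi ≫ Proj.map g hirr ≫ projStr 𝒜 =
          Proj.awayι ℬ (g f) (Graded.map_mem g hf) hi ≫
            projStr ℬ ≫ Spec.map (CommRingCat.ofHom (algebraMap R S)) := by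
      intro i hi f hf
      rw [Proj.awayι_comp_map_assoc g hirr hi f hf, awayι_projStr,
        reassoc_of% (awayι_projStr ℬ (Graded.map_mem g hf) hi)]
      exact (hw _ _ hf hi).w
    exact (Proj.mapAffineOpenCover g hirr).openCover.hom_ext _ _ fun s => key s.1 s.1.2 s.2 s.2.2
  have key : ∀ (i : ℕ) (hi : 0 < i) (f : A) (hf : f ∈ 𝒜 i), ∃ (Z : Scheme.{u}) (a : Z ⟶ Proj ℬ)
      (b : Z ⟶ Spec (.of (Away 𝒜 f))),
      IsPullback a b (Proj.map g hirr) (Proj.awayι 𝒜 f hf hi) ∧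
      IsPullback b (a ≫ projStr ℬ) (Proj.awayι 𝒜 f hf hi ≫ projStr 𝒜)
        (Spec.map (CommRingCat.ofHom (algebraMap R S))) := by
    intro i hi f hf
    refine ⟨_, Proj.awayι ℬ (g f) (Graded.map_mem g hf) hi,
      Spec.map (CommRingCat.ofHom (Away.map g f)), ?_, ?_⟩
    -- The preimage of the chart D₊(f) is the chart D₊(g f).
    · refine (IsOpenImmersion.isPullback _ _ _ _ ?_ ?_).flip
      · exact Proj.awayι_comp_map g hirr hi _ hf
      · rw [Proj.opensRange_awayι, Proj.opensRange_awayι, Proj.map_preimage_basicOpen]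
    · rw [awayι_projStr, awayι_projStr]
      exact hw _ _ hf hi
  exact isPullback_of_openCover hcomm (Proj.affineOpenCover 𝒜).openCover fun s => key s.1 s.1.2 s.2 s.2.2

end AwayBaseChange

end

/-! ### Proj of a graded domain: integrality, flatness, properness, surjectivity. -/

section

open HomogeneousLocalization

theorem ringHom_flat_of_subsingleton {R C : Type*} [CommRing R] [CommRing C] [Subsingleton C]
    (φ : R →+* C) : φ.Flat := by
  algebraize [φ]
  exact (inferInstance : Module.Flat R C)

/-- A domain containing a principal ideal domain is torsion-free over it. -/
theorem ringHom_flat_of_injective {R C : Type*} [CommRing R] [CommRing C] [IsDomain R]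
    [IsPrincipalIdealRing R] [IsDomain C] (φ : R →+* C) (hφ : Function.Injective φ) : φ.Flat := by
  algebraize [φ]
  have : FaithfulSMul R C := (faithfulSMul_iff_algebraMap_injective R C).mpr hφ
  exact (inferInstance : Module.Flat R C)

section ProjDomain

variable {R A : Type u} [CommRing R] [CommRing A] [Algebra R A]
  (𝒜 : ℕ → Submodule R A) [GradedAlgebra 𝒜]

theorem away_isDomain [IsDomain A] {f : A} (hf : f ≠ 0) : IsDomain (Away 𝒜 f) := by
  have hle : Submonoid.powers f ≤ nonZeroDivisors A :=
    powers_le_nonZeroDivisors_of_noZeroDivisors hf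
  have : IsDomain (Localization (Submonoid.powers f)) := IsLocalization.isDomain_localization hle
  exact (val_injective (𝒜 := 𝒜) (Submonoid.powers f)).isDomain
    (algebraMap (Away 𝒜 f) (Localization (Submonoid.powers f)))

theorem away_isReduced [IsDomain A] (f : A) : _root_.IsReduced (Away 𝒜 f) := by
  by_cases hf : f = 0
  · have : Subsingleton (Localization (Submonoid.powers f)) :=
      IsLocalization.subsingleton (M := Submonoid.powers f) (hf ▸ Submonoid.mem_powers f)
    have : Subsingleton (Away 𝒜 f) := (val_injective (𝒜 := 𝒜) (Submonoid.powers f)).subsingleton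
    infer_instance
  · have := away_isDomain 𝒜 hf
    infer_instance

theorem proj_isReduced [IsDomain A] : IsReduced (Proj 𝒜) := by
  have : ∀ i, IsReduced ((Proj.affineOpenCover 𝒜).openCover.X i) := by
    intro i
    have : _root_.IsReduced (Away 𝒜 (i.2.1 : A)) := away_isReduced 𝒜 _
    change IsReduced (Spec (.of (Away 𝒜 (i.2.1 : A))))
    infer_instance
  exact IsReduced.of_openCover _ (Proj.affineOpenCover 𝒜).openCover

/-- The zero ideal is a homogeneous prime, and f ≠ 0 of positive degree shows that it does not
contain the irrelevant ideal. It is thus a point lying in every nonempty basic open set, which makes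
Proj irreducible; reducedness is checked on charts. -/
theorem proj_isIntegral [IsDomain A] {f : A} {d : ℕ} (hf : f ∈ 𝒜 d) (hd : 0 < d) (hf0 : f ≠ 0) :
    IsIntegral (Proj 𝒜) := by
  have := proj_isReduced 𝒜
  let η : Proj 𝒜 := (⟨⊥, Ideal.isPrime_bot, fun hle => by
    have : f ∈ (HomogeneousIdeal.irrelevant 𝒜) :=
      HomogeneousIdeal.mem_irrelevant_of_mem _ hd hf
    exact hf0 (by simpa using (show f ∈ (⊥ : Ideal A) from hle this))⟩ : ProjectiveSpectrum 𝒜)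
  have hη : Dense ({η} : Set (Proj 𝒜)) := by
    rw [(Proj.isBasis_basicOpen 𝒜).dense_iff]
    rintro o ⟨_, ⟨g, rfl⟩, rfl⟩ ⟨x, hx⟩
    refine ⟨η, ?_, rfl⟩
    change g ∉ (⊥ : HomogeneousIdeal 𝒜)
    intro h
    have h0 : g = 0 := by simpa using (show g ∈ (⊥ : Ideal A) from h)
    subst h0
    simp at hx
  have : IrreducibleSpace (Proj 𝒜) := by
    have h1 : IsIrreducible (Set.univ : Set (Proj 𝒜)) := by
      rw [← hη.closure_eq]
      exact isIrreducible_singleton.closure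
    have : PreirreducibleSpace (Proj 𝒜) := ⟨h1.2⟩
    exact { toNonempty := ⟨η⟩ }
  exact isIntegral_of_irreducibleSpace_of_isReduced _

theorem awayStr_injective [IsDomain A] (hinj : Function.Injective (algebraMap R A)) {f : A}
    (hf : f ≠ 0) : Function.Injective (awayStr 𝒜 f) := by
  intro a b h
  have h1 := congrArg HomogeneousLocalization.val h
  rw [val_awayStr, val_awayStr] at h1
  exact hinj (IsLocalization.injective _ (powers_le_nonZeroDivisors_of_noZeroDivisors hf) h1)

theorem awayι_projStr_flat [IsDomain R] [IsPrincipalIdealRing R] [IsDomain A]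
    (hinj : Function.Injective (algebraMap R A)) {f : A} {d : ℕ} (hf : f ∈ 𝒜 d) (hd : 0 < d) :
    Flat (Proj.awayι 𝒜 f hf hd ≫ projStr 𝒜) := by
  rw [awayι_projStr, Flat.SpecMap_iff]
  by_cases hf0 : f = 0
  -- The standard cover includes the chart of f = 0, which is empty.
  · have : Subsingleton (Localization (Submonoid.powers f)) :=
      IsLocalization.subsingleton (M := Submonoid.powers f)
        ⟨1, by simpa using hf0⟩
    have : Subsingleton (Away 𝒜 f) :=
      (val_injective (𝒜 := 𝒜) (Submonoid.powers f)).subsingleton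
    exact ringHom_flat_of_subsingleton _
  · have := away_isDomain 𝒜 hf0
    exact ringHom_flat_of_injective _ (awayStr_injective 𝒜 hinj hf0)

theorem projStr_flat [IsDomain R] [IsPrincipalIdealRing R] [IsDomain A]
    (hinj : Function.Injective (algebraMap R A)) : Flat (projStr 𝒜) := by
  have : IsZariskiLocalAtSource @AlgebraicGeometry.Flat :=
    HasRingHomProperty.instIsZariskiLocalAtSource (Q := RingHom.Flat)
  rw [IsZariskiLocalAtSource.iff_of_openCover (P := @AlgebraicGeometry.Flat) (Proj.affineOpenCover 𝒜).openCover]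
  intro i
  obtain ⟨d, f, hf⟩ : (i : ℕ+) × 𝒜 i := i
  exact awayι_projStr_flat 𝒜 hinj hf d.2

/-- Proj is proper over the spectrum of its degree zero part by finite generation, and that spectrum
is a closed subscheme of Spec R. -/
theorem projStr_isProper (hs : Function.Surjective (algebraMap R (𝒜 0)))
    [Algebra.FiniteType R A] : IsProper (projStr 𝒜) := by
  have : Algebra.FiniteType (𝒜 0) A := by
    have : IsScalarTower R (𝒜 0) A := ⟨fun r a b => by
      change ((r • a : 𝒜 0) : A) * b = r • ((a : A) * b)
      rw [Submodule.coe_smul, smul_mul_assoc]⟩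
    exact Algebra.FiniteType.of_restrictScalars_finiteType R (𝒜 0) A
  have : IsClosedImmersion (Spec.map (CommRingCat.ofHom (algebraMap R (𝒜 0)))) :=
    IsClosedImmersion.spec_of_surjective _ hs
  unfold projStr
  infer_instance

/-- A single nonempty chart already dominates Spec R, and the image is closed by properness. -/
theorem projStr_surjective [IsDomain A] (hs : Function.Surjective (algebraMap R (𝒜 0)))
    [Algebra.FiniteType R A] (hinj : Function.Injective (algebraMap R A)) {f : A} {d : ℕ}
    (hf : f ∈ 𝒜 d) (hd : 0 < d) (hf0 : f ≠ 0) : Surjective (projStr 𝒜) := by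
  have := projStr_isProper 𝒜 hs
  have : IsDominant (Proj.awayι 𝒜 f hf hd ≫ projStr 𝒜) := by
    rw [awayι_projStr]
    refine ⟨?_⟩
    refine (PrimeSpectrum.denseRange_comap_iff_ker_le_nilRadical _).mpr ?_
    rw [CommRingCat.hom_ofHom, (RingHom.injective_iff_ker_eq_bot _).mp (awayStr_injective 𝒜 hinj hf0)]
    exact bot_le
  have : IsDominant (projStr 𝒜) := IsDominant.of_comp (Proj.awayι 𝒜 f hf hd) _
  exact surjective_of_isDominant_of_isClosed_range _ (projStr 𝒜).isClosedMap.isClosed_range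

end ProjDomain

end

/-! ### Convex geometry of a cone with one chosen vector in each face. -/

section

section Cones

open Module

variable {V : Type*} [AddCommGroup V] [Module ℝ V]

/-- A finitely generated cone is an intersection of finitely many half spaces. -/
theorem exists_dual_description [FiniteDimensional ℝ V] {ι : Type*} (s : Finset ι) (v : ι → V) :
    ∃ G : Set (Dual ℝ V), G.Finite ∧ ∀ x, (∃ c : ι → ℝ, (∀ i, 0 ≤ c i) ∧ x = ∑ i ∈ s, c i • v i) ↔
      ∀ g ∈ G, 0 ≤ g x := by
  classical
  induction s using Finset.induction_on with
  | empty =>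
    let b := Module.finBasis ℝ V
    refine ⟨Set.range b.coord ∪ Set.range fun i => -b.coord i,
      (Set.finite_range _).union (Set.finite_range _), fun x => ⟨?_, fun h => ⟨0, by simp, ?_⟩⟩⟩
    · rintro ⟨c, -, rfl⟩
      simp
    · rw [Finset.sum_empty]
      refine (b.ext_elem_iff).mpr fun i => ?_
      have h1 := h _ (Or.inl ⟨i, rfl⟩)
      have h2 := h _ (Or.inr ⟨i, rfl⟩)
      simp only [LinearMap.neg_apply, Basis.coord_apply] at h1 h2
      simp only [map_zero, Finsupp.coe_zero, Pi.zero_apply]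
      linarith
  | insert j s hj ih =>
    obtain ⟨G, hG, h⟩ := ih
    let w := v j
    -- Fourier–Motzkin elimination of the coefficient r of the new generator w: keep the
    -- inequalities that w satisfies, and combine each g with g w < 0 (a lower bound for r) with
    -- each g with g w > 0 (an upper bound) so that w cancels.
    let G' : Set (Dual ℝ V) := {g ∈ G | 0 ≤ g w} ∪
      (fun p : Dual ℝ V × Dual ℝ V => p.2 w • p.1 - p.1 w • p.2) '' {p ∈ G ×ˢ G | p.1 w < 0 ∧ 0 < p.2 w}
    have key : ∀ x, (∃ r : ℝ, 0 ≤ r ∧ ∀ g ∈ G, 0 ≤ g (x - r • w)) ↔ ∀ g ∈ G', 0 ≤ g x := by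
      intro x
      constructor
      · rintro ⟨r, hr, hx⟩ g (⟨hg, hgw⟩ | ⟨⟨p, q⟩, ⟨⟨hp, hq⟩, hpw, hqw⟩, rfl⟩)
        · have := hx g hg
          simp only [map_sub, map_smul, smul_eq_mul] at this
          have := mul_nonneg hr hgw
          linarith
        · have h1 := hx p hp
          have h2 := hx q hq
          simp only [map_sub, map_smul, smul_eq_mul] at h1 h2
          simp only [LinearMap.sub_apply, LinearMap.smul_apply, smul_eq_mul] at hpw hqw ⊢
          have h3 := mul_nonneg hqw.le h1
          have h4 := mul_nonneg (neg_nonneg.mpr hpw.le) h2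
          linarith
      · intro hx
        -- The lower bounds for r, including 0. Their maximum is the least possible r, and it meets
        -- the upper bounds by the combined inequalities.
        let L : Finset ℝ := insert 0 ((hG.toFinset.filter fun g => g w < 0).image fun g => g x / g w)
        have hL : L.Nonempty := ⟨0, Finset.mem_insert_self _ _⟩
        refine ⟨L.max' hL, L.le_max' _ (Finset.mem_insert_self _ _), fun g hg => ?_⟩
        simp only [map_sub, map_smul, smul_eq_mul]
        rcases lt_trichotomy (g w) 0 with hgw | hgw | hgw
        · have hle : g x / g w ≤ L.max' hL := L.le_max' _ (Finset.mem_insert_of_mem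
            (Finset.mem_image_of_mem _ (Finset.mem_filter.mpr ⟨hG.mem_toFinset.mpr hg, hgw⟩)))
          rw [div_le_iff_of_neg hgw] at hle
          linarith
        · rw [hgw]
          have := hx g (Or.inl ⟨hg, hgw.ge⟩)
          linarith
        · have hm := L.max'_mem hL
          rw [Finset.mem_insert, Finset.mem_image] at hm
          rcases hm with hm | ⟨p, hp, hm⟩
          · rw [hm]
            have := hx g (Or.inl ⟨hg, hgw.le⟩)
            linarith
          · rw [Finset.mem_filter, hG.mem_toFinset] at hp
            rw [← hm]
            have := hx _ (Or.inr ⟨(p, g), ⟨⟨hp.1, hg⟩, hp.2, hgw⟩, rfl⟩)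
            simp only [LinearMap.sub_apply, LinearMap.smul_apply, smul_eq_mul] at this
            have h1 : 0 ≤ (g w * p x - p w * g x) / (-p w) :=
              div_nonneg this (neg_nonneg.mpr hp.2.le)
            have h2 : (g w * p x - p w * g x) / (-p w) = g x - p x / p w * g w := by
              field_simp [hp.2.ne]
              ring
            linarith
    refine ⟨G', ?_, fun x => ?_⟩
    · refine (hG.subset fun g hg => hg.1).union (Set.Finite.image _ ?_)
      exact (hG.prod hG).subset fun p hp => hp.1
    · rw [← key]
      constructor
      · rintro ⟨c, hc, rfl⟩
        refine ⟨c j, hc j, (h _).mp ⟨c, hc, ?_⟩⟩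
        rw [Finset.sum_insert hj, add_sub_cancel_left]
      · rintro ⟨r, hr, hx⟩
        obtain ⟨c, hc, hx⟩ := (h _).mpr hx
        refine ⟨Function.update c j r, fun i => ?_, ?_⟩
        · by_cases hij : i = j
          · subst hij; simpa using hr
          · rw [Function.update_of_ne hij]; exact hc i
        · rw [Finset.sum_insert hj, Function.update_self, Finset.sum_congr rfl
            (fun i hi => by rw [Function.update_of_ne (ne_of_mem_of_not_mem hi hj)]), ← hx]
          abel

/-- The cone over a polytope, given by its vertices `v`, with its nonempty faces `σ : F` (given by
supporting functionals `φ σ`), and a vector `w σ` in the relative interior of each of the cones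
over the faces. -/
structure FacedCone (ι F V : Type*) [Fintype ι] [PartialOrder F] [AddCommGroup V] [Module ℝ V] where
  v : ι → V
  φ : F → Dual ℝ V
  w : F → V
  dg : Dual ℝ V
  φ_nonneg : ∀ σ i, 0 ≤ φ σ (v i)
  exists_face : ∀ g : Dual ℝ V, (∀ i, 0 ≤ g (v i)) → (∃ i, g (v i) = 0) →
    ∃ σ, ∀ i, g (v i) = 0 ↔ φ σ (v i) = 0
  le_iff : ∀ σ τ, σ ≤ τ ↔ ∀ i, φ σ (v i) = 0 → φ τ (v i) = 0
  w_mem : ∀ σ, ∃ c : ι → ℝ, (∀ i, 0 ≤ c i) ∧ (∀ i, c i ≠ 0 → φ σ (v i) = 0) ∧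
    w σ = ∑ i, c i • v i
  interior : ∀ σ τ, φ τ (w σ) = 0 → σ ≤ τ
  spans : ∀ g : Dual ℝ V, (∀ i, g (v i) = 0) → g = 0
  dg_pos : ∀ i, 0 < dg (v i)
  dg_w_pos : ∀ σ, 0 < dg (w σ)

namespace FacedCone

variable {ι F : Type*} [Fintype ι] [PartialOrder F] (D : FacedCone ι F V)

theorem nonneg_of_mem {g : Dual ℝ V} (hg : ∀ i, 0 ≤ g (D.v i)) (c : ι → ℝ) (hc : ∀ i, 0 ≤ c i) :
    0 ≤ g (∑ i, c i • D.v i) := by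
  rw [map_sum]
  exact Finset.sum_nonneg fun i _ => by
    rw [map_smul]; exact mul_nonneg (hc i) (hg i)

theorem nonneg_w {g : Dual ℝ V} (hg : ∀ i, 0 ≤ g (D.v i)) (σ : F) : 0 ≤ g (D.w σ) := by
  obtain ⟨c, hc, -, hw⟩ := D.w_mem σ
  rw [hw]
  exact D.nonneg_of_mem hg c hc

theorem eq_zero_of_face {g : Dual ℝ V} {σ : F} (hg : ∀ i, D.φ σ (D.v i) = 0 → g (D.v i) = 0) :
    g (D.w σ) = 0 := by
  obtain ⟨c, hc, hc', hw⟩ := D.w_mem σ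
  rw [hw, map_sum]
  refine Finset.sum_eq_zero fun i _ => ?_
  rw [map_smul]
  by_cases h : c i = 0
  · simp [h]
  · rw [hg i (hc' i h), smul_zero]

theorem eq_zero_of_sum {g : Dual ℝ V} (hg : ∀ i, 0 ≤ g (D.v i)) {c : ι → ℝ} (hc : ∀ i, 0 ≤ c i)
    (h : g (∑ i, c i • D.v i) = 0) (i : ι) (hi : c i ≠ 0) : g (D.v i) = 0 := by
  rw [map_sum, Finset.sum_eq_zero_iff_of_nonneg] at h
  · have := h i (Finset.mem_univ i)
    rw [map_smul, smul_eq_mul] at this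
    exact (mul_eq_zero.mp this).resolve_left hi
  · intro i _
    rw [map_smul]
    exact mul_nonneg (hc i) (hg i)

/-- Induction on the face: subtract from x the largest multiple of w σ that leaves x in the cone.
The remainder is zero or lies on a face strictly below σ, and adding σ to a chain strictly below it
keeps it a chain. -/
theorem exists_chain_repr [Fintype F] [FiniteDimensional ℝ V] (σ : F) : ∀ c : ι → ℝ, (∀ i, 0 ≤ c i) →
    D.φ σ (∑ i, c i • D.v i) = 0 → ∃ a : F → ℝ, (∀ τ, 0 ≤ a τ) ∧ (∀ τ, a τ ≠ 0 → τ ≤ σ) ∧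
      IsChain (· ≤ ·) {τ | a τ ≠ 0} ∧ ∑ i, c i • D.v i = ∑ τ, a τ • D.w τ := by
  classical
  induction σ using WellFoundedLT.induction with
  | ind σ ih =>
  intro c hc hφ
  set x := ∑ i, c i • D.v i with hx
  obtain ⟨G, hG, hGx⟩ := exists_dual_description Finset.univ D.v
  have hGv : ∀ g ∈ G, ∀ i, 0 ≤ g (D.v i) := by
    intro g hg i
    refine (hGx (D.v i)).mp ⟨Pi.single i 1, fun j => ?_, ?_⟩ g hg
    · by_cases h : j = i
      · subst h; simp
      · simp [h]
    · simp [Pi.single_apply]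
  -- Only the inequalities positive at w σ limit how much can be subtracted. If there were none, −w
  -- σ would lie in the cone, against positivity of the degree.
  let T : Finset (Dual ℝ V) := hG.toFinset.filter fun g => 0 < g (D.w σ)
  have hT : T.Nonempty := by
    by_contra hT
    have hle : ∀ g ∈ G, 0 ≤ g (-D.w σ) := by
      intro g hg
      rw [map_neg, neg_nonneg]
      by_contra! hlt
      exact hT ⟨g, Finset.mem_filter.mpr ⟨hG.mem_toFinset.mpr hg, hlt⟩⟩
    obtain ⟨e, he, hw⟩ := (hGx _).mpr hle
    have := D.nonneg_of_mem (fun i => (D.dg_pos i).le) e he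
    rw [← hw, map_neg] at this
    linarith [D.dg_w_pos σ]
  obtain ⟨g, hgT, hmin⟩ := T.exists_min_image (fun g => g x / g (D.w σ)) hT
  obtain ⟨hgG, hgw⟩ := Finset.mem_filter.mp hgT
  rw [hG.mem_toFinset] at hgG
  set r := g x / g (D.w σ) with hr
  have hr0 : 0 ≤ r := div_nonneg (D.nonneg_of_mem (hGv g hgG) c hc) hgw.le
  have hy : ∀ k ∈ G, 0 ≤ k (x - r • D.w σ) := by
    intro k hk
    rw [map_sub, map_smul, smul_eq_mul]
    have h0 : 0 ≤ k x := D.nonneg_of_mem (hGv k hk) c hc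
    rcases (D.nonneg_w (hGv k hk) σ).eq_or_lt with h | h
    · rw [← h]; linarith
    · have := hmin k (Finset.mem_filter.mpr ⟨hG.mem_toFinset.mpr hk, h⟩)
      rw [le_div_iff₀ h] at this
      linarith
  obtain ⟨e, he, hye⟩ := (hGx _).mpr hy
  have hφw : D.φ σ (D.w σ) = 0 := D.eq_zero_of_face fun i h => h
  -- The minimizing g vanishes at the remainder, so g + φ σ cuts out a face of σ containing it. The
  -- face is proper because g (w σ) > 0.
  have hgy : (g + D.φ σ) (∑ i, e i • D.v i) = 0 := by
    rw [← hye, LinearMap.add_apply, map_sub, map_sub, map_smul, map_smul, hφ, hφw, hr, smul_eq_mul,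
      div_mul_cancel₀ _ hgw.ne']
    simp
  have hpos : ∀ i, 0 ≤ (g + D.φ σ) (D.v i) := fun i => add_nonneg (hGv g hgG i) (D.φ_nonneg σ i)
  have hzero := D.eq_zero_of_sum hpos he hgy
  have hb : ∃ b : F → ℝ, (∀ τ, 0 ≤ b τ) ∧ (∀ τ, b τ ≠ 0 → τ < σ) ∧
      IsChain (· ≤ ·) {τ | b τ ≠ 0} ∧ ∑ i, e i • D.v i = ∑ τ, b τ • D.w τ := by
    by_cases he0 : ∀ i, e i = 0
    · exact ⟨0, by simp, by simp, by simp [IsChain], by simp [he0]⟩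
    · push Not at he0
      obtain ⟨i, hi⟩ := he0
      obtain ⟨τ, hτ⟩ := D.exists_face _ hpos ⟨i, hzero i hi⟩
      have hle : τ ≤ σ := by
        rw [D.le_iff]
        intro j hj
        have h1 := (hτ j).mpr hj
        rw [LinearMap.add_apply] at h1
        linarith [hGv g hgG j, D.φ_nonneg σ j]
      have hne : τ ≠ σ := by
        rintro rfl
        have h1 : (g + D.φ τ) (D.w τ) = 0 := D.eq_zero_of_face fun j hj => (hτ j).mpr hj
        rw [LinearMap.add_apply, hφw] at h1
        linarith
      have hlt := lt_of_le_of_ne hle hne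
      obtain ⟨b, hb, hb', hbc, hbs⟩ := ih τ hlt e he (by
        rw [map_sum]
        refine Finset.sum_eq_zero fun j _ => ?_
        rw [map_smul]
        by_cases hj : e j = 0
        · simp [hj]
        · rw [(hτ j).mp (hzero j hj), smul_zero])
      exact ⟨b, hb, fun ρ hρ => (hb' ρ hρ).trans_lt hlt, hbc, hbs⟩
  obtain ⟨b, hb, hb', hbc, hbs⟩ := hb
  refine ⟨b + Pi.single σ r, fun τ => ?_, fun τ hτ => ?_, ?_, ?_⟩
  · refine add_nonneg (hb τ) ?_
    by_cases h : τ = σ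
    · subst h; simpa using hr0
    · simp [h]
  · by_cases h : τ = σ
    · exact h.le
    · exact (hb' τ (by simpa [h] using hτ)).le
  · refine (hbc.insert (a := σ) fun τ hτ _ => Or.inr (hb' τ hτ).le).mono ?_
    intro τ hτ
    by_cases h : τ = σ
    · exact Or.inl h
    · exact Or.inr (by simpa [h] using hτ)
  · simp only [Pi.add_apply, add_smul, Finset.sum_add_distrib]
    rw [← hbs, ← hye]
    simp [Pi.single_apply]

/-- A functional whose zeros on the cone are the faces in a given set, if this set is a chain. -/
theorem exists_pred [Finite F] {C : Set F} (hC : IsChain (· ≤ ·) C) :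
    ∃ h : Dual ℝ V, (∀ i, 0 ≤ h (D.v i)) ∧ (∀ σ ∈ C, ∀ i, D.φ σ (D.v i) = 0 → h (D.v i) = 0) ∧
      (∀ i, h (D.v i) = 0 → ∃ σ ∈ C, D.φ σ (D.v i) = 0) ∧
      ∀ τ, h (D.w τ) = 0 → ∃ σ ∈ C, τ ≤ σ := by
  rcases C.eq_empty_or_nonempty with rfl | hne
  -- For the empty chain the required zero set is the origin alone, and the degree functional has
  -- it.
  · exact ⟨D.dg, fun i => (D.dg_pos i).le, by simp, fun i hi => absurd hi (D.dg_pos i).ne',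
      fun τ hτ => absurd hτ (D.dg_w_pos τ).ne'⟩
  · obtain ⟨σ, hσ⟩ := C.toFinite.exists_maximal hne
    have hmax : ∀ τ ∈ C, τ ≤ σ := fun τ hτ =>
      (hC.total hτ hσ.1).elim id fun h => hσ.2 hτ h
    exact ⟨D.φ σ, D.φ_nonneg σ, fun τ hτ i hi => (D.le_iff τ σ).mp (hmax τ hτ) i hi,
      fun i hi => ⟨σ, hσ.1, hi⟩, fun τ hτ => ⟨σ, hσ.1, D.interior τ σ hτ⟩⟩

/-- Among the representations of a vector by the `w σ` with nonnegative coefficients, those which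
are supported on a chain are lexicographically maximal. -/
theorem lex_le [Fintype F] (r : LinearOrder F) (hr : ∀ σ τ : F, σ ≤ τ → r.le σ τ) {a b : F → ℝ}
    (ha : ∀ σ, 0 ≤ a σ) (hb : IsChain (· ≤ ·) {σ | b σ ≠ 0})
    (hab : ∑ σ, a σ • D.w σ = ∑ σ, b σ • D.w σ) :
    a = b ∨ ∃ τ, (∀ σ, r.lt τ σ → a σ = b σ) ∧ a τ < b τ := by
  by_cases hne : a = b
  · exact Or.inl hne
  refine Or.inr ?_
  have hex : ∃ τ, a τ ≠ b τ ∧ ∀ σ, r.lt τ σ → a σ = b σ := by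
    obtain ⟨τ, hτ⟩ := Function.ne_iff.mp hne
    obtain ⟨ρ, hρ⟩ := @Set.Finite.exists_maximal F r.toLE _ {τ | a τ ≠ b τ} (Set.toFinite _)
      ⟨τ, hτ⟩
    refine ⟨ρ, hρ.1, fun σ hσ => ?_⟩
    by_contra hσ'
    exact absurd (hρ.2 hσ' (@le_of_lt _ r.toPreorder _ _ hσ)) (@not_le_of_gt _ r.toPreorder _ _ hσ)
  obtain ⟨τ, hτ, hgt⟩ := hex
  refine ⟨τ, hgt, lt_of_le_of_ne ?_ hτ⟩
  by_contra! hlt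
  -- Suppose b τ < a τ at the largest face where a and b differ. Choose h vanishing on the members
  -- of the support of b below τ; it is positive at w τ because the linear order extends inclusion.
  -- In ∑ (a − b) h(w) the terms above τ vanish, those below are nonnegative and the one at τ is
  -- positive, although the sum is 0.
  obtain ⟨h, h0, h1, -, h3⟩ := D.exists_pred
    (C := {σ | b σ ≠ 0 ∧ r.lt σ τ}) (hb.mono fun σ hσ => hσ.1)
  have hw : 0 < h (D.w τ) := by
    refine lt_of_le_of_ne (D.nonneg_w h0 τ) fun h4 => ?_
    obtain ⟨σ, hσ, hle⟩ := h3 τ h4.symm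
    exact absurd (hr _ _ hle) (@not_le_of_gt _ r.toPreorder _ _ hσ.2)
  have hsum : ∑ σ, (a σ - b σ) * h (D.w σ) = 0 := by
    have := congrArg h hab
    simp only [map_sum, map_smul, smul_eq_mul] at this
    simp only [sub_mul, Finset.sum_sub_distrib]
    linarith
  refine absurd hsum (Finset.sum_pos' (fun σ _ => ?_) ⟨τ, Finset.mem_univ τ,
    mul_pos (sub_pos.mpr hlt) hw⟩).ne'
  rcases @lt_trichotomy _ r σ τ with hσ | rfl | hσ
  · by_cases hbσ : b σ = 0
    · rw [hbσ, sub_zero]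
      exact mul_nonneg (ha σ) (D.nonneg_w h0 σ)
    · rw [D.eq_zero_of_face (h1 σ ⟨hbσ, hσ⟩), mul_zero]
  · exact (mul_pos (sub_pos.mpr hlt) hw).le
  · rw [hgt σ hσ, sub_self, zero_mul]

/-- A functional vanishing on the smaller members of the support but not at the vector of its
largest member τ isolates the coefficient of τ. -/
theorem eq_zero_of_chain_sum [Fintype F] {b : F → ℝ} (hb : IsChain (· ≤ ·) {σ | b σ ≠ 0})
    (h : ∑ σ, b σ • D.w σ = 0) : b = 0 := by
  classical
  by_contra hne
  obtain ⟨τ, hτ⟩ := (Set.toFinite {σ | b σ ≠ 0}).exists_maximal (Function.ne_iff.mp hne)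
  obtain ⟨g, -, h1, -, h3⟩ := D.exists_pred
    (C := {σ | b σ ≠ 0 ∧ σ < τ}) (hb.mono fun σ hσ => hσ.1)
  have h4 := congrArg g h
  rw [map_sum, map_zero, Finset.sum_eq_single τ] at h4
  · rw [map_smul, smul_eq_mul] at h4
    obtain ⟨σ, hσ, hle⟩ := h3 τ ((mul_eq_zero.mp h4).resolve_left hτ.1)
    exact absurd hσ.2 hle.not_gt
  · intro σ _ hσ
    rw [map_smul]
    by_cases hbσ : b σ = 0
    · simp [hbσ]
    · have hle : σ ≤ τ := (hb.total hbσ hτ.1).elim id fun h => hτ.2 hbσ h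
      rw [D.eq_zero_of_face (h1 σ ⟨hbσ, lt_of_le_of_ne hle hσ⟩), smul_zero]
  · intro hτ'
    exact absurd (Finset.mem_univ τ) hτ'

theorem _root_.IsMaxChain.mem_of_comparable {α : Type*} {r : α → α → Prop} {C : Set α}
    (hC : IsMaxChain r C) {x : α} (h : ∀ y ∈ C, r x y ∨ r y x) : x ∈ C :=
  (hC.2 (hC.1.insert fun y hy _ => h y hy) (Set.subset_insert x C)).symm ▸ Set.mem_insert x C

/-- The vectors along a maximal chain span. Otherwise let τ be the smallest member of the chain on
which g ≠ 0, and let h ≥ 0 cut out the members below τ. Tilting h by a multiple of ±g until it first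
vanishes at a further vertex of τ gives a face ρ ≤ τ comparable with the whole chain, so ρ belongs
to it. If ρ < τ, then g vanishes on ρ by minimality, but not at the further vertex. If ρ = τ,
evaluating at w τ, where g = 0, gives h (w τ) = 0, which the choice of h excludes. -/
theorem eq_zero_of_maxChain [Finite F] {C : Set F} (hC : IsMaxChain (· ≤ ·) C) {g : Dual ℝ V}
    (hg : ∀ σ ∈ C, g (D.w σ) = 0) : g = 0 := by
  classical
  by_contra hne
  obtain ⟨i₀, hi₀⟩ : ∃ i, g (D.v i) ≠ 0 := by
    by_contra! hcon
    exact hne (D.spans g hcon)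
  -- The zero functional gives the improper face, which lies in every maximal chain; so some member
  -- of C has a vertex with g ≠ 0.
  obtain ⟨τ₀, hτ₀⟩ := D.exists_face 0 (by simp) ⟨i₀, rfl⟩
  have hτ₀C : τ₀ ∈ C := hC.mem_of_comparable fun σ _ =>
    Or.inr ((D.le_iff σ τ₀).mpr fun i _ => (hτ₀ i).mp rfl)
  obtain ⟨τ, ⟨hτC, i₁, hi₁, hgi₁⟩, hτmin⟩ :=
    (Set.toFinite {σ | σ ∈ C ∧ ∃ i, D.φ σ (D.v i) = 0 ∧ g (D.v i) ≠ 0}).exists_minimal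
      ⟨τ₀, hτ₀C, i₀, (hτ₀ i₀).mp rfl, hi₀⟩
  obtain ⟨k, hk, hki⟩ : ∃ k : Dual ℝ V, (∀ x, g x = 0 ↔ k x = 0) ∧ k (D.v i₁) < 0 := by
    rcases lt_or_gt_of_ne hgi₁ with h | h
    · exact ⟨g, fun x => Iff.rfl, h⟩
    · exact ⟨-g, fun x => by simp, by simpa using h⟩
  have hmin : ∀ σ ∈ C, σ < τ → ∀ i, D.φ σ (D.v i) = 0 → k (D.v i) = 0 := by
    intro σ hσ hlt i hi
    by_contra hki
    exact absurd hlt (hτmin ⟨hσ, i, hi, fun h => hki ((hk _).mp h)⟩ hlt.le).not_gt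
  obtain ⟨h, h0, h1, -, h3⟩ := D.exists_pred
    (C := {σ | σ ∈ C ∧ σ < τ}) (hC.1.mono fun σ hσ => hσ.1)
  -- The least ratio h / (−k) over the vertices of τ with k < 0 is the first s at which h + s k
  -- acquires a new zero on τ.
  obtain ⟨i, hi, himin⟩ := (Finset.univ.filter fun i => D.φ τ (D.v i) = 0 ∧ k (D.v i) < 0).exists_min_image
    (fun i => h (D.v i) / -k (D.v i)) ⟨i₁, by simp [hi₁, hki]⟩
  simp only [Finset.mem_filter, Finset.mem_univ, true_and] at hi himin
  set s := h (D.v i) / -k (D.v i) with hs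
  have hsi : h (D.v i) + s * k (D.v i) = 0 := by
    have : -k (D.v i) ≠ 0 := (neg_pos.mpr hi.2).ne'
    have h4 := div_mul_cancel₀ (h (D.v i)) this
    rw [← hs] at h4
    linarith
  have hs0 : 0 ≤ s := div_nonneg (h0 i) (neg_nonneg.mpr hi.2.le)
  have hτ0 : ∀ j, D.φ τ (D.v j) = 0 → 0 ≤ (h + s • k) (D.v j) := by
    intro j hj
    rw [LinearMap.add_apply, LinearMap.smul_apply, smul_eq_mul]
    by_cases hkj : k (D.v j) < 0
    · have := himin j ⟨hj, hkj⟩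
      rw [le_div_iff₀ (neg_pos.mpr hkj)] at this
      linarith
    · exact add_nonneg (h0 j) (mul_nonneg hs0 (not_lt.mp hkj))
  -- Large enough that adding N φ τ makes the functional positive at all vertices outside τ without
  -- changing it on τ. Vertices on τ contribute 0 to the sum, division by zero being 0.
  let N : ℝ := 1 + ∑ j, |(h + s • k) (D.v j)| / D.φ τ (D.v j)
  have hN : ∀ j, 0 < D.φ τ (D.v j) → 0 < (h + s • k + N • D.φ τ) (D.v j) := by
    intro j hj
    have h4 : |(h + s • k) (D.v j)| / D.φ τ (D.v j) ≤
        ∑ j, |(h + s • k) (D.v j)| / D.φ τ (D.v j) :=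
      Finset.single_le_sum (f := fun j => |(h + s • k) (D.v j)| / D.φ τ (D.v j))
        (fun j _ => div_nonneg (abs_nonneg _) (D.φ_nonneg τ j)) (Finset.mem_univ j)
    have h5 : |(h + s • k) (D.v j)| / D.φ τ (D.v j) < N := by simp only [N]; linarith
    rw [div_lt_iff₀ hj] at h5
    have h6 := neg_abs_le ((h + s • k) (D.v j))
    rw [LinearMap.add_apply, LinearMap.smul_apply, smul_eq_mul]
    linarith
  have hτN : ∀ j, D.φ τ (D.v j) = 0 → (h + s • k + N • D.φ τ) (D.v j) = (h + s • k) (D.v j) := by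
    intro j hj
    simp [hj]
  obtain ⟨ρ, hρ⟩ := D.exists_face (h + s • k + N • D.φ τ) (fun j => by
    rcases (D.φ_nonneg τ j).eq_or_lt with hj | hj
    · rw [hτN j hj.symm]; exact hτ0 j hj.symm
    · exact (hN j hj).le) ⟨i, by rw [hτN i hi.1]; simpa using hsi⟩
  have hρτ : ρ ≤ τ := by
    rw [D.le_iff]
    intro j hj
    by_contra hj'
    exact (hN j (lt_of_le_of_ne (D.φ_nonneg τ j) (Ne.symm hj'))).ne' ((hρ j).mpr hj)
  have hρC : ρ ∈ C := by
    refine hC.mem_of_comparable fun σ hσ => ?_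
    by_cases hστ : σ < τ
    · refine Or.inr ((D.le_iff _ _).mpr fun j hj => (hρ j).mp ?_)
      rw [hτN j ((D.le_iff _ _).mp hστ.le j hj)]
      simp [h1 σ ⟨hσ, hστ⟩ j hj, hmin σ hσ hστ j hj]
    · rcases hC.1.total hσ hτC with hle | hle
      · exact Or.inl (hρτ.trans ((eq_or_lt_of_le hle).resolve_right hστ).ge)
      · exact Or.inl (hρτ.trans hle)
  rcases hρτ.eq_or_lt with rfl | hlt
  · have h4 : (h + s • k) (D.w ρ) = 0 := D.eq_zero_of_face fun j hj => by
      rw [← hτN j hj]; exact (hρ j).mpr hj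
    rw [LinearMap.add_apply, LinearMap.smul_apply, (hk _).mp (hg ρ hρC), smul_zero, add_zero] at h4
    obtain ⟨σ, hσ, hle⟩ := h3 ρ h4
    exact absurd hσ.2 hle.not_gt
  · exact hi.2.ne (hmin ρ hρC hlt i ((hρ i).mp (by rw [hτN i hi.1]; simpa using hsi)))

theorem span_maxChain [Finite F] {C : Set F} (hC : IsMaxChain (· ≤ ·) C) :
    Submodule.span ℝ (D.w '' C) = ⊤ := by
  by_contra hne
  obtain ⟨g, hg, hle⟩ := Submodule.exists_le_ker_of_lt_top _ (lt_top_iff_ne_top.mpr hne)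
  exact hg (D.eq_zero_of_maxChain hC fun σ hσ => hle (Submodule.subset_span ⟨σ, hσ, rfl⟩))

/-- A relation on the chain, extended by zero, is a chain-supported representation of 0. -/
theorem linearIndependent_chain [Finite F] {C : Set F} (hC : IsChain (· ≤ ·) C) :
    LinearIndependent ℝ fun σ : C => D.w σ := by
  classical
  have := Fintype.ofFinite F
  rw [Fintype.linearIndependent_iff]
  intro c hc σ
  let b : F → ℝ := fun σ => if h : σ ∈ C then c ⟨σ, h⟩ else 0
  have hbC : ∀ σ, b σ ≠ 0 → σ ∈ C := by
    intro σ hσ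
    by_contra h
    exact hσ (dif_neg h)
  have hb : b = 0 := by
    refine D.eq_zero_of_chain_sum (hC.mono hbC) ?_
    rw [← hc, ← Finset.sum_subset (Finset.subset_univ (Finset.univ.filter (· ∈ C))),
      Finset.sum_subtype (p := (· ∈ C)) _ (by simp)]
    · exact Finset.sum_congr rfl fun σ _ => by simp [b]
    · intro σ _ hσ
      have : b σ = 0 := dif_neg (by simpa using hσ)
      rw [this, zero_smul]
  have := congrFun hb σ
  simpa [b] using this

end FacedCone

end Cones

end

/-! ### The cone over a lattice polytope and its faces. -/

section

section PolytopeCone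

open Module

variable {n : ℕ} (P : NormalPolytope n)

theorem latticePt_injective : Function.Injective (latticePt (n := n)) := fun a b h => by
  funext i
  have := congrFun h i
  simpa [latticePt] using this

theorem NormalPolytope.isCompact_carrier : IsCompact P.carrier := by
  obtain ⟨s, -, hs⟩ := P.lattice
  rw [hs]
  exact (s.finite_toSet.image _).isCompact_convexHull ℝ

theorem NormalPolytope.convex_carrier : Convex ℝ P.carrier := by
  obtain ⟨s, -, hs⟩ := P.lattice
  rw [hs]
  exact convex_convexHull ℝ _

theorem NormalPolytope.carrier_nonempty : P.carrier.Nonempty := by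
  obtain ⟨s, h, hs⟩ := P.lattice
  rw [hs]
  exact (Set.Nonempty.image _ h).convexHull

instance LatPts.finite : Finite (LatPts P) := by
  obtain ⟨R, hR⟩ := P.isCompact_carrier.isBounded.exists_norm_le
  refine Set.Finite.to_subtype ((Set.finite_Icc (fun _ : Fin n => -⌈R⌉) (fun _ => ⌈R⌉)).subset ?_)
  intro χ hχ
  have h : ∀ i, |(χ i : ℝ)| ≤ R := fun i => by
    have := (norm_le_pi_norm (latticePt χ) i).trans (hR _ hχ)
    simpa [latticePt] using this
  refine ⟨fun i => ?_, fun i => ?_⟩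
  · have h1 := (abs_le.mp (h i)).1
    have h2 := Int.le_ceil R
    have : (-⌈R⌉ : ℝ) ≤ χ i := by linarith
    exact_mod_cast this
  · have h1 := (abs_le.mp (h i)).2
    have h2 := Int.le_ceil R
    have : (χ i : ℝ) ≤ ⌈R⌉ := by linarith
    exact_mod_cast this

theorem LatPts.nonempty (P : NormalPolytope n) : Nonempty (LatPts P) := by
  obtain ⟨s, ⟨χ, hχ⟩, hs⟩ := P.lattice
  exact ⟨χ, hs ▸ subset_convexHull ℝ _ ⟨χ, hχ, rfl⟩⟩

instance LatPts.fintype : Fintype (LatPts P) := Fintype.ofFinite _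

instance : Fintype (Face P) := Fintype.ofFinite _

variable {P}

/-- A lattice point of `P`, at height one. -/
def LatPts.vec (χ : LatPts P) : ℝ × (Fin n → ℝ) := (1, latticePt χ.1)

/-- P is the hull of finitely many of its lattice points, hence of all of them. -/
theorem exists_convex_comb {x : Fin n → ℝ} (hx : x ∈ P.carrier) :
    ∃ c : LatPts P → ℝ, (∀ χ, 0 ≤ c χ) ∧ ((1 : ℝ), x) = ∑ χ, c χ • χ.vec := by
  classical
  obtain ⟨s, -, hs⟩ := P.lattice
  have hsub : latticePt '' (s : Set (Fin n → ℤ)) ⊆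
      ((Finset.univ.image fun χ : LatPts P => latticePt χ.1 : Finset (Fin n → ℝ)) :
        Set (Fin n → ℝ)) := by
    rintro _ ⟨χ, hχ, rfl⟩
    have : latticePt χ ∈ P.carrier := hs ▸ subset_convexHull ℝ _ ⟨χ, hχ, rfl⟩
    simp only [Finset.coe_image, Finset.coe_univ, Set.image_univ, Set.mem_range]
    exact ⟨⟨χ, this⟩, rfl⟩
  have hx' := convexHull_mono hsub (hs ▸ hx)
  rw [Finset.mem_convexHull'] at hx'
  obtain ⟨w, hw, hw1, hwx⟩ := hx'
  have hinj : Set.InjOn (fun χ : LatPts P => latticePt χ.1) (Finset.univ : Finset (LatPts P)) :=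
    fun a _ b _ h => Subtype.ext (latticePt_injective h)
  rw [Finset.sum_image hinj] at hw1 hwx
  refine ⟨fun χ => w (latticePt χ.1), fun χ => hw _ (Finset.mem_image_of_mem _ (Finset.mem_univ χ)), ?_⟩
  refine Prod.ext ?_ ?_
  · rw [Prod.fst_sum, ← hw1]
    simp [LatPts.vec]
  · rw [Prod.snd_sum, ← hwx]
    simp [LatPts.vec]

theorem mem_carrier_of_comb {x : Fin n → ℝ} {c : LatPts P → ℝ} (hc : ∀ χ, 0 ≤ c χ)
    (hx : ((1 : ℝ), x) = ∑ χ, c χ • χ.vec) : x ∈ P.carrier := by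
  have h1 := congrArg Prod.fst hx
  have h2 := congrArg Prod.snd hx
  rw [Prod.fst_sum] at h1
  rw [Prod.snd_sum] at h2
  simp only [LatPts.vec, Prod.smul_fst, Prod.smul_snd, smul_eq_mul, mul_one] at h1 h2
  rw [h2]
  exact P.convex_carrier.sum_mem (fun χ _ => hc χ) h1.symm fun χ _ => χ.2

/-- If σ is the locus where the linear form l is maximal on P, then max l − l, made linear on the
cone, does it. -/
theorem exists_faceFn (σ : Face P) : ∃ g : Dual ℝ (ℝ × (Fin n → ℝ)), ∀ x ∈ P.carrier,
    0 ≤ g (1, x) ∧ (g (1, x) = 0 ↔ x ∈ σ.1) := by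
  obtain ⟨l, hl⟩ := σ.2.1 σ.2.2
  obtain ⟨x₀, hx₀⟩ := σ.2.2
  have hx₀' := hl ▸ hx₀
  refine ⟨(l x₀) • LinearMap.fst ℝ ℝ _ - l.toLinearMap ∘ₗ LinearMap.snd ℝ ℝ _, fun x hx => ?_⟩
  have hle := hx₀'.2 x hx
  simp only [LinearMap.sub_apply, LinearMap.smul_apply, LinearMap.fst_apply, smul_eq_mul, mul_one,
    LinearMap.comp_apply, LinearMap.snd_apply, ContinuousLinearMap.coe_coe]
  refine ⟨sub_nonneg.mpr hle, fun h => ?_, fun h => ?_⟩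
  · rw [hl]
    exact ⟨hx, fun y hy => (hx₀'.2 y hy).trans (sub_eq_zero.mp h).le⟩
  · rw [hl] at h
    exact sub_eq_zero.mpr (le_antisymm (h.2 x₀ hx₀'.1) hle)

/-- A linear functional on the cone over `P` which supports the cone over the face `σ`. -/
def faceFn (σ : Face P) : Dual ℝ (ℝ × (Fin n → ℝ)) := (exists_faceFn σ).choose

theorem faceFn_nonneg (σ : Face P) {x : Fin n → ℝ} (hx : x ∈ P.carrier) : 0 ≤ faceFn σ (1, x) :=
  ((exists_faceFn σ).choose_spec x hx).1

theorem faceFn_eq_zero (σ : Face P) {x : Fin n → ℝ} (hx : x ∈ P.carrier) :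
    faceFn σ (1, x) = 0 ↔ x ∈ σ.1 :=
  ((exists_faceFn σ).choose_spec x hx).2

theorem Face.subset (σ : Face P) : σ.1 ⊆ P.carrier := σ.2.1.subset

/-- In a convex combination of lattice points lying on σ, the supporting functional is a sum of
nonnegative terms equal to 0; so only lattice points of σ occur. -/
theorem exists_convex_comb_face (σ : Face P) {x : Fin n → ℝ} (hx : x ∈ σ.1) :
    ∃ c : LatPts P → ℝ, (∀ χ, 0 ≤ c χ) ∧ (∀ χ, c χ ≠ 0 → faceFn σ χ.vec = 0) ∧
      ((1 : ℝ), x) = ∑ χ, c χ • χ.vec := by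
  obtain ⟨c, hc, h⟩ := exists_convex_comb (σ.subset hx)
  refine ⟨c, hc, fun χ hχ => ?_, h⟩
  have h0 := (faceFn_eq_zero σ (σ.subset hx)).mpr hx
  rw [h, map_sum, Finset.sum_eq_zero_iff_of_nonneg] at h0
  · have := h0 χ (Finset.mem_univ χ)
    rw [map_smul, smul_eq_mul] at this
    exact (mul_eq_zero.mp this).resolve_left hχ
  · intro χ _
    rw [map_smul]
    exact mul_nonneg (hc χ) (faceFn_nonneg σ χ.2)

theorem exists_face_of_nonneg (g : Dual ℝ (ℝ × (Fin n → ℝ))) (hg : ∀ χ : LatPts P, 0 ≤ g χ.vec)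
    (h0 : ∃ χ : LatPts P, g χ.vec = 0) : ∃ σ : Face P, ∀ χ : LatPts P, g χ.vec = 0 ↔
      faceFn σ χ.vec = 0 := by
  obtain ⟨χ₀, hχ₀⟩ := h0
  have hP : ∀ x ∈ P.carrier, 0 ≤ g (1, x) := by
    intro x hx
    obtain ⟨c, hc, h⟩ := exists_convex_comb hx
    rw [h, map_sum]
    exact Finset.sum_nonneg fun χ _ => by rw [map_smul]; exact mul_nonneg (hc χ) (hg χ)
  -- With this sign g (1, ·) is a constant minus l, so its zeros on P, where its minimum 0 is
  -- attained, are the maximum locus of l.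
  let l : StrongDual ℝ (Fin n → ℝ) := LinearMap.toContinuousLinearMap (-(g ∘ₗ LinearMap.inr ℝ ℝ _))
  have hl : ∀ x, g (1, x) = g (1, 0) - l x := by
    intro x
    have : ((1 : ℝ), x) = (1, 0) + (0, x) := by simp
    rw [this, map_add]
    simp [l]
  let σ : Set (Fin n → ℝ) := {x ∈ P.carrier | ∀ y ∈ P.carrier, l y ≤ l x}
  have hσ : ∀ x ∈ P.carrier, g (1, x) = 0 ↔ x ∈ σ := by
    intro x hx
    constructor
    · intro h
      refine ⟨hx, fun y hy => ?_⟩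
      have := hP y hy
      rw [hl] at this h
      linarith
    · intro h
      refine le_antisymm ?_ (hP x hx)
      have h1 := h.2 _ χ₀.2
      have h2 : g (1, latticePt χ₀.1) = 0 := hχ₀
      rw [hl] at h2 ⊢
      linarith
  let τ : Face P := ⟨σ, fun _ => ⟨l, rfl⟩, ⟨_, (hσ _ χ₀.2).mp hχ₀⟩⟩
  exact ⟨τ, fun χ => (hσ _ χ.2).trans (faceFn_eq_zero τ χ.2).symm⟩

/-- An affine function which is nonnegative on a set and vanishes at a point of its relative
interior vanishes on the set. -/
theorem eq_zero_of_intrinsicInterior {s : Set (Fin n → ℝ)} {g : Dual ℝ (ℝ × (Fin n → ℝ))}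
    (hg : ∀ x ∈ s, 0 ≤ g (1, x)) {p : Fin n → ℝ} (hp : p ∈ intrinsicInterior ℝ s)
    (hgp : g (1, p) = 0) {y : Fin n → ℝ} (hy : y ∈ s) : g (1, y) = 0 := by
  obtain ⟨q, hq, rfl⟩ := mem_intrinsicInterior.mp hp
  -- The line from y through the relative interior point p stays in s a little beyond p, at
  -- parameter 1 + ε/2. There g has the value −(ε/2) g (1, y), which must be nonnegative.
  let γ : ℝ → affineSpan ℝ s := fun r =>
    ⟨AffineMap.lineMap y (q : Fin n → ℝ) r, AffineMap.lineMap_mem r (subset_affineSpan ℝ s hy) q.2⟩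
  have hγ : Continuous γ := Continuous.subtype_mk AffineMap.lineMap_continuous _
  have h1 : γ 1 = q := Subtype.ext (by simp [γ])
  have hmem : γ ⁻¹' interior ((↑) ⁻¹' s : Set (affineSpan ℝ s)) ∈ nhds (1 : ℝ) :=
    hγ.continuousAt.preimage_mem_nhds (by rw [h1]; exact isOpen_interior.mem_nhds hq)
  obtain ⟨ε, hε, hball⟩ := Metric.mem_nhds_iff.mp hmem
  have h2 : γ (1 + ε / 2) ∈ interior ((↑) ⁻¹' s : Set (affineSpan ℝ s)) := by
    refine hball ?_
    rw [Metric.mem_ball, dist_self_add_left, Real.norm_of_nonneg (by positivity)]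
    linarith
  have h3 := hg (γ (1 + ε / 2) : affineSpan ℝ s) (interior_subset h2 : _ ∈ (_ ⁻¹' _))
  have h4 : ((1 : ℝ), ((γ (1 + ε / 2) : affineSpan ℝ s) : Fin n → ℝ)) =
      (1 + ε / 2) • ((1 : ℝ), (q : Fin n → ℝ)) - (ε / 2) • (1, y) := by
    refine Prod.ext ?_ ?_
    · simp
    · simp only [γ, AffineMap.lineMap_apply_module, Prod.snd_sub, Prod.smul_snd]
      module
  rw [h4, map_sub, map_smul, map_smul, hgp, smul_zero, zero_sub, smul_eq_mul] at h3
  have h5 := hg y hy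
  have : 0 < ε / 2 := by positivity
  nlinarith

/-- The point of the face `σ` defined by the weight of the function `f σ`. -/
def Stratification.pt {K : Type u} [Field K] (S : Stratification K P) (σ : Face P) : Fin n → ℝ :=
  fun i => (S.wt σ i : ℝ) / (S.deg σ : ℝ)

theorem Stratification.deg_pos {K : Type u} [Field K] (S : Stratification K P) (σ : Face P) :
    (0 : ℝ) < S.deg σ := by
  have := S.one_le_deg σ
  exact_mod_cast this

theorem Stratification.deg_smul_pt {K : Type u} [Field K] (S : Stratification K P) (σ : Face P) :
    ((S.deg σ : ℝ), latticePt (S.wt σ)) = (S.deg σ : ℝ) • ((1 : ℝ), S.pt σ) := by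
  refine Prod.ext (by simp) (funext fun i => ?_)
  have := (S.deg_pos σ).ne'
  simp only [latticePt, Prod.smul_snd, Pi.smul_apply, Stratification.pt, smul_eq_mul]
  field_simp

/-- The cone over `P`, with the weights of the functions of a stratification. -/
def facedCone {K : Type u} [Field K] (S : Stratification K P) :
    FacedCone (LatPts P) (Face P) (ℝ × (Fin n → ℝ)) where
  v := LatPts.vec
  φ := faceFn
  w σ := ((S.deg σ : ℝ), latticePt (S.wt σ))
  dg := LinearMap.fst ℝ ℝ _
  φ_nonneg σ χ := faceFn_nonneg σ χ.2
  exists_face := exists_face_of_nonneg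
  le_iff σ τ := by
    constructor
    · intro h χ hχ
      exact (faceFn_eq_zero τ χ.2).mpr (h ((faceFn_eq_zero σ χ.2).mp hχ))
    · intro h x hx
      refine (faceFn_eq_zero τ (σ.subset hx)).mp ?_
      obtain ⟨c, hc, hc', hx'⟩ := exists_convex_comb_face σ hx
      rw [hx', map_sum]
      refine Finset.sum_eq_zero fun χ _ => ?_
      rw [map_smul]
      by_cases h0 : c χ = 0
      · simp [h0]
      · rw [h χ (hc' χ h0), smul_zero]
  w_mem σ := by
    obtain ⟨c, hc, hc', h⟩ := exists_convex_comb_face σ (intrinsicInterior_subset (S.mem_relint σ))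
    refine ⟨fun χ => S.deg σ * c χ, fun χ => mul_nonneg (S.deg_pos σ).le (hc χ),
      fun χ hχ => hc' χ (right_ne_zero_of_mul hχ), ?_⟩
    rw [S.deg_smul_pt]
    simp only [mul_smul, ← Finset.smul_sum]
    rw [← h]
    rfl
  interior σ τ h := by
    rw [S.deg_smul_pt, map_smul, smul_eq_mul] at h
    have h0 := (mul_eq_zero.mp h).resolve_left (S.deg_pos σ).ne'
    exact fun x hx => (faceFn_eq_zero τ (σ.subset hx)).mp
      (eq_zero_of_intrinsicInterior (fun y hy => faceFn_nonneg τ (σ.subset hy)) (S.mem_relint σ) h0 hx)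
  spans g hg := by
    have h1 : ∀ x ∈ P.carrier, g (1, x) = 0 := by
      intro x hx
      obtain ⟨c, -, h⟩ := exists_convex_comb hx
      rw [h, map_sum]
      exact Finset.sum_eq_zero fun χ _ => by rw [map_smul, hg, smul_zero]
    -- Full dimensionality enters here: an affine function vanishing on P vanishes on its affine
    -- span.
    have h2 : ∀ x, g (1, x) = 0 := by
      intro x
      let f : (Fin n → ℝ) →ᵃ[ℝ] ℝ :=
        g.toAffineMap.comp ((AffineMap.const ℝ (Fin n → ℝ) (1 : ℝ)).prod (AffineMap.id ℝ _))
      have hf : ∀ y, f y = g (1, y) := fun y => rfl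
      have hx : x ∈ affineSpan ℝ P.carrier := by rw [P.fullDim]; trivial
      have h3 : f x ∈ (affineSpan ℝ P.carrier).map f := AffineSubspace.mem_map_of_mem f hx
      rw [AffineSubspace.map_span] at h3
      have h4 : f '' P.carrier ⊆ {0} := by
        rintro _ ⟨y, hy, rfl⟩
        exact h1 y hy
      have h5 := affineSpan_mono ℝ h4 h3
      rw [AffineSubspace.mem_affineSpan_singleton] at h5
      exact h5
    ext x
    · simpa using h2 0
    · have h3 := h2 (Pi.single x 1)
      have h4 : ((1 : ℝ), (Pi.single x 1 : Fin n → ℝ)) = (1, 0) + (0, Pi.single x 1) := by simp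
      rw [h4, map_add, h2, zero_add] at h3
      simpa using h3
  dg_pos χ := by simp [LatPts.vec]
  dg_w_pos σ := S.deg_pos σ

end PolytopeCone

end

/-! ### The weight monoid, coordinates along maximal chains, and the values of ν. -/

section

open Module

section WeightMonoid

variable {n : ℕ} (P : NormalPolytope n)

/-- The monoid generated by the weights `(1, χ)`, `χ` a lattice point of `P`. -/
def weightMonoid : AddSubmonoid (Wt n) :=
  AddMonoidHom.mrange (Finsupp.weight (LatPts.wt (P := P)) : (LatPts P →₀ ℕ) →+ Wt n)

variable {P}

theorem mem_weightMonoid {l : Wt n} : l ∈ weightMonoid P ↔ ∃ a : LatPts P →₀ ℕ, monWt a = l := by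
  simp only [weightMonoid, AddMonoidHom.mem_mrange, weight_wt]

theorem wt_mem_weightMonoid (χ : LatPts P) : χ.wt ∈ weightMonoid P :=
  mem_weightMonoid.mpr ⟨Finsupp.single χ 1, by simp [monWt]⟩

theorem weightMonoid_fst_nonneg {l : Wt n} (h : l ∈ weightMonoid P) : 0 ≤ l.1 := by
  obtain ⟨a, rfl⟩ := mem_weightMonoid.mp h
  rw [monWt_fst]
  positivity

theorem eq_zero_of_weightMonoid {l : Wt n} (h : l ∈ weightMonoid P) (h0 : l.1 = 0) : l = 0 := by
  obtain ⟨a, rfl⟩ := mem_weightMonoid.mp h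
  rw [monWt_fst] at h0
  have : a = 0 := (Finsupp.degree_eq_zero_iff a).mp (by exact_mod_cast h0)
  rw [this]
  rfl

/-- The inclusion of `ℤ ⊕ M` in `ℝ ⊕ M_ℝ`. -/
def realWt : Wt n →+ ℝ × (Fin n → ℝ) where
  toFun l := ((l.1 : ℝ), latticePt l.2)
  map_zero' := by ext <;> simp [latticePt]
  map_add' a b := by ext <;> simp [latticePt]

theorem realWt_wt (χ : LatPts P) : realWt χ.wt = χ.vec := by
  simp [realWt, LatPts.vec]

theorem realWt_monWt (a : LatPts P →₀ ℕ) : realWt (monWt a) = ∑ χ, (a χ : ℝ) • χ.vec := by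
  rw [monWt, Finsupp.sum_fintype _ _ (by simp), map_sum]
  refine Finset.sum_congr rfl fun χ _ => ?_
  rw [map_nsmul, realWt_wt, Nat.cast_smul_eq_nsmul]

/-- Normality splits off one lattice point of P at a time. -/
theorem mem_weightMonoid_of_smul (m : ℕ) : ∀ η : Fin n → ℤ, latticePt η ∈ (m : ℝ) • P.carrier →
    ((m : ℤ), η) ∈ weightMonoid P := by
  induction m with
  | zero =>
    intro η hη
    rw [Nat.cast_zero, Set.zero_smul_set P.carrier_nonempty] at hη
    have : η = 0 := latticePt_injective (hη.trans (by ext; simp [latticePt]))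
    rw [this]
    exact zero_mem _
  | succ m ih =>
    intro η hη
    obtain ⟨χ₁, χ₂, h₁, h₂, rfl⟩ := P.normal m 1 η hη
    rw [Nat.cast_one, one_smul] at h₂
    have := add_mem (ih χ₁ h₁) (wt_mem_weightMonoid ⟨χ₂, h₂⟩)
    simpa [LatPts.wt] using this

/-- The lattice points of the cone over a normal polytope form the monoid generated by those
at height one. -/
theorem mem_weightMonoid_iff {l : Wt n} : l ∈ weightMonoid P ↔
    ∃ c : LatPts P → ℝ, (∀ χ, 0 ≤ c χ) ∧ realWt l = ∑ χ, c χ • χ.vec := by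
  constructor
  · intro h
    obtain ⟨a, rfl⟩ := mem_weightMonoid.mp h
    exact ⟨fun χ => a χ, fun χ => Nat.cast_nonneg _, realWt_monWt a⟩
  · rintro ⟨c, hc, h⟩
    have h1 : (l.1 : ℝ) = ∑ χ, c χ := by
      have := congrArg Prod.fst h
      rw [Prod.fst_sum] at this
      simpa [LatPts.vec, realWt] using this
    have h0 : 0 ≤ l.1 := by
      have : (0 : ℝ) ≤ l.1 := h1 ▸ Finset.sum_nonneg fun χ _ => hc χ
      exact_mod_cast this
    rcases h0.eq_or_lt with h0 | h0
    · rw [← h0, Int.cast_zero] at h1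
      have h2 : ∀ χ, c χ = 0 := fun χ =>
        (Finset.sum_eq_zero_iff_of_nonneg fun χ _ => hc χ).mp h1.symm χ (Finset.mem_univ χ)
      have h3 : realWt l = realWt 0 := by rw [h, map_zero]; simp [h2]
      have h4 : l = 0 := by
        refine Prod.ext h0.symm (latticePt_injective ?_)
        exact congrArg Prod.snd h3
      rw [h4]
      exact zero_mem _
    · have h2 : (0 : ℝ) < l.1 := by exact_mod_cast h0
      have h3 : ((l.1.toNat : ℕ) : ℤ) = l.1 := Int.toNat_of_nonneg h0.le
      have h4 : ((l.1.toNat : ℕ) : ℝ) = l.1 := by exact_mod_cast congrArg (Int.cast (R := ℝ)) h3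
      have h5 := mem_weightMonoid_of_smul (P := P) l.1.toNat l.2 (by
        rw [h4]
        refine ⟨(l.1 : ℝ)⁻¹ • latticePt l.2, ?_, smul_inv_smul₀ h2.ne' _⟩
        refine mem_carrier_of_comb (c := fun χ => (l.1 : ℝ)⁻¹ * c χ)
          (fun χ => mul_nonneg (inv_nonneg.mpr h2.le) (hc χ)) ?_
        simp only [mul_smul, ← Finset.smul_sum]
        rw [← h]
        refine Prod.ext ?_ ?_
        · simp [realWt, h2.ne']
        · simp [realWt])
      rw [h3] at h5
      exact h5

end WeightMonoid

section Coordinates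

variable {K : Type u} [Field K] {n : ℕ} {P : NormalPolytope n}
variable (S : Stratification K P) (t : Linearization P)

/-- The weight `(deg σ, wt σ)`. -/
def Stratification.wvec (σ : Face P) : Wt n := ((S.deg σ : ℤ), S.wt σ)

/-- The inclusion of `ℚ ⊕ M_ℚ` in `ℝ ⊕ M_ℝ`. -/
def ratReal : (ℚ × (Fin n → ℚ)) →ₗ[ℚ] (ℝ × (Fin n → ℝ)) where
  toFun x := ((x.1 : ℝ), fun i => (x.2 i : ℝ))
  map_add' x y := by ext <;> simp
  map_smul' c x := by ext <;> simp [Rat.smul_def]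

theorem ratReal_ratWt (l : Wt n) : ratReal (ratWt l) = realWt l := by
  ext <;> simp [ratReal, ratWt, realWt, latticePt]

theorem facedCone_w (σ : Face P) : (facedCone S).w σ = ratReal (ratWt (S.wvec σ)) := by
  rw [ratReal_ratWt]
  simp [facedCone, Stratification.wvec, realWt]

/-- Independence over ℝ after the ℚ-linear inclusion implies independence over ℚ. -/
theorem linearIndependent_wvec {C : Set (Face P)} (hC : IsChain (· ≤ ·) C) :
    LinearIndependent ℚ fun σ : C => ratWt (S.wvec σ) := by
  have h := (facedCone S).linearIndependent_chain hC
  simp only [facedCone_w] at h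
  exact LinearIndependent.of_comp ratReal (h.restrict_scalars' ℚ)

/-- Over ℝ the vectors along a maximal chain form a basis, and the real and rational dimensions are
both n + 1. -/
theorem card_maxChain (S : Stratification K P) {C : Set (Face P)} (hC : IsMaxChain (· ≤ ·) C) :
    Nat.card C = finrank ℚ (ℚ × (Fin n → ℚ)) := by
  have h := (facedCone S).linearIndependent_chain hC.1
  have hs := (facedCone S).span_maxChain hC
  have := Fintype.ofFinite C
  have b := Basis.mk h (by rw [← hs, Set.image_eq_range])
  have h2 := finrank_eq_nat_card_basis b
  rw [← h2]
  simp

/-- The basis of `ℚ ⊕ M_ℚ` attached to a maximal chain of faces. -/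
def chainBasis {C : Set (Face P)} (hC : IsMaxChain (· ≤ ·) C) : Basis C ℚ (ℚ × (Fin n → ℚ)) :=
  have := Fintype.ofFinite C
  have : Nonempty C := by
    have h := card_maxChain S hC
    rw [finrank_prod, finrank_self] at h
    exact (Nat.card_pos_iff.mp (by omega)).1
  basisOfLinearIndependentOfCardEqFinrank (linearIndependent_wvec S hC.1)
    (by rw [← card_maxChain S hC, Nat.card_eq_fintype_card])

theorem chainBasis_apply {C : Set (Face P)} (hC : IsMaxChain (· ≤ ·) C) (σ : C) :
    chainBasis S hC σ = ratWt (S.wvec σ) := by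
  simp [chainBasis]

/-- The basis attached to the chain supplies the linear map that `chainCoord` asks for, so its
default value 0 is not used. -/
theorem chainCoord_wvec {C : Set (Face P)} (hC : IsMaxChain (· ≤ ·) C) {σ : Face P} (hσ : σ ∈ C) :
    chainCoord S C (ratWt (S.wvec σ)) = (open scoped Classical in Pi.single σ 1) := by
  classical
  have h : ∃ L : (ℚ × (Fin n → ℚ)) →ₗ[ℚ] (Face P → ℚ),
      ∀ σ ∈ C, L (ratWt ((S.deg σ : ℤ), S.wt σ)) = Pi.single σ 1 := by
    refine ⟨(chainBasis S hC).constr ℚ fun σ => Pi.single σ.1 1, fun σ hσ => ?_⟩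
    have := (chainBasis S hC).constr_basis ℚ (fun σ => (Pi.single σ.1 1 : Face P → ℚ)) ⟨σ, hσ⟩
    rw [chainBasis_apply] at this
    exact this
  have h2 : chainCoord S C = h.choose := by
    rw [chainCoord]
    exact dif_pos h
  rw [h2]
  exact h.choose_spec σ hσ

theorem sum_chainCoord {C : Set (Face P)} (hC : IsMaxChain (· ≤ ·) C) (x : ℚ × (Fin n → ℚ)) :
    ∑ σ, chainCoord S C x σ • ratWt (S.wvec σ) = x := by
  classical
  let L : (ℚ × (Fin n → ℚ)) →ₗ[ℚ] (ℚ × (Fin n → ℚ)) :=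
    ∑ σ, (LinearMap.proj σ ∘ₗ chainCoord S C).smulRight (ratWt (S.wvec σ))
  have h : L = LinearMap.id := by
    refine (chainBasis S hC).ext fun σ => ?_
    rw [chainBasis_apply]
    simp only [L, LinearMap.sum_apply, LinearMap.smulRight_apply, LinearMap.comp_apply,
      chainCoord_wvec S hC σ.2, LinearMap.proj_apply, LinearMap.id_apply]
    rw [Finset.sum_eq_single σ.1] <;> simp +contextual
  have := LinearMap.congr_fun h x
  simpa [L] using this

theorem chainCoord_eq_zero {C : Set (Face P)} (hC : IsMaxChain (· ≤ ·) C) (x : ℚ × (Fin n → ℚ))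
    {σ : Face P} (hσ : σ ∉ C) : chainCoord S C x σ = 0 := by
  classical
  have h : LinearMap.proj σ ∘ₗ chainCoord S C = 0 := by
    refine (chainBasis S hC).ext fun τ => ?_
    rw [chainBasis_apply, LinearMap.comp_apply, chainCoord_wvec S hC τ.2]
    have : σ ≠ τ.1 := fun h => hσ (h ▸ τ.2)
    simp [this]
  exact LinearMap.congr_fun h x

theorem realWt_eq_sum {C : Set (Face P)} (hC : IsMaxChain (· ≤ ·) C) (l : Wt n) :
    ∑ σ, ((chainCoord S C (ratWt l) σ : ℚ) : ℝ) • (facedCone S).w σ = realWt l := by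
  conv_rhs => rw [← ratReal_ratWt, ← sum_chainCoord S hC (ratWt l), map_sum]
  refine Finset.sum_congr rfl fun σ _ => ?_
  rw [map_smul, facedCone_w]
  ext <;> simp [Rat.smul_def]

theorem isChain_chainCoord {C : Set (Face P)} (hC : IsMaxChain (· ≤ ·) C) (l : Wt n) :
    IsChain (· ≤ ·) {σ | ((chainCoord S C (ratWt l) σ : ℚ) : ℝ) ≠ 0} := by
  refine hC.1.mono fun σ hσ => ?_
  by_contra h
  exact hσ (by rw [chainCoord_eq_zero S hC _ h]; simp)

/-- The value of the quasi-valuation at an eigenfunction of weight `-l`. -/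
def val (l : Wt n) : ValGroup t :=
  Finset.univ.inf' Finset.univ_nonempty fun C : MaxChain P => nuWt S t C.1 l

theorem val_le (C : MaxChain P) (l : Wt n) : val S t l ≤ nuWt S t C.1 l :=
  Finset.inf'_le _ (Finset.mem_univ C)

theorem exists_val_eq (l : Wt n) : ∃ C : MaxChain P, val S t l = nuWt S t C.1 l := by
  obtain ⟨C, -, h⟩ := Finset.exists_mem_eq_inf' (Finset.univ_nonempty (α := MaxChain P))
    fun C => nuWt S t C.1 l
  exact ⟨C, h⟩

theorem val_zero : val S t 0 = 0 := by
  obtain ⟨C, h⟩ := exists_val_eq S t 0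
  rw [h, map_zero]

/-- Each chain value is additive in the weight, so their minimum is superadditive. -/
theorem add_val_le (l l' : Wt n) : val S t l + val S t l' ≤ val S t (l + l') := by
  obtain ⟨C, h⟩ := exists_val_eq S t (l + l')
  rw [h, map_add]
  exact add_le_add (val_le S t C l) (val_le S t C l')

/-- By `lex_le` the nonnegative coordinates along C are lexicographically at most those along any
other maximal chain. Hence `val` is additive on weights whose coordinates along one common chain are
nonnegative. -/
theorem val_eq_of_nonneg (C : MaxChain P) {l : Wt n}
    (h : ∀ σ, 0 ≤ chainCoord S C.1 (ratWt l) σ) : val S t l = nuWt S t C.1 l := by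
  refine le_antisymm (val_le S t C l) (Finset.le_inf' _ _ fun C' _ => ?_)
  rcases (facedCone S).lex_le t.order t.extends_le (fun σ => Rat.cast_nonneg.mpr (h σ))
    (isChain_chainCoord S C'.2 l) (by rw [realWt_eq_sum S C.2, realWt_eq_sum S C'.2]) with
    h1 | ⟨τ, h1, h2⟩
  · exact le_of_eq (congrArg toLex (funext fun σ => Rat.cast_injective (congrFun h1 σ)))
  · exact le_of_lt ⟨τ, fun σ hσ => Rat.cast_injective (h1 σ hσ), Rat.cast_lt.mp h2⟩

/-- Every weight in the cone over `P` is in the cone generated by the weights attached to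
some maximal chain. -/
theorem exists_chainCoord_nonneg {l : Wt n} (hl : l ∈ weightMonoid P) : ∃ C : MaxChain P,
    ∀ σ, 0 ≤ chainCoord S C.1 (ratWt l) σ := by
  obtain ⟨c, hc, h⟩ := mem_weightMonoid_iff.mp hl
  obtain ⟨χ₀⟩ := LatPts.nonempty P
  -- The face of the zero functional is P itself, so `exists_chain_repr` applies to every point of
  -- the cone.
  obtain ⟨σ, hσ⟩ := (facedCone S).exists_face 0 (by simp) ⟨χ₀, rfl⟩
  have hσ0 : (facedCone S).φ σ = 0 := (facedCone S).spans _ fun i => (hσ i).mp rfl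
  obtain ⟨a, ha, -, hchain, hsum⟩ := (facedCone S).exists_chain_repr σ c hc (by rw [hσ0]; rfl)
  obtain ⟨C, hC, hsub⟩ := IsChain.exists_maxChain hchain
  have hrep : ∑ σ, a σ • (facedCone S).w σ = realWt l := by rw [h]; exact hsum.symm
  -- Representations along a chain are unique, so the real coefficients found by peeling are the
  -- rational chain coordinates.
  have heq : ∀ σ, ((chainCoord S C (ratWt l) σ : ℚ) : ℝ) = a σ := by
    have h0 : (fun σ => ((chainCoord S C (ratWt l) σ : ℚ) : ℝ) - a σ) = 0 := by
      refine (facedCone S).eq_zero_of_chain_sum (hC.1.mono fun σ hσ => ?_) ?_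
      · by_contra hσC
        refine hσ ?_
        have : a σ = 0 := by
          by_contra h0
          exact hσC (hsub h0)
        simp [this, chainCoord_eq_zero S hC _ hσC]
      · simp only [sub_smul, Finset.sum_sub_distrib]
        rw [hrep, realWt_eq_sum S hC, sub_self]
    intro σ
    exact sub_eq_zero.mp (congrFun h0 σ)
  have hnn : ∀ σ, 0 ≤ chainCoord S C (ratWt l) σ := fun σ => by
    have := ha σ
    rw [← heq] at this
    exact_mod_cast this
  exact ⟨⟨C, hC⟩, hnn⟩

theorem wvec_mem_weightMonoid (σ : Face P) : S.wvec σ ∈ weightMonoid P := by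
  obtain ⟨c, hc, -, h⟩ := (facedCone S).w_mem σ
  exact mem_weightMonoid_iff.mpr ⟨c, hc, by rw [← ratReal_ratWt, ← facedCone_w, h]; rfl⟩

theorem mem_weightMonoid_of_chainCoord_nonneg (C : MaxChain P) {l : Wt n}
    (h : ∀ σ, 0 ≤ chainCoord S C.1 (ratWt l) σ) : l ∈ weightMonoid P := by
  choose c hc _ hw using (facedCone S).w_mem
  refine mem_weightMonoid_iff.mpr ⟨fun χ => ∑ σ, ((chainCoord S C.1 (ratWt l) σ : ℚ) : ℝ) * c σ χ,
    fun χ => Finset.sum_nonneg fun σ _ => mul_nonneg (Rat.cast_nonneg.mpr (h σ)) (hc σ χ), ?_⟩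
  rw [← realWt_eq_sum S C.2]
  simp only [hw, Finset.sum_smul, mul_smul, Finset.smul_sum]
  rw [Finset.sum_comm]
  rfl

/-- A weight of large degree is the sum of another weight and of the weight of one of the
functions of the stratification, and the quasi-valuation is additive on this sum. -/
theorem exists_sub_wvec {l : Wt n} (hl : l ∈ weightMonoid P) (hdeg : ∑ σ, (S.deg σ : ℤ) < l.1) :
    ∃ σ, l - S.wvec σ ∈ weightMonoid P ∧
      val S t (l - S.wvec σ) + val S t (S.wvec σ) = val S t l := by
  classical
  obtain ⟨C, hC⟩ := exists_chainCoord_nonneg S hl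
  have h1 : ∑ σ, chainCoord S C.1 (ratWt l) σ * S.deg σ = l.1 := by
    have := congrArg Prod.fst (sum_chainCoord S C.2 (ratWt l))
    rw [Prod.fst_sum] at this
    simpa [ratWt, Stratification.wvec] using this
  -- The degree of l is the sum of its coordinates times the degrees of the f σ; if all coordinates
  -- were below 1 it could not exceed the sum of these degrees. Subtracting the weight of such a σ
  -- keeps the coordinates along C nonnegative.
  obtain ⟨σ, hσ⟩ : ∃ σ, 1 ≤ chainCoord S C.1 (ratWt l) σ := by
    by_contra! hcon
    have h2 : ∑ σ, chainCoord S C.1 (ratWt l) σ * S.deg σ ≤ ∑ σ, (S.deg σ : ℚ) :=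
      Finset.sum_le_sum fun σ _ => mul_le_of_le_one_left (Nat.cast_nonneg _) (hcon σ).le
    rw [h1] at h2
    have h3 : (l.1 : ℚ) ≤ ((∑ σ, (S.deg σ : ℤ) : ℤ) : ℚ) := by simpa using h2
    exact absurd (Int.cast_le.mp h3) hdeg.not_ge
  have hσC : σ ∈ C.1 := by
    by_contra h
    rw [chainCoord_eq_zero S C.2 _ h] at hσ
    linarith
  have hw : ∀ τ, 0 ≤ chainCoord S C.1 (ratWt (S.wvec σ)) τ := by
    intro τ
    rw [chainCoord_wvec S C.2 hσC, Pi.single_apply]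
    split_ifs <;> simp
  have hd : ∀ τ, 0 ≤ chainCoord S C.1 (ratWt (l - S.wvec σ)) τ := by
    intro τ
    rw [map_sub, map_sub, Pi.sub_apply, chainCoord_wvec S C.2 hσC, Pi.single_apply]
    split_ifs with h
    · subst h; linarith
    · simpa using hC τ
  refine ⟨σ, mem_weightMonoid_of_chainCoord_nonneg S C hd, ?_⟩
  rw [val_eq_of_nonneg S t C hC, val_eq_of_nonneg S t C hw, val_eq_of_nonneg S t C hd, ← map_add,
    sub_add_cancel]

end Coordinates

end

/-! ### The basis of eigenfunctions and the structure of gr_ν. -/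

section

section CoordinateRing

variable {K : Type u} [Field K] [CharZero K] {n : ℕ} {P : NormalPolytope n}

/-- The restriction of functions on the affine cone to its torus. -/
def toTorus : CoordRing K P →ₐ[K] AddMonoidAlgebra K (Wt n) :=
  Ideal.Quotient.liftₐ (coneIdeal K P) (toLaurent K P) fun p hp => by
    rwa [coneIdeal_eq_ker] at hp

theorem toTorus_mk (p : MvPolynomial (LatPts P) K) :
    toTorus (Ideal.Quotient.mk (coneIdeal K P) p) = toLaurent K P p := rfl

theorem toTorus_injective : Function.Injective (toTorus (K := K) (P := P)) := by
  rw [injective_iff_map_eq_zero]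
  intro x hx
  obtain ⟨p, rfl⟩ := Ideal.Quotient.mk_surjective x
  rw [toTorus_mk] at hx
  rw [Ideal.Quotient.eq_zero_iff_mem, coneIdeal_eq_ker]
  exact hx

instance : IsDomain (CoordRing K P) :=
  toTorus_injective.isDomain (toTorus (K := K) (P := P)).toRingHom

theorem toTorus_basisFun {l : Wt n} (hl : l ∈ weightMonoid P) :
    toTorus (basisFun K P l) = AddMonoidAlgebra.single l 1 := by
  have h := mem_weightMonoid.mp hl
  rw [basisFun, dif_pos h, toTorus_mk, toLaurent_monomial, h.choose_spec]

/-- Restriction to the torus is injective and sees only the weight of a monomial, so the choice made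
in `basisFun` does not matter. -/
theorem mk_monomial (a : LatPts P →₀ ℕ) (c : K) :
    Ideal.Quotient.mk (coneIdeal K P) (MvPolynomial.monomial a c) = c • basisFun K P (monWt a) := by
  apply toTorus_injective
  rw [map_smul, toTorus_basisFun (mem_weightMonoid.mpr ⟨a, rfl⟩), toTorus_mk, toLaurent_monomial]
  simp

theorem basisFun_ne_zero {l : Wt n} (hl : l ∈ weightMonoid P) : basisFun K P l ≠ 0 := by
  intro h
  have h2 := toTorus_basisFun (K := K) hl
  rw [h, map_zero] at h2
  simpa using congrArg (fun x => x.coeff l) h2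

theorem basisFun_add {l l' : Wt n} (hl : l ∈ weightMonoid P) (hl' : l' ∈ weightMonoid P) :
    basisFun K P (l + l') = basisFun K P l * basisFun K P l' := by
  apply toTorus_injective
  rw [map_mul, toTorus_basisFun hl, toTorus_basisFun hl', toTorus_basisFun (add_mem hl hl')]
  simp [AddMonoidAlgebra.single_mul_single]

theorem basisFun_zero : basisFun K P 0 = 1 := by
  apply toTorus_injective
  rw [map_one, toTorus_basisFun (zero_mem _)]
  rfl

/-- The coefficients of a function with respect to the basis of eigenfunctions. -/
def coeffAt (l : Wt n) : CoordRing K P →ₗ[K] K where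
  toFun g := (toTorus g).coeff l
  map_add' g h := by simp
  map_smul' c g := by simp

theorem coeffAt_basisFun {l l' : Wt n} (hl : l ∈ weightMonoid P) :
    coeffAt l' (basisFun K P l) = if l = l' then 1 else 0 := by
  change (toTorus (basisFun K P l)).coeff l' = _
  rw [toTorus_basisFun hl]
  simp [Finsupp.single_apply]

theorem coordRing_induction {p : CoordRing K P → Prop}
    (h1 : ∀ l ∈ weightMonoid P, ∀ c : K, p (c • basisFun K P l))
    (h2 : ∀ g h, p g → p h → p (g + h)) (g : CoordRing K P) : p g := by
  obtain ⟨q, rfl⟩ := Ideal.Quotient.mk_surjective g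
  induction q using MvPolynomial.induction_on' with
  | monomial a c =>
    rw [mk_monomial]
    exact h1 _ (mem_weightMonoid.mpr ⟨a, rfl⟩) c
  | add q r hq hr =>
    rw [map_add]
    exact h2 _ _ hq hr

theorem basisFun_mem_eigenSpace {l : Wt n} (hl : l ∈ weightMonoid P) :
    basisFun K P l ∈ eigenSpace K P l := by
  obtain ⟨a, rfl⟩ := mem_weightMonoid.mp hl
  rw [← quotPiece_eq_eigenSpace]
  refine ⟨MvPolynomial.monomial a 1, MvPolynomial.isWeightedHomogeneous_monomial _ _ _ (weight_wt a), ?_⟩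
  have := mk_monomial a (1 : K)
  rw [one_smul] at this
  exact this

open scoped Classical in
theorem decompose_eigenSpace (g : CoordRing K P) (l : Wt n) :
    (DirectSum.decompose (eigenSpace K P) g l : CoordRing K P) = coeffAt l g • basisFun K P l := by
  induction g using coordRing_induction with
  | h1 l' hl' c =>
    have hm := Submodule.smul_mem _ c (basisFun_mem_eigenSpace (K := K) hl')
    rw [LinearMap.map_smul (coeffAt l), coeffAt_basisFun hl']
    split_ifs with h
    · subst h
      rw [DirectSum.decompose_of_mem_same _ hm, smul_eq_mul, mul_one]
    · rw [DirectSum.decompose_of_mem_ne _ hm h, smul_zero, zero_smul]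
  | h2 g h hg hh =>
    rw [DirectSum.decompose_add, DirectSum.add_apply, Submodule.coe_add, hg, hh, map_add, add_smul]

theorem coeffAt_eq_zero (g : CoordRing K P) {l : Wt n} (hl : l ∉ weightMonoid P) :
    coeffAt l g = 0 := by
  induction g using coordRing_induction with
  | h1 l' hl' c =>
    rw [map_smul, coeffAt_basisFun hl', if_neg (by rintro rfl; exact hl hl'), smul_zero]
  | h2 g h hg hh => rw [map_add, hg, hh, add_zero]

theorem mem_wtSupport_iff {g : CoordRing K P} {l : Wt n} :
    l ∈ wtSupport K P g ↔ coeffAt l g ≠ 0 := by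
  rw [mem_wtSupport, decompose_eigenSpace]
  by_cases hl : l ∈ weightMonoid P
  · simp [basisFun_ne_zero hl]
  · simp [coeffAt_eq_zero g hl]

end CoordinateRing

section Values

variable {K : Type u} [Field K] {n : ℕ} {P : NormalPolytope n}
variable {S : Stratification K P} {t : Linearization P}

theorem le_val_iff {a : ValGroup t} {l : Wt n} :
    a ≤ val S t l ↔ ∀ C : MaxChain P, a ≤ nuWt S t C.1 l := by
  simp [val]

theorem lt_val_iff {a : ValGroup t} {l : Wt n} :
    a < val S t l ↔ ∀ C : MaxChain P, a < nuWt S t C.1 l := by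
  simp [val]

end Values

section AssociatedGraded

variable {K : Type u} [Field K] [CharZero K] {n : ℕ} {P : NormalPolytope n}
variable (S : Stratification K P) (t : Linearization P)

-- The filtration is spanned by the basis elements it contains: the minima over chains and over
-- weights may be interchanged.
variable {S t} in
theorem mem_filtGE_iff {a : ValGroup t} {g : CoordRing K P} :
    g ∈ filtGE S t a ↔ ∀ l, coeffAt l g ≠ 0 → a ≤ val S t l := by
  rw [mem_filtGE]
  simp only [mem_wtSupport_iff, le_val_iff]
  exact ⟨fun h l hl C => h C l hl, fun h C l hl => h l hl C⟩

variable {S t} in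
theorem mem_filtGT_iff {a : ValGroup t} {g : CoordRing K P} :
    g ∈ filtGT S t a ↔ ∀ l, coeffAt l g ≠ 0 → a < val S t l := by
  rw [mem_filtGT]
  simp only [mem_wtSupport_iff, lt_val_iff]
  exact ⟨fun h l hl C => h C l hl, fun h C l hl => h l hl C⟩

theorem nu_basisFun {l : Wt n} (hl : l ∈ weightMonoid P) :
    nu S t (basisFun K P l) = val S t l := by
  have h0 := basisFun_ne_zero (K := K) hl
  refine eq_of_forall_le_iff fun a => ?_
  have h1 := le_nu_iff (S := S) (t := t) (g := basisFun K P l) (a := a)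
  rw [or_iff_right h0] at h1
  rw [h1, le_val_iff]
  simp only [mem_wtSupport_iff, coeffAt_basisFun hl]
  constructor
  · intro h C
    exact h C l (by simp)
  · intro h C l' hl'
    have : l = l' := by by_contra h; simp [h] at hl'
    exact this ▸ h C

/-- The coefficient functionals on the associated graded algebra. -/
def grCoeff (l : Wt n) : Gr S t →ₗ[K] K :=
  Submodule.liftQ ((reesIdeal S t).restrictScalars K)
    { toFun := fun x => coeffAt l (x.comp (val S t l) : CoordRing K P)
      map_add' := fun x y => by rw [Rees.comp_add, Submodule.coe_add, map_add]
      map_smul' := fun c x => by rw [Rees.comp_smul, Submodule.coe_smul, map_smul]; rfl }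
    (by
      intro x hx
      have h : (x.comp (val S t l) : CoordRing K P) ∈ filtGT S t (val S t l) := hx _
      by_contra h0
      exact absurd (mem_filtGT_iff.mp h l h0) (lt_irrefl _))

theorem grCoeff_mk (l : Wt n) (x : Rees S t) :
    grCoeff S t l (Ideal.Quotient.mk (reesIdeal S t) x) =
      coeffAt l (x.comp (val S t l) : CoordRing K P) := rfl

/-- In the component of degree a only weights with `val` ≥ a occur. If the coefficients with `val` =
a vanish, the component lies in the ideal. -/
theorem grCoeff_ext {x y : Gr S t} (h : ∀ l, grCoeff S t l x = grCoeff S t l y) : x = y := by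
  rw [← sub_eq_zero]
  replace h : ∀ l, grCoeff S t l (x - y) = 0 := fun l => by rw [map_sub, h, sub_self]
  generalize x - y = z at h
  obtain ⟨z, rfl⟩ := Ideal.Quotient.mk_surjective z
  rw [Ideal.Quotient.eq_zero_iff_mem]
  intro a
  refine mem_filtGT_iff.mpr fun l hl => lt_of_le_of_ne (mem_filtGE_iff.mp (z.comp a).2 l hl) ?_
  rintro rfl
  exact hl (h l)

theorem Rees.comp_of (a b : ValGroup t) (g : filtGE S t a) :
    ((Rees.of S t a g).comp b : CoordRing K P) = if a = b then (g : CoordRing K P) else 0 := by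
  change ((DirectSum.of (fun a => filtGE S t a) a g) b : CoordRing K P) = _
  rw [DirectSum.coe_of_apply]
  split_ifs <;> rfl

theorem grCoeff_of (l : Wt n) (a : ValGroup t) (g : filtGE S t a) :
    grCoeff S t l (Ideal.Quotient.mk (reesIdeal S t) (Rees.of S t a g)) =
      if a = val S t l then coeffAt l (g : CoordRing K P) else 0 := by
  rw [grCoeff_mk, Rees.comp_of]
  split_ifs <;> simp

theorem grCoeff_symb {l : Wt n} (hl : l ∈ weightMonoid P) (l' : Wt n) :
    grCoeff S t l' (symb S t (basisFun K P l)) = if l = l' then 1 else 0 := by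
  rw [symb, grCoeff_of]
  change (if _ then coeffAt l' (basisFun K P l) else 0) = _
  rw [nu_basisFun S t hl, coeffAt_basisFun hl]
  split_ifs with h1 h2 h2
  · rfl
  · rfl
  · exact absurd (congrArg _ h2) h1
  · rfl

theorem symb_zero : symb S t (basisFun K P 0) = 1 := by
  refine grCoeff_ext S t fun l => ?_
  rw [grCoeff_symb S t (zero_mem _), ← map_one (Ideal.Quotient.mk (reesIdeal S t)), grCoeff_mk,
    Rees.comp_one, ← basisFun_zero]
  split_ifs with h1 h2 h2
  · rw [coeffAt_basisFun (zero_mem _), if_pos h1]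
  · exact absurd (by rw [← h1, val_zero]) h2
  · rw [coeffAt_basisFun (zero_mem _), if_neg h1]
  · simp

/-- The product is represented by f_(l+l') placed in degree `val l + val l'`. If this is smaller
than `val (l + l')`, the element lies in the strict filtration step. -/
theorem symb_mul {l l' : Wt n} (hl : l ∈ weightMonoid P) (hl' : l' ∈ weightMonoid P) :
    symb S t (basisFun K P l) * symb S t (basisFun K P l') =
      if val S t l + val S t l' = val S t (l + l') then symb S t (basisFun K P (l + l')) else 0 := by
  have hmul : symb S t (basisFun K P l) * symb S t (basisFun K P l') =
      Ideal.Quotient.mk (reesIdeal S t) (Rees.of S t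
        (nu S t (basisFun K P l) + nu S t (basisFun K P l')) ⟨basisFun K P l * basisFun K P l',
          SetLike.GradedMul.mul_mem (A := filtGE S t) (Or.inr le_rfl) (Or.inr le_rfl)⟩) := by
    rw [symb, symb, ← map_mul]
    congr 1
    exact DirectSum.of_mul_of (A := fun a => filtGE S t a) _ _
  refine grCoeff_ext S t fun k => ?_
  rw [hmul, grCoeff_of]
  change (if _ then coeffAt k (basisFun K P l * basisFun K P l') else 0) = _
  rw [nu_basisFun S t hl, nu_basisFun S t hl', ← basisFun_add hl hl',
    coeffAt_basisFun (add_mem hl hl')]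
  by_cases hk : l + l' = k
  · subst hk
    rw [if_pos rfl]
    by_cases h : val S t l + val S t l' = val S t (l + l')
    · rw [if_pos h, if_pos h, grCoeff_symb S t (add_mem hl hl'), if_pos rfl]
    · rw [if_neg h, if_neg h, LinearMap.map_zero]
  · rw [if_neg hk, ite_self]
    split_ifs with h
    · rw [grCoeff_symb S t (add_mem hl hl'), if_neg hk]
    · simp

theorem Rees.induction_on {p : Rees S t → Prop} (x : Rees S t) (h0 : p 0)
    (h1 : ∀ a g, p (Rees.of S t a g)) (h2 : ∀ x y, p x → p y → p (x + y)) : p x :=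
  DirectSum.induction_on (motive := p) x h0 h1 h2

theorem span_symb : Submodule.span K
    ((fun l => symb S t (basisFun K P l)) '' (weightMonoid P : Set (Wt n))) = ⊤ := by
  classical
  rw [eq_top_iff]
  rintro x -
  obtain ⟨x, rfl⟩ := Ideal.Quotient.mk_surjective x
  induction x using Rees.induction_on with
  | h0 => rw [map_zero]; exact zero_mem _
  | h2 x y hx hy => rw [map_add]; exact add_mem hx hy
  | h1 a g =>
    have hsub : ∀ l ∈ wtSupport K P (g : CoordRing K P), l ∈ weightMonoid P := by
      intro l hl
      by_contra h
      exact mem_wtSupport_iff.mp hl (coeffAt_eq_zero _ h)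
    -- In degree a the terms of g with `val` > a vanish, and each remaining basis element sits in
    -- its own degree.
    have h : Ideal.Quotient.mk (reesIdeal S t) (Rees.of S t a g) =
        ∑ l ∈ wtSupport K P (g : CoordRing K P) with a = val S t l,
          coeffAt l (g : CoordRing K P) • symb S t (basisFun K P l) := by
      refine grCoeff_ext S t fun k => ?_
      rw [grCoeff_of, map_sum, Finset.sum_filter]
      rw [Finset.sum_congr rfl (g := fun l => if l = k then
        (if a = val S t k then coeffAt k (g : CoordRing K P) else 0) else 0)]
      · rw [Finset.sum_ite_eq']
        split_ifs with h1 h2 h2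
        · rfl
        · by_contra h3
          exact h2 (mem_wtSupport_iff.mpr h3)
        · rfl
        · rfl
      · intro l hl
        rw [map_smul, grCoeff_symb S t (hsub l hl)]
        by_cases hlk : l = k
        · subst hlk
          simp
        · simp [hlk]
    rw [h]
    exact sum_mem fun l hl => Submodule.smul_mem _ _
      (Submodule.subset_span ⟨l, hsub l (Finset.mem_filter.mp hl).1, rfl⟩)

theorem finite_weightMonoid_le (N : ℤ) : {l : Wt n | l ∈ weightMonoid P ∧ l.1 ≤ N}.Finite := by
  classical
  refine ((Set.finite_Icc (0 : LatPts P →₀ ℕ)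
    (Finsupp.equivFunOnFinite.symm fun _ => N.toNat)).image monWt).subset ?_
  rintro l ⟨hl, hN⟩
  obtain ⟨a, rfl⟩ := mem_weightMonoid.mp hl
  rw [monWt_fst] at hN
  refine ⟨a, ⟨zero_le, fun χ => ?_⟩, rfl⟩
  have := Finsupp.le_degree χ a
  simp only [Finsupp.equivFunOnFinite_symm_apply_apply]
  omega

/-- There are finitely many weights of bounded degree. Above the bound, `exists_sub_wvec` writes the
class of f_l as a product of classes of smaller degree. -/
theorem nonempty_genSystem : Nonempty (GenSystem S t) := by
  classical
  -- The summand 1 puts the elements of degree one within the bound at once.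
  set N : ℤ := 1 + ∑ σ, (S.deg σ : ℤ) with hN
  have hfin : {l : Wt n | l ∈ weightMonoid P ∧ 1 ≤ l.1 ∧ l.1 ≤ N}.Finite :=
    (finite_weightMonoid_le (P := P) N).subset fun l hl => ⟨hl.1, hl.2.2⟩
  have hdeg : 0 ≤ ∑ σ, (S.deg σ : ℤ) := Finset.sum_nonneg fun σ _ => Int.natCast_nonneg _
  refine ⟨⟨hfin.toFinset, fun l hl => ?_, fun l hl => ?_, fun χ => ?_, ?_⟩⟩
  · exact mem_weightMonoid.mp (hfin.mem_toFinset.mp hl).1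
  · exact (hfin.mem_toFinset.mp hl).2.1
  · rw [hfin.mem_toFinset]
    exact ⟨wt_mem_weightMonoid χ, le_rfl, by simp only; omega⟩
  · rw [hfin.coe_toFinset]
    set A := Algebra.adjoin K ((fun l => symb S t (basisFun K P l)) ''
      {l : Wt n | l ∈ weightMonoid P ∧ 1 ≤ l.1 ∧ l.1 ≤ N})
    have hmem : ∀ k : ℕ, ∀ l ∈ weightMonoid P, l.1.toNat ≤ k →
        symb S t (basisFun K P l) ∈ A := by
      intro k
      induction k with
      | zero =>
        intro l hl hk
        have h0 := weightMonoid_fst_nonneg hl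
        rw [eq_zero_of_weightMonoid hl (by omega), symb_zero]
        exact one_mem _
      | succ k ih =>
        intro l hl hk
        by_cases h1 : l.1.toNat ≤ k
        · exact ih l hl h1
        by_cases h2 : l.1 ≤ N
        · exact Algebra.subset_adjoin ⟨l, ⟨hl, by omega, h2⟩, rfl⟩
        obtain ⟨σ, hσ, hval⟩ := exists_sub_wvec S t hl (by omega)
        have hσ1 : 1 ≤ S.deg σ := S.one_le_deg σ
        have hσN : (S.deg σ : ℤ) ≤ ∑ σ, (S.deg σ : ℤ) :=
          Finset.single_le_sum (f := fun σ => (S.deg σ : ℤ)) (fun σ _ => Int.natCast_nonneg _)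
            (Finset.mem_univ σ)
        have hmul := symb_mul S t hσ (wvec_mem_weightMonoid S σ)
        rw [sub_add_cancel, if_pos hval] at hmul
        rw [← hmul]
        refine mul_mem (ih _ hσ ?_) (Algebra.subset_adjoin ⟨_, ⟨wvec_mem_weightMonoid S σ, ?_, ?_⟩, rfl⟩)
        · simp only [Prod.fst_sub, Stratification.wvec]; omega
        · simp only [Stratification.wvec]; omega
        · simp only [Stratification.wvec]; omega
    rw [eq_top_iff]
    intro x _
    have hx : x ∈ Submodule.span K
      ((fun l => symb S t (basisFun K P l)) '' (weightMonoid P : Set (Wt n))) := by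
      rw [span_symb]; trivial
    refine Submodule.span_le (p := Subalgebra.toSubmodule A).mpr ?_ hx
    rintro _ ⟨l, hl, rfl⟩
    exact hmem _ l hl le_rfl

end AssociatedGraded

end

/-! ### Initial ideals as the kernel of K[x] → gr_ν, and the choice of λ. -/

section

section InitialForm

variable {ι : Type} {K : Type u} [Field K] {Λ : Type*} [LinearOrder Λ]

open scoped Classical in
theorem coeff_initialForm (d : (ι →₀ ℕ) → Λ) (g : MvPolynomial ι K) (α : ι →₀ ℕ) :
    (initialForm d g).coeff α = if ∀ β ∈ g.support, d β ≤ d α then g.coeff α else 0 := by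
  rw [initialForm, MvPolynomial.coeff_sum]
  simp only [MvPolynomial.coeff_monomial]
  rw [Finset.sum_ite_eq']
  by_cases hα : α ∈ g.support
  · simp only [Finset.mem_filter, hα, true_and]
  · rw [if_neg (fun h => hα (Finset.mem_filter.mp h).1), MvPolynomial.notMem_support_iff.mp hα, ite_self]

end InitialForm

/-- Finitely many lexicographically positive vectors are positive with respect to some linear
functional. -/
theorem exists_weights_of_lex {I : Type*} [LinearOrder I] (X : Finset (I → ℚ)) (s : Finset I) :
    ∃ ε : I → ℚ, ∀ x ∈ X, (∃ i ∈ s, 0 < x i ∧ ∀ j ∈ s, j < i → x j = 0) →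
      0 < ∑ i ∈ s, ε i * x i := by
  classical
  induction s using Finset.induction_on_min with
  | empty => exact ⟨0, by simp⟩
  | insert a s ha ih =>
    obtain ⟨ε, hε⟩ := ih
    have has : a ∉ s := fun h => lt_irrefl _ (ha a h)
    -- The new index a precedes all the others, so its weight must outweigh their contribution for
    -- every x with x a > 0. Vectors with x a = 0 add 0 to the sum.
    refine ⟨Function.update ε a (1 + ∑ x ∈ X, |∑ i ∈ s, ε i * x i| / |x a|), fun x hx h => ?_⟩
    have hs : ∀ c, ∑ i ∈ s, Function.update ε a c i * x i = ∑ i ∈ s, ε i * x i := fun c =>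
      Finset.sum_congr rfl fun i hi => by rw [Function.update_of_ne (ne_of_mem_of_not_mem hi has)]
    rw [Finset.sum_insert has, Function.update_self, hs]
    obtain ⟨i, hi, hpos, hzero⟩ := h
    rcases Finset.mem_insert.mp hi with rfl | his
    · have h1 : |∑ j ∈ s, ε j * x j| / |x i| ≤ ∑ x ∈ X, |∑ j ∈ s, ε j * x j| / |x i| :=
        Finset.single_le_sum (f := fun x : I → ℚ => |∑ j ∈ s, ε j * x j| / |x i|)
          (fun x _ => div_nonneg (abs_nonneg _) (abs_nonneg _)) hx
      have h2 : |∑ j ∈ s, ε j * x j| / x i < 1 + ∑ x ∈ X, |∑ j ∈ s, ε j * x j| / |x i| := by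
        rw [abs_of_pos hpos] at h1
        linarith
      rw [div_lt_iff₀ hpos] at h2
      have h3 := neg_abs_le (∑ j ∈ s, ε j * x j)
      linarith
    · rw [hzero a (Finset.mem_insert_self _ _) (ha i his), mul_zero, zero_add]
      exact hε x hx ⟨i, his, hpos, fun j hj hji => hzero j (Finset.mem_insert_of_mem hj) hji⟩

theorem exists_functional_of_pos {n : ℕ} {P : NormalPolytope n} (t : Linearization P)
    (X : Finset (ValGroup t)) : ∃ ψ : ValGroup t →+ ℚ, ∀ x ∈ X, 0 < x → 0 < ψ x := by
  classical
  have := Fintype.ofFinite (FaceIdx t)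
  obtain ⟨ε, hε⟩ := exists_weights_of_lex (X.image (fun x : ValGroup t => (ofLex x : FaceIdx t → ℚ)))
    Finset.univ
  refine ⟨{ toFun := fun x => ∑ i, ε i * ofLex x i
            map_zero' := Finset.sum_eq_zero fun i _ => mul_zero _
            map_add' := fun x y => by
              rw [← Finset.sum_add_distrib]
              exact Finset.sum_congr rfl fun i _ => mul_add _ _ _ }, fun x hx h => ?_⟩
  obtain ⟨i, h1, h2⟩ := h
  exact hε _ (Finset.mem_image_of_mem _ hx) ⟨i, Finset.mem_univ i, h2, fun j _ hj => (h1 j hj).symm⟩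

namespace GenSystem

variable {K : Type u} [Field K] [CharZero K] {n : ℕ} {P : NormalPolytope n}
variable {S : Stratification K P} {t : Linearization P} (G : GenSystem S t)

theorem gens_mem (l : G.gens) : l.1 ∈ weightMonoid P := mem_weightMonoid.mpr (G.isWeight _ l.2)

/-- The weight of a monomial in the generators. -/
def wtOf : (G.gens →₀ ℕ) →+ Wt n := Finsupp.weight fun l : G.gens => l.1

/-- The sum of the values of the factors of a monomial in the generators. -/
def valOf : (G.gens →₀ ℕ) →+ ValGroup t := Finsupp.weight fun l : G.gens => val S t l.1

theorem wtOf_single (l : G.gens) (k : ℕ) : G.wtOf (Finsupp.single l k) = k • l.1 :=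
  Finsupp.weight_single _ _ _

theorem valOf_single (l : G.gens) (k : ℕ) : G.valOf (Finsupp.single l k) = k • val S t l.1 :=
  Finsupp.weight_single _ _ _

theorem wtOf_mem (α : G.gens →₀ ℕ) : G.wtOf α ∈ weightMonoid P := by
  induction α using Finsupp.induction_linear with
  | zero => rw [map_zero]; exact zero_mem _
  | add α β hα hβ => rw [map_add]; exact add_mem hα hβ
  | single l k => rw [wtOf_single]; exact nsmul_mem (G.gens_mem l) k

theorem valOf_le (α : G.gens →₀ ℕ) : G.valOf α ≤ val S t (G.wtOf α) := by
  induction α using Finsupp.induction_linear with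
  | zero => rw [map_zero, map_zero, val_zero]
  | add α β hα hβ =>
    rw [map_add, map_add]
    exact (add_le_add hα hβ).trans (add_val_le S t _ _)
  | single l k =>
    rw [wtOf_single, valOf_single]
    induction k with
    | zero => rw [zero_smul, zero_smul, val_zero]
    | succ k ih =>
      rw [succ_nsmul, succ_nsmul]
      exact (add_le_add ih le_rfl).trans (add_val_le S t _ _)

/-- The quasi-valuation is additive on the factors of a monomial. -/
def IsStd (α : G.gens →₀ ℕ) : Prop := G.valOf α = val S t (G.wtOf α)

/-- Both steps valOf α + valOf β ≤ val(wt α) + val(wt β) ≤ val(wt α + wt β) are inequalities in an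
ordered group, so overall equality forces equality in each. -/
theorem isStd_add {α β : G.gens →₀ ℕ} : G.IsStd (α + β) ↔ G.IsStd α ∧ G.IsStd β ∧
    val S t (G.wtOf α) + val S t (G.wtOf β) = val S t (G.wtOf α + G.wtOf β) := by
  have hα := G.valOf_le α
  have hβ := G.valOf_le β
  have h := add_val_le S t (G.wtOf α) (G.wtOf β)
  rw [IsStd, map_add, map_add, IsStd, IsStd]
  constructor
  · intro heq
    rw [← heq] at h
    have h1 := (add_eq_add_iff_eq_and_eq hα hβ).mp (le_antisymm (add_le_add hα hβ) h)
    exact ⟨h1.1, h1.2, by rw [← heq, h1.1, h1.2]⟩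
  · rintro ⟨h1, h2, h3⟩
    rw [h1, h2, h3]

theorem theta_monomial (α : G.gens →₀ ℕ) (c : K) :
    G.theta (MvPolynomial.monomial α c) = c • basisFun K P (G.wtOf α) := by
  rw [theta, MvPolynomial.aeval_monomial, ← Algebra.smul_def]
  congr 1
  induction α using Finsupp.induction_linear with
  | zero => rw [map_zero, basisFun_zero, Finsupp.prod_zero_index]
  | add α β hα hβ =>
    rw [map_add, basisFun_add (G.wtOf_mem α) (G.wtOf_mem β), Finsupp.prod_add_index' (by simp)
      (by intros; rw [pow_add]), hα, hβ]
  | single l k =>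
    rw [wtOf_single, Finsupp.prod_single_index (by simp)]
    induction k with
    | zero => rw [zero_smul, basisFun_zero, pow_zero]
    | succ k ih =>
      rw [succ_nsmul, pow_succ, ih, basisFun_add (nsmul_mem (G.gens_mem l) k) (G.gens_mem l)]

/-- The homomorphism from the polynomial ring to the associated graded algebra. -/
def toGr : MvPolynomial G.gens K →ₐ[K] Gr S t :=
  MvPolynomial.aeval fun l => symb S t (basisFun K P l.1)

-- `symb_mul` and `isStd_add` have the same additivity condition: a product of generators survives
-- in gr_ν exactly when its monomial is standard.
open scoped Classical in
theorem toGr_monomial (α : G.gens →₀ ℕ) (c : K) :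
    G.toGr (MvPolynomial.monomial α c) =
      c • if G.IsStd α then symb S t (basisFun K P (G.wtOf α)) else 0 := by
  rw [toGr, MvPolynomial.aeval_monomial, ← Algebra.smul_def]
  congr 1
  have h0 : G.IsStd 0 := by rw [IsStd, map_zero, map_zero, val_zero]
  have hadd : ∀ α β : G.gens →₀ ℕ,
      (if G.IsStd α then symb S t (basisFun K P (G.wtOf α)) else 0) *
        (if G.IsStd β then symb S t (basisFun K P (G.wtOf β)) else 0) =
      if G.IsStd (α + β) then symb S t (basisFun K P (G.wtOf (α + β))) else 0 := by
    intro α β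
    by_cases hα : G.IsStd α
    · by_cases hβ : G.IsStd β
      · rw [if_pos hα, if_pos hβ, symb_mul S t (G.wtOf_mem α) (G.wtOf_mem β), map_add]
        exact if_congr (by rw [isStd_add]; tauto) rfl rfl
      · rw [if_neg hβ, if_neg (fun h => hβ (G.isStd_add.mp h).2.1), mul_zero]
    · rw [if_neg hα, if_neg (fun h => hα (G.isStd_add.mp h).1), zero_mul]
  induction α using Finsupp.induction_linear with
  | zero => rw [if_pos h0, map_zero, symb_zero, Finsupp.prod_zero_index]
  | add α β hα hβ =>
    rw [Finsupp.prod_add_index' (by simp) (by intros; rw [pow_add]), hα, hβ, hadd]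
  | single l k =>
    rw [Finsupp.prod_single_index (by simp)]
    induction k with
    | zero => rw [Finsupp.single_zero, if_pos h0, map_zero, symb_zero, pow_zero]
    | succ k ih =>
      have h1 : G.IsStd (Finsupp.single l 1) := by
        rw [IsStd, wtOf_single, valOf_single, one_smul, one_smul]
      have h2 : symb S t (basisFun K P l.1) = if G.IsStd (Finsupp.single l 1) then
          symb S t (basisFun K P (G.wtOf (Finsupp.single l 1))) else 0 := by
        rw [if_pos h1, wtOf_single, one_smul]
      rw [pow_succ, ih, h2, hadd, Finsupp.single_add]

theorem toGr_surjective : Function.Surjective G.toGr := by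
  rw [← AlgHom.range_eq_top, toGr, ← Algebra.adjoin_range_eq_range_aeval, ← G.generate]
  congr 1
  ext x
  simp

open scoped Classical in
theorem coeffAt_theta (p : MvPolynomial G.gens K) (l : Wt n) :
    coeffAt l (G.theta p) = ∑ α ∈ p.support with G.wtOf α = l, p.coeff α := by
  conv_lhs => rw [p.as_sum]
  rw [map_sum, map_sum, Finset.sum_filter]
  refine Finset.sum_congr rfl fun α _ => ?_
  rw [theta_monomial, LinearMap.map_smul, coeffAt_basisFun (G.wtOf_mem α)]
  split_ifs <;> simp

open scoped Classical in
theorem grCoeff_toGr (p : MvPolynomial G.gens K) (l : Wt n) :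
    grCoeff S t l (G.toGr p) =
      ∑ α ∈ p.support with G.IsStd α ∧ G.wtOf α = l, p.coeff α := by
  conv_lhs => rw [p.as_sum]
  rw [map_sum, map_sum, Finset.sum_filter]
  refine Finset.sum_congr rfl fun α _ => ?_
  rw [toGr_monomial, LinearMap.map_smul]
  by_cases h : G.IsStd α
  · rw [if_pos h, grCoeff_symb S t (G.wtOf_mem α)]
    by_cases h2 : G.wtOf α = l <;> simp [h, h2]
  · rw [if_neg h, if_neg (fun h2 => h h2.1), LinearMap.map_zero, smul_zero]

/-- The coefficient of f_l in a preimage of its class under `toGr` is 1, and only standard monomials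
of weight l contribute to it. -/
theorem exists_isStd {l : Wt n} (hl : l ∈ weightMonoid P) :
    ∃ α : G.gens →₀ ℕ, G.IsStd α ∧ G.wtOf α = l := by
  classical
  obtain ⟨p, hp⟩ := G.toGr_surjective (symb S t (basisFun K P l))
  have h := G.grCoeff_toGr p l
  rw [hp, grCoeff_symb S t hl, if_pos rfl] at h
  obtain ⟨α, hα, -⟩ := Finset.exists_ne_zero_of_sum_ne_zero (h ▸ one_ne_zero)
  exact ⟨α, (Finset.mem_filter.mp hα).2⟩

/-- A degree function on monomials which, on the monomials of a given weight, is minimal exactly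
at the monomials on which the quasi-valuation is additive. -/
def Detects {Λ : Type*} [LinearOrder Λ] (d : (G.gens →₀ ℕ) → Λ) : Prop :=
  ∀ α β, G.wtOf α = G.wtOf β → G.IsStd β → (G.IsStd α → d α = d β) ∧ (¬ G.IsStd α → d β < d α)

/-- J is described by binomials x^α − x^β of equal weight. With β standard, the initial form is the
whole binomial if α is standard, and x^α otherwise; these are the relations of gr_ν. -/
theorem initialIdeal_eq_ker {Λ : Type*} [LinearOrder Λ] {d : (G.gens →₀ ℕ) → Λ}
    (hd : G.Detects d) : initialIdeal d (RingHom.ker G.theta) = RingHom.ker G.toGr := by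
  classical
  refine le_antisymm (Ideal.span_le.mpr ?_) fun p hp => ?_
  · rintro _ ⟨f, hf, rfl⟩
    rw [SetLike.mem_coe, RingHom.mem_ker] at hf ⊢
    refine grCoeff_ext S t fun l => ?_
    rw [LinearMap.map_zero, grCoeff_toGr]
    -- If the initial form of f has a standard monomial of weight l, a nonstandard monomial of f of
    -- weight l would have larger degree. So all monomials of f of weight l are standard of the same
    -- maximal degree, and their coefficients add up to that of f_l in θ f = 0.
    by_cases hex : ∃ α ∈ (initialForm d f).support, G.IsStd α ∧ G.wtOf α = l
    · obtain ⟨α₀, h0, hstd, rfl⟩ := hex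
      rw [MvPolynomial.mem_support_iff, coeff_initialForm] at h0
      have hmax : ∀ β ∈ f.support, d β ≤ d α₀ := by
        by_contra h
        exact h0 (if_neg h)
      have hkey : ∀ α ∈ f.support, G.wtOf α = G.wtOf α₀ → G.IsStd α ∧ d α = d α₀ := by
        intro α hα hw
        by_cases hs : G.IsStd α
        · exact ⟨hs, (hd α α₀ hw hstd).1 hs⟩
        · exact absurd ((hd α α₀ hw hstd).2 hs) (hmax α hα).not_gt
      have hc := G.coeffAt_theta f (G.wtOf α₀)
      rw [hf, map_zero] at hc
      rw [hc]
      refine Finset.sum_subset_zero_on_sdiff ?_ ?_ ?_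
      · intro α hα
        obtain ⟨h1, h2, h3⟩ := Finset.mem_filter.mp hα
        refine Finset.mem_filter.mpr ⟨?_, h3⟩
        rw [MvPolynomial.mem_support_iff, coeff_initialForm] at h1
        rw [MvPolynomial.mem_support_iff]
        intro h4
        exact h1 (by rw [h4, ite_self])
      · intro α hα
        obtain ⟨h1, h2⟩ := Finset.mem_sdiff.mp hα
        obtain ⟨h3, h4⟩ := Finset.mem_filter.mp h1
        obtain ⟨h5, h6⟩ := hkey α h3 h4
        by_contra h7
        refine h2 (Finset.mem_filter.mpr ⟨?_, h5, h4⟩)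
        rw [MvPolynomial.mem_support_iff, coeff_initialForm, h6, if_pos hmax]
        exact h7
      · intro α hα
        obtain ⟨h1, h2, h3⟩ := Finset.mem_filter.mp hα
        rw [MvPolynomial.mem_support_iff, coeff_initialForm] at h1
        rw [coeff_initialForm]
        by_cases h4 : ∀ β ∈ f.support, d β ≤ d α
        · rw [if_pos h4]
        · exact absurd (if_neg h4) h1
    · push Not at hex
      refine Finset.sum_eq_zero fun α hα => ?_
      obtain ⟨h1, h2, h3⟩ := Finset.mem_filter.mp hα
      exact absurd h3 (hex α h1 h2)
  -- Fix one standard monomial for each weight. Modulo the initial ideal every monomial is either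
  -- this representative or 0.
  · choose! s hs using fun l (hl : l ∈ weightMonoid P) => G.exists_isStd hl
    set I := initialIdeal d (RingHom.ker G.theta) with hI
    have hmon : ∀ α : G.gens →₀ ℕ, Ideal.Quotient.mk I (MvPolynomial.monomial α (1 : K)) =
        if G.IsStd α then Ideal.Quotient.mk I (MvPolynomial.monomial (s (G.wtOf α)) (1 : K)) else 0 := by
      intro α
      obtain ⟨hs1, hs2⟩ := hs _ (G.wtOf_mem α)
      set β := s (G.wtOf α) with hβ
      by_cases hαβ : α = β
      · rw [← hαβ] at hs1 ⊢
        rw [if_pos hs1]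
      have hdα := hd α β hs2.symm hs1
      let f : MvPolynomial G.gens K := MvPolynomial.monomial α 1 - MvPolynomial.monomial β 1
      have hf : f ∈ RingHom.ker G.theta := by
        rw [RingHom.mem_ker, map_sub, theta_monomial, theta_monomial, hs2, sub_self]
      have hcoeff : ∀ γ, f.coeff γ = (if α = γ then 1 else 0) - if β = γ then 1 else 0 := by
        intro γ
        rw [MvPolynomial.coeff_sub, MvPolynomial.coeff_monomial, MvPolynomial.coeff_monomial]
      have hsupp : ∀ γ, γ ∈ f.support ↔ γ = α ∨ γ = β := by
        intro γ
        rw [MvPolynomial.mem_support_iff, hcoeff]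
        by_cases h1 : α = γ
        · subst h1; simp [Ne.symm hαβ]
        · by_cases h2 : β = γ
          · subst h2; simp [hαβ]
          · simp [h1, h2, Ne.symm h1, Ne.symm h2]
      have hin : initialForm d f ∈ I := Ideal.subset_span ⟨f, hf, rfl⟩
      by_cases hstd : G.IsStd α
      · rw [if_pos hstd, Ideal.Quotient.mk_eq_mk_iff_sub_mem]
        suffices heq : initialForm d f = f by rwa [heq] at hin
        ext γ
        rw [coeff_initialForm]
        split_ifs with h
        · rfl
        · by_contra h3
          replace h3 := Ne.symm h3
          refine h fun δ hδ => ?_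
          have h4 : ∀ δ ∈ f.support, d δ = d β := by
            intro δ hδ
            rcases (hsupp δ).mp hδ with rfl | rfl
            · exact hdα.1 hstd
            · rfl
          rw [h4 δ hδ, h4 γ (MvPolynomial.mem_support_iff.mpr h3)]
      · rw [if_neg hstd, Ideal.Quotient.eq_zero_iff_mem]
        suffices heq : initialForm d f = MvPolynomial.monomial α 1 by rwa [heq] at hin
        ext γ
        rw [coeff_initialForm]
        have hlt := hdα.2 hstd
        by_cases h1 : α = γ
        · subst h1
          rw [if_pos, hcoeff]
          · simp [Ne.symm hαβ]
          · intro δ hδ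
            rcases (hsupp δ).mp hδ with rfl | rfl
            · exact le_rfl
            · exact hlt.le
        · rw [MvPolynomial.coeff_monomial, if_neg h1]
          split_ifs with h
          · by_contra h3
            rcases (hsupp γ).mp (MvPolynomial.mem_support_iff.mpr h3) with rfl | rfl
            · exact h1 rfl
            · exact absurd (h α ((hsupp α).mpr (Or.inl rfl))) hlt.not_ge
          · rfl
    rw [← Ideal.Quotient.eq_zero_iff_mem, p.as_sum, map_sum]
    have h1 : ∀ α, Ideal.Quotient.mk I (MvPolynomial.monomial α (p.coeff α)) =
        if G.IsStd α then Ideal.Quotient.mk I (MvPolynomial.C (p.coeff α)) *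
          Ideal.Quotient.mk I (MvPolynomial.monomial (s (G.wtOf α)) (1 : K)) else 0 := by
      intro α
      rw [← mul_one (p.coeff α), ← MvPolynomial.C_mul_monomial, map_mul, hmon, mul_one, mul_ite, mul_zero]
    -- Grouped by weight, the coefficient of each representative is a coefficient of `toGr p`, which
    -- is 0.
    rw [Finset.sum_congr rfl fun α _ => h1 α, ← Finset.sum_filter,
      ← Finset.sum_fiberwise_of_maps_to (t := p.support.image G.wtOf) (g := G.wtOf)
        (fun α hα => Finset.mem_image_of_mem _ (Finset.mem_filter.mp hα).1)]
    refine Finset.sum_eq_zero fun l _ => ?_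
    rw [Finset.filter_filter, Finset.sum_congr rfl (fun α hα => by
      rw [(Finset.mem_filter.mp hα).2.2]), ← Finset.sum_mul, ← map_sum, ← map_sum, ← grCoeff_toGr,
      show G.toGr p = 0 from hp, LinearMap.map_zero]
    simp

theorem cast_weight_degs (α : G.gens →₀ ℕ) :
    ((Finsupp.weight G.degs α : ℕ) : ℤ) = (G.wtOf α).1 := by
  induction α using Finsupp.induction_linear with
  | zero => simp
  | add α β hα hβ => rw [map_add, map_add, Nat.cast_add, hα, hβ, Prod.fst_add]
  | single l k =>
    have h := weightMonoid_fst_nonneg (G.gens_mem l)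
    rw [wtOf_single, Finsupp.weight_single, degs]
    simp [h]

/-- Equal weights have equal degrees, so the comparison falls to the sum of values in reversed
order; by superadditivity that sum is largest exactly at standard monomials. -/
theorem detects_degA : G.Detects G.degA := by
  have hval : ∀ α : G.gens →₀ ℕ,
      (α.sum fun l k => k • nu S t (basisFun K P l.1)) = G.valOf α := by
    intro α
    rw [valOf, Finsupp.weight_apply]
    exact Finsupp.sum_congr fun l _ => by rw [nu_basisFun S t (G.gens_mem l)]
  intro α β hw hβ
  have hdeg : Finsupp.weight G.degs α = Finsupp.weight G.degs β := by
    have h1 := G.cast_weight_degs α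
    rw [hw, ← G.cast_weight_degs β] at h1
    exact_mod_cast h1
  simp only [degA, hval, hdeg]
  constructor
  · intro hα
    rw [show G.valOf α = G.valOf β by rw [hα, hβ, hw]]
  · intro hα
    rw [Prod.Lex.toLex_lt_toLex]
    refine Or.inr ⟨rfl, OrderDual.toDual_lt_toDual.mpr (lt_of_le_of_ne ?_ fun h => hα ?_)⟩
    · rw [hβ, ← hw]; exact G.valOf_le α
    · rw [IsStd, h, hw, hβ]

/-- Henceforth the preorder of ν enters only through the kernel of `toGr`. -/
theorem approximates_iff (lam : G.gens → ℤ) : G.Approximates lam ↔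
    initialIdeal (fun α => Finsupp.weight lam α) (RingHom.ker G.theta) = RingHom.ker G.toGr := by
  rw [Approximates, G.initialIdeal_eq_ker G.detects_degA, eq_comm]

/-- A pair of equal weight with standard second member is a sum of generating pairs whose second
members are again standard. Each then has a nonnegative difference of values, and a functional
positive on the positive differences of generators is positive on every positive difference. -/
theorem exists_functional : ∃ ψ : ValGroup t →+ ℚ, ∀ α β : G.gens →₀ ℕ, G.wtOf α = G.wtOf β →
    G.IsStd β → ¬ G.IsStd α → ψ (G.valOf α) < ψ (G.valOf β) := by
  classical
  let Q : AddSubmonoid ((G.gens →₀ ℕ) × (G.gens →₀ ℕ)) :=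
    (G.wtOf.comp (AddMonoidHom.fst _ _)).eqLocusM (G.wtOf.comp (AddMonoidHom.snd _ _))
  -- Finite generation of the pairs of exponents of equal weight reduces infinitely many strict
  -- inequalities to finitely many.
  obtain ⟨T, hT⟩ : Q.FG := AddSubmonoid.fg_eqLocusM _ _
  obtain ⟨ψ, hψ⟩ := exists_functional_of_pos t (T.image fun p => G.valOf p.2 - G.valOf p.1)
  have key : ∀ p ∈ Q, G.IsStd p.2 → 0 ≤ ψ (G.valOf p.2 - G.valOf p.1) ∧
      (0 < G.valOf p.2 - G.valOf p.1 → 0 < ψ (G.valOf p.2 - G.valOf p.1)) := by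
    intro p hp
    have hle : ∀ p ∈ Q, G.IsStd p.2 → 0 ≤ G.valOf p.2 - G.valOf p.1 := by
      intro p hp h
      have hw : G.wtOf p.1 = G.wtOf p.2 := hp
      rw [sub_nonneg, h, ← hw]
      exact G.valOf_le p.1
    rw [← hT] at hp
    induction hp using AddSubmonoid.closure_induction with
    | mem p hp =>
      intro h
      have h1 := hψ _ (Finset.mem_image_of_mem _ hp)
      refine ⟨?_, h1⟩
      rcases (hle p (hT ▸ AddSubmonoid.subset_closure hp) h).eq_or_lt with h2 | h2
      · rw [← h2, map_zero]
      · exact (h1 h2).le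
    | zero => intro h; simp
    | add p q hp hq ihp ihq =>
      intro h
      have hs := G.isStd_add.mp h
      have h1 := ihp hs.1
      have h2 := ihq hs.2.1
      have heq : G.valOf (p + q).2 - G.valOf (p + q).1 =
          (G.valOf p.2 - G.valOf p.1) + (G.valOf q.2 - G.valOf q.1) := by
        rw [Prod.snd_add, Prod.fst_add, map_add, map_add]
        abel
      rw [heq, map_add]
      refine ⟨add_nonneg h1.1 h2.1, fun h3 => ?_⟩
      rcases (hle p (hT ▸ hp) hs.1).eq_or_lt with h4 | h4
      · rw [← h4, zero_add] at h3
        exact add_pos_of_nonneg_of_pos h1.1 (h2.2 h3)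
      · exact add_pos_of_pos_of_nonneg (h1.2 h4) h2.1
  refine ⟨ψ, fun α β hw hβ hα => ?_⟩
  have h := (key (α, β) hw hβ).2 (sub_pos.mpr (lt_of_le_of_ne ?_ fun h => hα ?_))
  · rw [map_sub] at h
    exact sub_pos.mp h
  · rw [hβ, ← hw]; exact G.valOf_le α
  · rw [IsStd]
    exact h.trans (by rw [hβ, hw])

theorem exists_approximates : ∃ lam : G.gens → ℤ, G.Approximates lam := by
  classical
  obtain ⟨ψ, hψ⟩ := G.exists_functional
  let q : G.gens → ℚ := fun l => ψ (val S t l.1)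
  -- A common denominator makes λ = −N ψ(val) integral. The sign turns large values into small
  -- weights, as in `degA`.
  let N : ℕ := ∏ l, (q l).den
  have hN : (0 : ℚ) < N := by
    have : 0 < N := Finset.prod_pos fun l _ => (q l).den_pos
    exact_mod_cast this
  have hint : ∀ l, ∃ z : ℤ, (z : ℚ) = -(N * q l) := by
    intro l
    refine ⟨-(((∏ k ∈ Finset.univ.erase l, (q k).den : ℕ) : ℤ) * (q l).num), ?_⟩
    have h1 : (N : ℚ) = (q l).den * ((∏ k ∈ Finset.univ.erase l, (q k).den : ℕ) : ℚ) := by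
      rw [← Nat.cast_mul, Finset.mul_prod_erase _ (fun k => (q k).den) (Finset.mem_univ l)]
    have h2 := Rat.mul_den_eq_num (q l)
    rw [h1]
    push_cast
    rw [← h2]
    ring
  choose lam hlam using hint
  have hw : ∀ α : G.gens →₀ ℕ, ((Finsupp.weight lam α : ℤ) : ℚ) = -(N * ψ (G.valOf α)) := by
    intro α
    induction α using Finsupp.induction_linear with
    | zero => simp
    | add α β hα hβ =>
      rw [map_add, map_add, map_add, Int.cast_add, hα, hβ]
      ring
    | single l k =>
      rw [valOf_single, Finsupp.weight_single, map_nsmul, nsmul_eq_mul, nsmul_eq_mul, Int.cast_mul,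
        hlam]
      push_cast
      ring
  refine ⟨lam, (G.approximates_iff lam).mpr (G.initialIdeal_eq_ker fun α β h hβ => ⟨fun hα => ?_,
    fun hα => ?_⟩)⟩
  · have h1 : ((Finsupp.weight lam α : ℤ) : ℚ) = (Finsupp.weight lam β : ℤ) := by
      rw [hw, hw, show G.valOf α = G.valOf β by rw [hα, hβ, h]]
    exact_mod_cast h1
  · have h1 : ((Finsupp.weight lam β : ℤ) : ℚ) < (Finsupp.weight lam α : ℤ) := by
      rw [hw, hw, neg_lt_neg_iff]
      exact mul_lt_mul_of_pos_left (hψ α β h hβ hα) hN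
    exact_mod_cast h1

end GenSystem

end

/-! ### The homogenized ideal, its localization at u and its reduction modulo u. -/

section

open TensorProduct Polynomial

section Laurent

variable {K B : Type u} [Field K] [CommRing B] [Algebra K B]

theorem isDomain_laurent_tensor [IsDomain B] : IsDomain (LaurentPolynomial K ⊗[K] B) := by
  let e : LaurentPolynomial K ⊗[K] B ≃ₐ[K] AddMonoidAlgebra B ℤ :=
    (Algebra.TensorProduct.comm K (LaurentPolynomial K) B).trans
      ((AddMonoidAlgebra.scalarTensorEquiv K B).restrictScalars K)
  exact e.injective.isDomain e.toRingEquiv.toRingHom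

/-- The coefficient of `T ^ k`. -/
def laurentCoeff (k : ℤ) : LaurentPolynomial K ⊗[K] B →ₗ[K] B :=
  TensorProduct.lid K B ∘ₗ LinearMap.rTensor B
    { toFun := fun s : LaurentPolynomial K => s.coeff k
      map_add' := fun s s' => by simp
      map_smul' := fun c s => by simp }

theorem laurentCoeff_tmul (k : ℤ) (s : LaurentPolynomial K) (b : B) :
    laurentCoeff k (s ⊗ₜ b) = s.coeff k • b := by
  rw [laurentCoeff, LinearMap.comp_apply, LinearMap.rTensor_tmul]
  exact TensorProduct.lid_tmul _ _

theorem coeff_toLaurent_mul_T (r : K[X]) (m k : ℤ) :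
    (Polynomial.toLaurent r * LaurentPolynomial.T m).coeff k = if m ≤ k then r.coeff (k - m).toNat else 0 := by
  induction r using Polynomial.induction_on' with
  | add p q hp hq =>
    rw [map_add, add_mul, AddMonoidAlgebra.coeff_add, Finsupp.add_apply, hp, hq, Polynomial.coeff_add]
    split_ifs <;> simp
  | monomial j c =>
    rw [← C_mul_X_pow_eq_monomial, Polynomial.toLaurent_C_mul_X_pow, mul_assoc, ← LaurentPolynomial.T_add,
      ← LaurentPolynomial.single_eq_C_mul_T, AddMonoidAlgebra.coeff_single, Finsupp.single_apply,
      coeff_C_mul_X_pow]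
    split_ifs <;> first | rfl | omega

end Laurent

namespace GenSystem

variable {K : Type u} [Field K] [CharZero K] {n : ℕ} {P : NormalPolytope n}
variable {S : Stratification K P} {t : Linearization P} (G : GenSystem S t)
variable (lam : G.gens → ℤ)

/-- The substitution `x_i ↦ T ^ λ_i f_i`, `u ↦ T`, which identifies the localization of the total
space of the degeneration at `u` with a trivial family. -/
def spread : MvPolynomial G.gens K[X] →ₐ[K[X]] LaurentPolynomial K ⊗[K] CoordRing K P :=
  MvPolynomial.aeval fun l => LaurentPolynomial.T (R := K) (lam l) ⊗ₜ[K] basisFun K P l.1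

theorem spread_monomial (α : G.gens →₀ ℕ) (r : K[X]) :
    G.spread lam (MvPolynomial.monomial α r) =
      (Polynomial.toLaurent r * LaurentPolynomial.T (Finsupp.weight lam α)) ⊗ₜ basisFun K P (G.wtOf α) := by
  have h : (α.prod fun l k => (LaurentPolynomial.T (R := K) (lam l) ⊗ₜ[K] basisFun K P l.1) ^ k) =
      LaurentPolynomial.T (Finsupp.weight lam α) ⊗ₜ basisFun K P (G.wtOf α) := by
    induction α using Finsupp.induction_linear with
    | zero => rw [map_zero, map_zero, basisFun_zero, Finsupp.prod_zero_index, LaurentPolynomial.T_zero]; rfl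
    | add α β hα hβ =>
      rw [Finsupp.prod_add_index' (by simp) (by intros; rw [pow_add]), hα, hβ,
        Algebra.TensorProduct.tmul_mul_tmul, map_add, map_add, LaurentPolynomial.T_add,
        basisFun_add (G.wtOf_mem α) (G.wtOf_mem β)]
    | single l k =>
      rw [Finsupp.prod_single_index (by simp), wtOf_single, Finsupp.weight_single]
      induction k with
      | zero => rw [zero_smul, zero_smul, basisFun_zero, pow_zero, LaurentPolynomial.T_zero]; rfl
      | succ k ih =>
        rw [pow_succ, ih, Algebra.TensorProduct.tmul_mul_tmul, succ_nsmul, succ_nsmul,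
          LaurentPolynomial.T_add, basisFun_add (nsmul_mem (G.gens_mem l) k) (G.gens_mem l)]
  rw [spread, MvPolynomial.aeval_monomial, h, ← Algebra.smul_def, TensorProduct.smul_tmul',
    Algebra.smul_def, LaurentPolynomial.algebraMap_eq_toLaurent]

/-- The part of `λ`-degree `k` of a polynomial in `K[x, u]`, at `u = 1`. -/
def lamPart (k : ℤ) (F : MvPolynomial G.gens K[X]) : MvPolynomial G.gens K :=
  ∑ α ∈ F.support, MvPolynomial.monomial α
    (if Finsupp.weight lam α ≤ k then (F.coeff α).coeff (k - Finsupp.weight lam α).toNat else 0)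

theorem coeff_lamPart (k : ℤ) (F : MvPolynomial G.gens K[X]) (α : G.gens →₀ ℕ) :
    (G.lamPart lam k F).coeff α =
      if Finsupp.weight lam α ≤ k then (F.coeff α).coeff (k - Finsupp.weight lam α).toNat else 0 := by
  classical
  rw [lamPart, MvPolynomial.coeff_sum]
  simp only [MvPolynomial.coeff_monomial]
  rw [Finset.sum_ite_eq']
  split_ifs with h h1 h1
  · rfl
  · rfl
  · rw [MvPolynomial.notMem_support_iff.mp h, Polynomial.coeff_zero]
  · rfl

theorem laurentCoeff_spread (k : ℤ) (F : MvPolynomial G.gens K[X]) :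
    laurentCoeff k (G.spread lam F) = G.theta (G.lamPart lam k F) := by
  conv_lhs => rw [F.as_sum]
  rw [lamPart, map_sum, map_sum, map_sum]
  refine Finset.sum_congr rfl fun α _ => ?_
  rw [spread_monomial, laurentCoeff_tmul, coeff_toLaurent_mul_T, theta_monomial]

theorem lamDeg_lamPart_le (k : ℤ) (F : MvPolynomial G.gens K[X]) {α : G.gens →₀ ℕ}
    (hα : α ∈ (G.lamPart lam k F).support) : lamDeg lam (G.lamPart lam k F) ≤ k := by
  rw [lamDeg, dif_pos ⟨α, hα⟩]
  refine Finset.sup'_le _ _ fun β hβ => ?_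
  rw [MvPolynomial.mem_support_iff, coeff_lamPart] at hβ
  by_contra h
  exact hβ (if_neg h)

/-- Give u degree 1 and x_i degree λ_i. The part of F of degree k is recovered from its value at u =
1 by homogenizing and multiplying by the missing power of u. -/
theorem eq_sum_homogenization (F : MvPolynomial G.gens K[X]) : ∃ s : Finset ℤ,
    F = ∑ k ∈ s, MvPolynomial.C (X ^ (k - lamDeg lam (G.lamPart lam k F)).toNat) *
      homogenization lam (G.lamPart lam k F) := by
  classical
  -- The λ-degrees of the terms u^j x^α of F.
  refine ⟨F.support.biUnion fun α =>
    (F.coeff α).support.image fun j : ℕ => Finsupp.weight lam α + (j : ℤ), ?_⟩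
  ext α j
  rw [MvPolynomial.coeff_sum, Polynomial.finsetSum_coeff]
  have hterm : ∀ k : ℤ, ((MvPolynomial.C (X ^ (k - lamDeg lam (G.lamPart lam k F)).toNat) *
      homogenization lam (G.lamPart lam k F)).coeff α).coeff j =
      if Finsupp.weight lam α + j = k then (F.coeff α).coeff j else 0 := by
    intro k
    rw [MvPolynomial.coeff_C_mul, coeff_homogenization, mul_left_comm, ← pow_add, coeff_C_mul_X_pow]
    by_cases hα : α ∈ (G.lamPart lam k F).support
    · have h1 := G.lamDeg_lamPart_le lam k F hα
      have h2 := le_lamDeg lam hα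
      rw [coeff_lamPart, if_pos (h2.trans h1)]
      by_cases h : Finsupp.weight lam α + j = k
      · rw [if_pos h, if_pos (by omega)]
        congr 1
        omega
      · rw [if_neg h, if_neg (by omega)]
    · rw [MvPolynomial.notMem_support_iff.mp hα, ite_self]
      split_ifs with h
      · rw [MvPolynomial.notMem_support_iff, coeff_lamPart, if_pos (by omega)] at hα
        rw [← hα]
        congr 1
        omega
      · rfl
  rw [Finset.sum_congr rfl fun k _ => hterm k, Finset.sum_ite_eq]
  split_ifs with h
  · rfl
  · by_contra h0
    refine h (Finset.mem_biUnion.mpr ⟨α, ?_, Finset.mem_image.mpr ⟨j, ?_, rfl⟩⟩)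
    · rw [MvPolynomial.mem_support_iff]
      intro h1
      exact h0 (by rw [h1, Polynomial.coeff_zero])
    · rw [Polynomial.mem_support_iff]
      exact h0

/-- The coefficient of T^k in the image of F is θ of the degree k part of F at u = 1. If the image
vanishes, these parts lie in J and F is a combination of their homogenizations; conversely the
homogenization of f goes to a power of T times θ f. -/
theorem ker_spread : RingHom.ker (G.spread lam) = G.breveIdeal lam := by
  refine le_antisymm (fun F hF => ?_) (Ideal.span_le.mpr ?_)
  · obtain ⟨s, hs⟩ := G.eq_sum_homogenization lam F
    rw [hs]
    refine sum_mem fun k _ => Ideal.mul_mem_left _ _ (Ideal.subset_span ⟨_, ?_, rfl⟩)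
    rw [SetLike.mem_coe, RingHom.mem_ker, ← laurentCoeff_spread, show G.spread lam F = 0 from hF,
      map_zero]
  · rintro _ ⟨f, hf, rfl⟩
    rw [SetLike.mem_coe, RingHom.mem_ker] at hf ⊢
    have h : G.spread lam (homogenization lam f) =
        LaurentPolynomial.T (lamDeg lam f) ⊗ₜ G.theta f := by
      obtain ⟨D, hD⟩ : ∃ D, D = lamDeg lam f := ⟨_, rfl⟩
      rw [homogenization, map_sum, ← hD]
      conv_rhs => rw [f.as_sum, map_sum, TensorProduct.tmul_sum]
      refine Finset.sum_congr rfl fun α hα => ?_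
      have h1 := le_lamDeg lam hα
      rw [← hD] at h1
      rw [spread_monomial, theta_monomial, Polynomial.toLaurent_C_mul_X_pow, mul_assoc,
        ← LaurentPolynomial.T_add, TensorProduct.tmul_smul, TensorProduct.smul_tmul',
        LaurentPolynomial.smul_eq_C_mul, Int.toNat_of_nonneg (by omega), sub_add_cancel]
    rw [h, hf, TensorProduct.tmul_zero]

/-- The coordinate ring of the affine cone over the total space of the degeneration. -/
abbrev BreveRing : Type u := MvPolynomial G.gens K[X] ⧸ G.breveIdeal lam

/-- The restriction to the complement of the special fibre. -/
def toGeneric : G.BreveRing lam →ₐ[K[X]] LaurentPolynomial K ⊗[K] CoordRing K P :=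
  Ideal.Quotient.liftₐ _ (G.spread lam) fun F hF => by
    rwa [← ker_spread] at hF

theorem toGeneric_mk (F : MvPolynomial G.gens K[X]) :
    G.toGeneric lam (Ideal.Quotient.mk _ F) = G.spread lam F := rfl

theorem toGeneric_injective : Function.Injective (G.toGeneric lam) := by
  rw [injective_iff_map_eq_zero]
  intro x hx
  obtain ⟨F, rfl⟩ := Ideal.Quotient.mk_surjective x
  rw [toGeneric_mk] at hx
  rw [Ideal.Quotient.eq_zero_iff_mem, ← ker_spread]
  exact hx

instance : IsDomain (G.BreveRing lam) :=
  have := isDomain_laurent_tensor (K := K) (B := CoordRing K P)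
  (G.toGeneric_injective lam).isDomain (G.toGeneric lam).toRingHom

/-- K[u] → K[T, T⁻¹] ⊗ K[X̂_P] is already injective and factors through this map. -/
theorem algebraMap_breveRing_injective :
    Function.Injective (algebraMap K[X] (G.BreveRing lam)) := by
  have h1 : Function.Injective
      (Algebra.TensorProduct.includeLeft : LaurentPolynomial K →ₐ[K] _ ⊗[K] CoordRing K P) :=
    Algebra.TensorProduct.includeLeft_injective (algebraMap K (CoordRing K P)).injective
  intro r s hrs
  have h2 : ∀ r, G.toGeneric lam (algebraMap K[X] _ r) = Polynomial.toLaurent r ⊗ₜ 1 :=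
    fun r => (G.toGeneric lam).commutes r
  apply Polynomial.toLaurent_injective
  apply h1
  exact (h2 r).symm.trans ((congrArg _ hrs).trans (h2 s))

/-- The target is spanned by the elements T^k f_l. If x^α has weight l, a high enough power of T
carries T^k f_l to the image of some u^j x^α. -/
theorem isLocalizedModule_toGeneric :
    IsLocalizedModule (Submonoid.powers (X : K[X])) (G.toGeneric lam).toLinearMap where
  map_units x := by
    obtain ⟨u, hu⟩ := IsLocalization.map_units (LaurentPolynomial K) x
    rw [Module.End.isUnit_iff]
    have : ⇑(algebraMap K[X] (Module.End K[X] (LaurentPolynomial K ⊗[K] CoordRing K P)) x) =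
        fun y => u • y := by
      funext y
      rw [Module.algebraMap_end_apply, Units.smul_def, hu, algebraMap_smul]
    rw [this]
    exact MulAction.bijective u
  surj y := by
    have hs : ∀ (r : K[X]) (y : LaurentPolynomial K ⊗[K] CoordRing K P),
        r • y = algebraMap K[X] _ r * y := fun r y => Algebra.smul_def r y
    have hadd : ∀ y z, (∃ k : ℕ, ∃ x, (X : K[X]) ^ k • y = G.toGeneric lam x) →
        (∃ k : ℕ, ∃ x, (X : K[X]) ^ k • z = G.toGeneric lam x) →
        ∃ k : ℕ, ∃ x, (X : K[X]) ^ k • (y + z) = G.toGeneric lam x := by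
      rintro y z ⟨k, x, hx⟩ ⟨k', x', hx'⟩
      refine ⟨k + k', (X : K[X]) ^ k' • x + (X : K[X]) ^ k • x', ?_⟩
      rw [map_add, map_smul, map_smul, ← hx, ← hx']
      simp only [hs, map_pow]
      ring
    suffices h : ∃ k : ℕ, ∃ x, (X : K[X]) ^ k • y = G.toGeneric lam x by
      obtain ⟨k, x, h⟩ := h
      exact ⟨(x, ⟨X ^ k, k, rfl⟩), h⟩
    induction y using TensorProduct.induction_on with
    | zero => exact ⟨0, 0, by rw [map_zero]; exact TensorProduct.smul_zero _⟩
    | add y z hy hz => exact hadd y z hy hz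
    | tmul s b =>
      induction b using coordRing_induction with
      | h2 b c hb hc => rw [TensorProduct.tmul_add]; exact hadd _ _ hb hc
      | h1 l hl c =>
        induction s using LaurentPolynomial.induction_on' with
        | add s r hs hr => rw [TensorProduct.add_tmul]; exact hadd _ _ hs hr
        | C_mul_T k a =>
          obtain ⟨α, -, hα⟩ := G.exists_isStd hl
          -- The least power e of u for which k + e − λ·α, the exponent of u in the preimage, is
          -- nonnegative.
          refine ⟨(Finsupp.weight lam α - k).toNat, Ideal.Quotient.mk _ (MvPolynomial.monomial α
            (C (c * a) * X ^ (k + (Finsupp.weight lam α - k).toNat - Finsupp.weight lam α).toNat)), ?_⟩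
          rw [toGeneric_mk, spread_monomial, hα, Polynomial.toLaurent_C_mul_X_pow, mul_assoc,
            ← LaurentPolynomial.T_add, TensorProduct.tmul_smul, TensorProduct.smul_tmul',
            TensorProduct.smul_tmul', Algebra.smul_def, LaurentPolynomial.algebraMap_eq_toLaurent,
            Polynomial.toLaurent_X_pow, LaurentPolynomial.smul_eq_C_mul, map_mul]
          congr 1
          rw [show ∀ x y z w : LaurentPolynomial K, x * (y * (z * w)) = y * z * (w * x) by
            intros; ring, ← LaurentPolynomial.T_add]
          congr 2
          omega
  exists_of_eq {x y} h := ⟨1, by rw [G.toGeneric_injective lam h]⟩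

theorem toGeneric_isBaseChange :
    IsBaseChange (LaurentPolynomial K) (G.toGeneric lam).toLinearMap :=
  (isLocalizedModule_iff_isBaseChange (Submonoid.powers (X : K[X])) _ _).mp
    (G.isLocalizedModule_toGeneric lam)

theorem toGeneric_mem {m : ℕ} {x : G.BreveRing lam} (hx : x ∈ G.brevePiece lam m) :
    G.toGeneric lam x ∈ (degPiece K P m).baseChange (LaurentPolynomial K) := by
  obtain ⟨F, hF, rfl⟩ := hx
  change G.spread lam F ∈ _
  rw [F.as_sum, map_sum]
  refine sum_mem fun α hα => ?_
  rw [spread_monomial]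
  refine Submodule.tmul_mem_baseChange_of_mem _ ?_
  have h1 := basisFun_mem_degPiece (K := K) (mem_weightMonoid.mp (G.wtOf_mem α))
  rw [← G.cast_weight_degs, hF (MvPolynomial.mem_support_iff.mp hα), Int.toNat_natCast] at h1
  exact h1

/-- The specialization at `u = 0`. -/
def toSpecial : MvPolynomial G.gens K[X] →+* Gr S t :=
  G.toGr.toRingHom.comp (MvPolynomial.map (Polynomial.evalRingHom 0))

theorem coeff_initialForm_weight (f : MvPolynomial G.gens K) (α : G.gens →₀ ℕ) :
    (initialForm (fun α => Finsupp.weight lam α) f).coeff α =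
      if Finsupp.weight lam α = lamDeg lam f then f.coeff α else 0 := by
  classical
  rw [coeff_initialForm]
  by_cases hα : α ∈ f.support
  · refine if_congr ⟨fun h => le_antisymm (le_lamDeg lam hα) ?_, fun h β hβ => ?_⟩ rfl rfl
    · rw [lamDeg, dif_pos ⟨α, hα⟩]
      exact Finset.sup'_le _ _ h
    · rw [h]
      exact le_lamDeg lam hβ
  · rw [MvPolynomial.notMem_support_iff.mp hα, ite_self, ite_self]

/-- At u = 0 only the terms whose exponent of u is 0 survive, those of maximal λ-degree. -/
theorem map_homogenization (f : MvPolynomial G.gens K) :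
    MvPolynomial.map (Polynomial.evalRingHom 0) (homogenization lam f) =
      initialForm (fun α => Finsupp.weight lam α) f := by
  ext α
  rw [MvPolynomial.coeff_map, coeff_homogenization, coeff_initialForm_weight]
  by_cases hα : α ∈ f.support
  · have := le_lamDeg lam hα
    simp only [coe_evalRingHom, eval_mul, eval_C, eval_pow, eval_X]
    split_ifs with h
    · rw [h, sub_self, Int.toNat_zero, pow_zero, mul_one]
    · rw [zero_pow (by omega), mul_zero]
  · rw [MvPolynomial.notMem_support_iff.mp hα, ite_self, map_zero, zero_mul, map_zero]

variable {lam}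

theorem breveIdeal_le_ker (h : G.Approximates lam) :
    G.breveIdeal lam ≤ RingHom.ker G.toSpecial := by
  refine Ideal.span_le.mpr ?_
  rintro _ ⟨f, hf, rfl⟩
  rw [SetLike.mem_coe, RingHom.mem_ker, toSpecial, RingHom.comp_apply, map_homogenization]
  have h1 : initialForm (fun α => Finsupp.weight lam α) f ∈ RingHom.ker G.toGr := by
    rw [← (G.approximates_iff lam).mp h]
    exact Ideal.subset_span ⟨f, hf, rfl⟩
  exact h1

theorem C_X_dvd_sub (F : MvPolynomial G.gens K[X]) {p : MvPolynomial G.gens K}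
    (h : MvPolynomial.map (Polynomial.evalRingHom 0) F = p) :
    MvPolynomial.C (X : K[X]) ∣ F - MvPolynomial.map C p := by
  rw [MvPolynomial.C_dvd_iff_dvd_coeff]
  intro α
  rw [X_dvd_iff, MvPolynomial.coeff_sub, ← h, MvPolynomial.coeff_map, MvPolynomial.coeff_map,
    Polynomial.coeff_sub, coeff_C_zero, coe_evalRingHom, coeff_zero_eq_eval_zero, sub_self]

/-- Modulo u, F equals its value at u = 0. If that value is in in_λ J, it is a combination of
initial forms, each congruent modulo u to the corresponding homogenization. -/
theorem ker_toSpecial (h : G.Approximates lam) : RingHom.ker G.toSpecial =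
    G.breveIdeal lam ⊔ Ideal.span {MvPolynomial.C (X : K[X])} := by
  set I := G.breveIdeal lam ⊔ Ideal.span {MvPolynomial.C (X : K[X])} with hI
  have hdvd : ∀ F, MvPolynomial.C (X : K[X]) ∣ F → F ∈ I := fun F hF =>
    Ideal.mem_sup_right (Ideal.mem_span_singleton.mpr hF)
  refine le_antisymm (fun F hF => ?_) (sup_le (G.breveIdeal_le_ker h) ?_)
  · have h1 : RingHom.ker G.toGr ≤ I.comap (MvPolynomial.map C) := by
      rw [← (G.approximates_iff lam).mp h]
      refine Ideal.span_le.mpr ?_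
      rintro _ ⟨f, hf, rfl⟩
      rw [SetLike.mem_coe, Ideal.mem_comap]
      have h2 := hdvd _ (G.C_X_dvd_sub _ (G.map_homogenization lam f))
      have h3 : homogenization lam f ∈ I := Ideal.mem_sup_left (Ideal.subset_span ⟨f, hf, rfl⟩)
      exact (Submodule.sub_mem_iff_right _ h3).mp h2
    have h4 := hdvd _ (G.C_X_dvd_sub F rfl)
    have h5 : MvPolynomial.map C (MvPolynomial.map (Polynomial.evalRingHom 0) F) ∈ I := h1 hF
    exact (Submodule.sub_mem_iff_left _ h5).mp h4
  · rw [Ideal.span_singleton_le_iff_mem, RingHom.mem_ker, toSpecial, RingHom.comp_apply,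
      MvPolynomial.map_C]
    simp

end GenSystem

end

/-! ### Geometry of the family: fibres, total space, trivialization. -/

section

open TensorProduct Polynomial

/-- Every tensor is 1 ⊗ m, and it vanishes when m is a multiple of r because r becomes 0 in S. -/
theorem isBaseChange_of_surjective {R S M N : Type*} [CommRing R] [CommRing S] [AddCommGroup M]
    [AddCommGroup N] [Algebra R S] [Module R M] [Module R N] [Module S N] [IsScalarTower R S N]
    (hS : Function.Surjective (algebraMap R S)) (f : M →ₗ[R] N) (hf : Function.Surjective f) (r : R)
    (hr : algebraMap R S r = 0) (hker : ∀ m, f m = 0 → ∃ m', m = r • m') : IsBaseChange S f := by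
  rw [isBaseChange_iff_bijective]
  constructor
  · rw [injective_iff_map_eq_zero]
    intro x hx
    obtain ⟨m, rfl⟩ := TensorProduct.mk_surjective R M S hS x
    rw [TensorProduct.mk_apply, tensorAct_tmul, one_smul] at hx
    obtain ⟨m', rfl⟩ := hker m hx
    rw [TensorProduct.mk_apply, TensorProduct.tmul_smul, TensorProduct.smul_tmul',
      Algebra.smul_def, hr, zero_mul, TensorProduct.zero_tmul]
  · intro y
    obtain ⟨m, rfl⟩ := hf y
    exact ⟨1 ⊗ₜ m, by rw [tensorAct_tmul, one_smul]⟩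

/-- `Proj` of a base change. -/
theorem exists_isPullback_of_isBaseChange {R S A B : Type u} [CommRing R] [CommRing S] [CommRing A]
    [CommRing B] [Algebra R A] [Algebra S B] [Algebra R S] [Algebra R B] [IsScalarTower R S B]
    (𝒜 : ℕ → Submodule R A) (ℬ : ℕ → Submodule S B) [GradedAlgebra 𝒜] [GradedAlgebra ℬ]
    (φ : A →ₐ[R] B) (hφ : ∀ m, ∀ a ∈ 𝒜 m, φ a ∈ ℬ m) (H : IsBaseChange S φ.toLinearMap) :
    ∃ i : Proj ℬ ⟶ Proj 𝒜, IsPullback i (projStr ℬ) (projStr 𝒜)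
      (Spec.map (CommRingCat.ofHom (algebraMap R S))) :=
  let g : 𝒜 →+*ᵍ ℬ := { φ.toRingHom with map_mem := fun {m} _ hx => hφ m _ hx }
  ⟨_, isPullback_projMap g φ (fun _ => rfl) H⟩

/-- The complement of the origin in the affine line is the spectrum of the ring of Laurent
polynomials. -/
theorem exists_laurent_iso_punctured (K : Type u) [Field K] :
    ∃ e : Spec (.of (LaurentPolynomial K)) ≅ (punctured K).toScheme, e.hom ≫ (punctured K).ι =
      Spec.map (CommRingCat.ofHom (algebraMap K[X] (LaurentPolynomial K))) := by
  have : IsOpenImmersion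
      (Spec.map (CommRingCat.ofHom (algebraMap K[X] (LaurentPolynomial K)))) :=
    IsOpenImmersion.of_isLocalization (X : K[X])
  refine ⟨IsOpenImmersion.isoOfRangeEq _ _ ?_, IsOpenImmersion.isoOfRangeEq_hom_fac _ _ _⟩
  rw [Scheme.Opens.range_ι]
  exact PrimeSpectrum.localization_away_comap_range (LaurentPolynomial K) (X : K[X])

/-- A family over the affine line is trivial over the complement of the origin if its base change
to the Laurent polynomials is obtained by base change from `K`. -/
theorem exists_iso_of_isPullback {K : Type u} [Field K] {X Y Z : Scheme.{u}}
    {f : X ⟶ Spec (.of K[X])} {q : Y ⟶ Spec (.of K)} {p : Z ⟶ Spec (.of (LaurentPolynomial K))}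
    {i₁ : Z ⟶ X} {i₂ : Z ⟶ Y}
    (sq₁ : IsPullback i₁ p f
      (Spec.map (CommRingCat.ofHom (algebraMap K[X] (LaurentPolynomial K)))))
    (sq₂ : IsPullback i₂ p q (Spec.map (CommRingCat.ofHom (algebraMap K (LaurentPolynomial K))))) :
    ∃ e : (f ⁻¹ᵁ punctured K).toScheme ≅ pullback q ((punctured K).ι ≫ lineStr K),
      e.hom ≫ pullback.snd q ((punctured K).ι ≫ lineStr K) = f ∣_ punctured K := by
  obtain ⟨ψ, hψ⟩ := exists_laurent_iso_punctured K
  have hK : Spec.map (CommRingCat.ofHom (algebraMap K (LaurentPolynomial K))) =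
      ψ.hom ≫ (punctured K).ι ≫ lineStr K := by
    rw [reassoc_of% hψ, lineStr, ← Spec.map_comp, ← CommRingCat.ofHom_comp]
    congr 2
    ext c : 1
    change _ = algebraMap K[X] (LaurentPolynomial K) (C c)
    rw [LaurentPolynomial.algebraMap_eq_toLaurent, Polynomial.toLaurent_C]
    rfl
  -- Transported along ψ, both squares exhibit Z as a fibre product over the punctured line, which
  -- identifies the two fibre products.
  have sq₁' := sq₁.of_iso (fst' := i₁) (snd' := p ≫ ψ.hom)
    (f' := f) (g' := (punctured K).ι) (Iso.refl _) (Iso.refl _) ψ (Iso.refl _)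
    (by simp) (by simp) (by simp) (by simp [hψ])
  have sq₂' := sq₂.of_iso (fst' := i₂) (snd' := p ≫ ψ.hom)
    (f' := q) (g' := (punctured K).ι ≫ lineStr K) (Iso.refl _) (Iso.refl _) ψ (Iso.refl _)
    (by simp) (by simp) (by simp) (by simp [hK])
  refine ⟨(isPullback_morphismRestrict f (punctured K)).flip.isoIsPullback _ _ sq₁' ≪≫ sq₂'.isoPullback, ?_⟩
  rw [Iso.trans_hom, Category.assoc, IsPullback.isoPullback_hom_snd,
    IsPullback.isoIsPullback_hom_snd]

namespace GenSystem

variable {K : Type u} [Field K] [CharZero K] {n : ℕ} {P : NormalPolytope n}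
variable {S : Stratification K P} {t : Linearization P} (G : GenSystem S t)
variable (lam : G.gens → ℤ)

/-! ### The special fibre -/

theorem symb_mem_grPiece {g : CoordRing K P} {m : ℕ} (hg : g ∈ degPiece K P m) :
    symb S t g ∈ grPiece S t m := by
  classical
  refine ⟨_, fun a => ?_, rfl⟩
  have : ((Rees.of S t (nu S t g) ⟨g, Or.inr le_rfl⟩).comp a : CoordRing K P) =
      if nu S t g = a then g else 0 := by
    refine (DirectSum.coe_of_apply (M := CoordRing K P) (A := fun a => filtGE S t a)
      _ _ _).trans ?_
    split_ifs <;> rfl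
  rw [this]
  split_ifs
  · exact hg
  · exact zero_mem _

theorem toSpecial_mem {m : ℕ} {F : MvPolynomial G.gens K[X]}
    (hF : F ∈ MvPolynomial.weightedHomogeneousSubmodule K[X] G.degs m) :
    G.toSpecial F ∈ grPiece S t m := by
  classical
  rw [F.as_sum, map_sum]
  refine sum_mem fun α hα => ?_
  rw [toSpecial, RingHom.comp_apply, MvPolynomial.map_monomial]
  change G.toGr _ ∈ _
  rw [toGr_monomial]
  refine Submodule.smul_mem _ _ ?_
  split_ifs
  · have h1 := basisFun_mem_degPiece (K := K) (mem_weightMonoid.mp (G.wtOf_mem α))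
    rw [← G.cast_weight_degs, hF (MvPolynomial.mem_support_iff.mp hα), Int.toNat_natCast] at h1
    exact symb_mem_grPiece h1
  · exact zero_mem _

variable {lam}

theorem exists_isPullback_origin (h : G.Approximates lam) : ∃ i : XZero S t ⟶ G.family lam,
    IsPullback i (XZeroStr S t) (G.toLine lam) (origin K) := by
  -- K and gr_ν become K[u]-algebras through u ↦ 0; gr_ν is then the base change of the ring of the
  -- family by `ker_toSpecial`.
  let _ : Algebra K[X] K := (evalRingHom 0).toAlgebra
  let _ : Algebra K[X] (Gr S t) := ((algebraMap K (Gr S t)).comp (evalRingHom 0)).toAlgebra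
  have : IsScalarTower K[X] K (Gr S t) := .of_algebraMap_eq fun _ => rfl
  let φ : G.BreveRing lam →ₐ[K[X]] Gr S t :=
    { Ideal.Quotient.lift _ G.toSpecial fun F hF => G.breveIdeal_le_ker h hF with
      commutes' := fun r => by
        change G.toSpecial (MvPolynomial.C r) = _
        rw [toSpecial, RingHom.comp_apply, MvPolynomial.map_C]
        exact G.toGr.commutes _ }
  have hφ : Function.Surjective φ := by
    intro y
    obtain ⟨p, rfl⟩ := G.toGr_surjective y
    refine ⟨Ideal.Quotient.mk _ (MvPolynomial.map C p), ?_⟩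
    change G.toGr (MvPolynomial.map _ (MvPolynomial.map C p)) = _
    rw [MvPolynomial.map_map, show (evalRingHom (0 : K)).comp C = RingHom.id K by ext; simp,
      MvPolynomial.map_id]
  have hbc : IsBaseChange K φ.toLinearMap := by
    refine isBaseChange_of_surjective (fun c => ⟨C c, eval_C⟩) _ hφ X eval_X fun m hm => ?_
    obtain ⟨F, rfl⟩ := Ideal.Quotient.mk_surjective m
    have hF : F ∈ RingHom.ker G.toSpecial := hm
    rw [G.ker_toSpecial h] at hF
    obtain ⟨F₁, h1, F₂, h2, rfl⟩ := Submodule.mem_sup.mp hF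
    obtain ⟨F₃, rfl⟩ := Ideal.mem_span_singleton.mp h2
    refine ⟨Ideal.Quotient.mk _ F₃, ?_⟩
    rw [map_add, Ideal.Quotient.eq_zero_iff_mem.mpr h1, zero_add, map_mul, Algebra.smul_def]
    rfl
  have key := exists_isPullback_of_isBaseChange
    (A := MvPolynomial G.gens K[X] ⧸ G.breveIdeal lam) (B := Gr S t) (R := K[X]) (S := K)
    (G.brevePiece lam) (grPiece S t) φ (by
      rintro m _ ⟨F, hF, rfl⟩
      exact G.toSpecial_mem hF) hbc
  exact key

variable (lam)

/-! ### The total space -/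

/-- The variable of a lattice point has degree one and maps to a power of T times a nonzero basis
element. This keeps the family nonempty and dominant over the line. -/
theorem exists_brevePiece_one : ∃ x ∈ G.brevePiece lam 1, x ≠ 0 := by
  obtain ⟨χ⟩ := LatPts.nonempty P
  let l : G.gens := ⟨χ.wt, G.wt_mem χ⟩
  refine ⟨Ideal.Quotient.mk _ (MvPolynomial.monomial (Finsupp.single l 1) 1),
    ⟨_, MvPolynomial.isWeightedHomogeneous_monomial _ _ _ ?_, rfl⟩, fun h => ?_⟩
  · rw [Finsupp.weight_single, one_smul]
    rfl
  · have h1 := congrArg (laurentCoeff (lam l)) (congrArg (G.toGeneric lam) h)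
    rw [map_zero, map_zero, toGeneric_mk, spread_monomial, laurentCoeff_tmul, map_one, one_mul,
      Finsupp.weight_single, one_smul, wtOf_single, one_smul] at h1
    refine basisFun_ne_zero (K := K) (wt_mem_weightMonoid χ) ?_
    rwa [LaurentPolynomial.T, AddMonoidAlgebra.coeff_single, Finsupp.single_eq_same, one_smul]
      at h1

/-- All variables have degree at least 1, so only constants in x have degree 0. -/
theorem algebraMap_brevePiece_zero_surjective :
    Function.Surjective (algebraMap K[X] (G.brevePiece lam 0)) := by
  rintro ⟨_, F, hF, rfl⟩
  refine ⟨F.coeff 0, Subtype.ext ?_⟩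
  have hC : F = MvPolynomial.C (F.coeff 0) := by
    ext1 α
    rw [MvPolynomial.coeff_C]
    split_ifs with h
    · rw [h]
    · by_contra h0
      have h1 := hF h0
      rw [Finsupp.weight_apply, Finsupp.sum, Finset.sum_eq_zero_iff] at h1
      refine h (Finsupp.ext fun l => ?_)
      by_contra h2
      have h3 := h1 l (Finsupp.mem_support_iff.mpr (Ne.symm h2))
      have h4 : 1 ≤ G.degs l := by
        have := G.one_le_fst l.1 l.2
        rw [degs]
        omega
      rw [smul_eq_mul, Nat.mul_eq_zero] at h3
      rcases h3 with h3 | h3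
      · exact h2 h3.symm
      · omega
  exact congrArg (Ideal.Quotient.mk (G.breveIdeal lam)) hC.symm

theorem toLine_isProper : IsProper (G.toLine lam) := by
  have : Algebra.FiniteType K[X] (G.BreveRing lam) := inferInstance
  have h := G.algebraMap_brevePiece_zero_surjective lam
  have key := @projStr_isProper K[X] (MvPolynomial G.gens K[X] ⧸ G.breveIdeal lam) _ _ _
    (G.brevePiece lam) inferInstance
  exact key h

theorem family_isIntegral : IsIntegral (G.family lam) := by
  obtain ⟨x, hx, hx0⟩ := G.exists_brevePiece_one lam
  have key := @proj_isIntegral K[X] (MvPolynomial G.gens K[X] ⧸ G.breveIdeal lam) _ _ _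
    (G.brevePiece lam) inferInstance inferInstance
  exact key hx one_pos hx0

theorem toLine_flat : Flat (G.toLine lam) := by
  have h := G.algebraMap_breveRing_injective lam
  have key := @projStr_flat K[X] (MvPolynomial G.gens K[X] ⧸ G.breveIdeal lam) _ _ _
    (G.brevePiece lam) inferInstance inferInstance inferInstance inferInstance
  exact key h

theorem toLine_surjective : Surjective (G.toLine lam) := by
  obtain ⟨x, hx, hx0⟩ := G.exists_brevePiece_one lam
  have hs := G.algebraMap_brevePiece_zero_surjective lam
  have hinj := G.algebraMap_breveRing_injective lam
  have key := @projStr_surjective K[X] (MvPolynomial G.gens K[X] ⧸ G.breveIdeal lam) _ _ _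
    (G.brevePiece lam) inferInstance inferInstance
  exact key hs hinj hx one_pos hx0

theorem family_isVariety : IsIntegral (G.family lam) ∧
    IsSeparated (G.toLine lam ≫ lineStr K) ∧
    LocallyOfFiniteType (G.toLine lam ≫ lineStr K) ∧
    QuasiCompact (G.toLine lam ≫ lineStr K) := by
  have := G.toLine_isProper lam
  have h1 : IsAffineHom (lineStr K) := by unfold lineStr; infer_instance
  have h2 : LocallyOfFiniteType (lineStr K) := by
    rw [lineStr, HasRingHomProperty.Spec_iff (P := @LocallyOfFiniteType)]
    exact (RingHom.finiteType_algebraMap (A := K) (B := K[X])).mpr inferInstance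
  exact ⟨G.family_isIntegral lam, inferInstance, inferInstance, inferInstance⟩

/-! ### The complement of the special fibre -/

/-- The grading of `K[T, T⁻¹] ⊗ K[X̂_P]` induced by that of `K[X̂_P]`. -/
abbrev laurentPiece (K : Type u) [Field K] (P : NormalPolytope n) (m : ℕ) :
    Submodule (LaurentPolynomial K) (LaurentPolynomial K ⊗[K] CoordRing K P) :=
  (degPiece K P m).baseChange (LaurentPolynomial K)

/-- The structure morphism of `X_P × Spec K[T, T⁻¹]`. -/
abbrev laurentProjStr (K : Type u) [Field K] [CharZero K] (P : NormalPolytope n) :=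
  @projStr (LaurentPolynomial K) (LaurentPolynomial K ⊗[K] CoordRing K P) _ _ _
    (laurentPiece K P) inferInstance

theorem exists_isPullback_toLine : ∃ i, IsPullback i (laurentProjStr K P) (G.toLine lam)
      (Spec.map (CommRingCat.ofHom (algebraMap K[X] (LaurentPolynomial K)))) := by
  have key := @exists_isPullback_of_isBaseChange K[X] (LaurentPolynomial K)
    (MvPolynomial G.gens K[X] ⧸ G.breveIdeal lam) (LaurentPolynomial K ⊗[K] CoordRing K P)
    _ _ _ _ _ _ _ _ _ (G.brevePiece lam) (laurentPiece K P) _ _ (G.toGeneric lam)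
  exact key (fun m x hx => G.toGeneric_mem lam hx) (G.toGeneric_isBaseChange lam)

theorem exists_isPullback_XPStr (K : Type u) [Field K] [CharZero K] (P : NormalPolytope n) :
    ∃ i, IsPullback i (laurentProjStr K P) (XPStr K P)
      (Spec.map (CommRingCat.ofHom (algebraMap K (LaurentPolynomial K)))) := by
  have key := @exists_isPullback_of_isBaseChange K (LaurentPolynomial K)
    (CoordRing K P) (LaurentPolynomial K ⊗[K] CoordRing K P)
    _ _ _ _ _ _ _ _ _ (degPiece K P) (laurentPiece K P) _ _ Algebra.TensorProduct.includeRight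
  exact key (fun _ _ hx => Submodule.tmul_mem_baseChange_of_mem _ hx)
    (TensorProduct.isBaseChange K (CoordRing K P) (LaurentPolynomial K))

theorem exists_trivialization :
    ∃ e : (G.toLine lam ⁻¹ᵁ punctured K).toScheme ≅
        pullback (XPStr K P) ((punctured K).ι ≫ lineStr K),
      e.hom ≫ pullback.snd (XPStr K P) ((punctured K).ι ≫ lineStr K) =
        G.toLine lam ∣_ punctured K := by
  obtain ⟨i₁, sq₁⟩ := G.exists_isPullback_toLine lam
  obtain ⟨i₂, sq₂⟩ := exists_isPullback_XPStr K P
  exact exists_iso_of_isPullback sq₁ sq₂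

end GenSystem

end

end ToricSeshadri

end

theorem mainTheorem3 {K : Type u} [Field K] [IsAlgClosed K] [CharZero K] {n : ℕ}
    (P : NormalPolytope n) (S : Stratification K P) (t : Linearization P) :
    Nonempty (GenSystem S t) ∧
    ∀ G : GenSystem S t,
      (∃ lam : G.gens → ℤ, G.Approximates lam) ∧
      ∀ lam : G.gens → ℤ, G.Approximates lam →
        -- the total space is a variety
        (IsIntegral (G.family lam) ∧
          IsSeparated (G.toLine lam ≫ lineStr K) ∧
          LocallyOfFiniteType (G.toLine lam ≫ lineStr K) ∧
          QuasiCompact (G.toLine lam ≫ lineStr K)) ∧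
        Flat (G.toLine lam) ∧
        Surjective (G.toLine lam) ∧
        -- the fibre over the origin is `X_0`
        (∃ i : XZero S t ⟶ G.family lam,
          IsPullback i (XZeroStr S t) (G.toLine lam) (origin K)) ∧
        -- the family is trivial with fibre `X_P` over the complement of the origin
        ∃ e : (G.toLine lam ⁻¹ᵁ punctured K).toScheme ≅
            pullback (XPStr K P) ((punctured K).ι ≫ lineStr K),
          e.hom ≫ pullback.snd (XPStr K P) ((punctured K).ι ≫ lineStr K) =
            G.toLine lam ∣_ punctured K :=
  ⟨nonempty_genSystem S t, fun G => ⟨G.exists_approximates, fun lam h =>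
    ⟨G.family_isVariety lam, G.toLine_flat lam, G.toLine_surjective lam,
      G.exists_isPullback_origin h, G.exists_trivialization lam⟩⟩⟩
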